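/- **Correctness of the graph algorithm for $d=2$.** Let $A\in\mathbb R^{m\times 2}$, $m\ge 3$, with rows $A_1,\dots,A_m$, let $P=\{x\in\mathbb R^2\mid Ax\le \mathbb 1\}$, suppose that $\{x\mid A_1x\le1,\,A_2x\le1,\,A_3x\le1\}$ is a triangle (so $P$ is a polytope), let $\varepsilon\ge 0$ and $(1+\varepsilon)P=\{x\mid Ax\le(1+\varepsilon)\mathbb 1\}$. *Algorithm.* It maintains a plane graph $G=(V,E)$, each face of which is marked valid or invalid, and coordinates $c:V\to\mathbb R^2$. Start with $G=K_3$, one of its two faces being valid and the other one invalid, and let $c$ map the three nodes bijectively to the vertices of the triangle $\{x\mid A_ix\le 1+\frac\varepsilon2,\ i=1,2,3\}$. For $i=4,\dots,m$ do the following, where all choices are arbitrary: 1. Partition $V$ into disjoint sets $V_-\ne\emptyset$, $V_0$, $V_+$ such that $A_ic(v)<1+\frac\varepsilon2$ on $V_-$, $A_ic(v)>1+\frac\varepsilon2$ on $V_+$, and $1\le A_ic(v)\le1+\varepsilon$ on $V_0$. 2. Subdivide each edge $uw$ with $u\in V_-$, $w\in V_+$ by a new node $v$, put $v$ into $V_0$,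 and choose $c(v)$ on the line segment between $c(u)$ and $c(w)$ with $1\le A_ic(v)\le 1+\varepsilon$. 3. Visit, in any order, all pairs of edges $u_0u_+,w_0w_+$ with $u_0,w_0\in V_0$ and $u_+,w_+\in V_+$. If at that moment $u_0\ne w_0$, $u_0w_0\notin E$, and there is a walk from $u_0$ to $w_0$ along a bounding walk of some valid face, with all intermediate nodes in $V_+$ or all intermediate nodes outside $V_-$, then draw the edge $u_0w_0$ inside this face. This splits the face into two valid faces. 4. Delete $V_+$ and all edges incident with nodes of $V_+$. A face that arises by merging faces is valid if and only if all of the merged faces are valid. The output is the final $(G,c)$. *Claim.* The algorithm is well defined and correct: it can be started, no sequence of choices leads to a situation in which a step cannot be carried out, every run is finite, and for the output of every run $$P\subseteq \operatorname{conv}c(V)\subseteq(1+\varepsilon)P .$$ Moreover, after the initialization and after each iteration $i$ the following holds. The nodes, edges, bounding walks and faces form a consistent half-edge structure of a simple graph: each edge $uw$ joins two distinct nodes of $V$ and is stored as the two half-edges $(u,w)$, $(w,u)$, a bounding walk continues at the head of a half-edge by a permutation of the half-edges and stays on one face, and the half-edges leaving a node are permuted cyclically by the rotation at this node. In addition: *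 (A) For every edge $uv\in E$ there is $\kappa\in\{1,\dots,m\}$ such that the segment $\operatorname{conv}\{c(u),c(v)\}$ lies in the half-plane $\{x\mid A_\kappa x\ge1\}$. * (B) For a dense set of directions $r\in\mathbb R^2\setminus\{0\}$ with $c(v)\notin\mathbb R r$ for all $v\in V$, the number $\sum_f N(f,r)$ is odd. Here the sum is over all valid faces $f$, and $N(f,r)$ is the number of edges $uv$ in the boundary of $f$ whose segment $\operatorname{conv}\{c(u),c(v)\}$ meets the ray $\mathbb R_+r$, an edge that has $f$ on both sides being counted twice. -/

import Mathlib

namespace GraphAlg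

/-- A finite simple plane graph, stored as a half-edge structure.

The nodes are natural numbers.  An edge `uw` is stored as the two half-edges `(u, w)` and
`(w, u)`; each half-edge lies on exactly one face, the one on its fixed (say, left) side.
* `next d` is the half-edge that follows `d` when one walks along the boundary of the face
  of `d`; the orbits of `next` are the bounding walks of the faces;
* `face d` is the name of the face on which `d` lies (a face may have several bounding walks
  if the graph is not connected);
* `valid` is the set of the names of the valid faces.
Values of `next` and `face` outside `darts` are irrelevant. -/
structure PlaneGraph where
  verts : Finset ℕ
  darts : Finset (ℕ × ℕ)
  next : ℕ × ℕ → ℕ × ℕ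
  face : ℕ × ℕ → ℕ
  valid : Set ℕ

namespace PlaneGraph

/-- Consistency of a half-edge structure: half-edges come in opposite pairs, join distinct
nodes, `next` permutes the half-edges and continues at the head of a half-edge, the rotation
`d ↦ next d.swap` at each node runs cyclically through all half-edges leaving this node, and
a bounding walk stays on one face. -/
def Consistent (G : PlaneGraph) : Prop :=
  (∀ d ∈ G.darts, d.swap ∈ G.darts ∧ d.1 ≠ d.2 ∧ d.1 ∈ G.verts) ∧
  Set.BijOn G.next (G.darts : Set (ℕ × ℕ)) (G.darts : Set (ℕ × ℕ)) ∧
  (∀ d ∈ G.darts, (G.next d).1 = d.2) ∧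
  (∀ d ∈ G.darts, ∀ e ∈ G.darts, d.1 = e.1 →
    ∃ k : ℕ, (fun x => G.next x.swap)^[k] d = e) ∧
  (∀ d ∈ G.darts, G.face (G.next d) = G.face d)

/-- The complete graph `K₃`, with one valid face (number `0`) and one invalid face. -/
def K3 : PlaneGraph where
  verts := {0, 1, 2}
  darts := {(0, 1), (1, 2), (2, 0), (1, 0), (2, 1), (0, 2)}
  next := fun d => (d.2, 3 - d.1 - d.2)
  face := fun d => if d = (0, 1) ∨ d = (1, 2) ∨ d = (2, 0) then 0 else 1
  valid := {0}

/-- Replace the edge `uw` by two edges `uv` and `vw`, where `v` is a new node. -/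
def subdivide (G : PlaneGraph) (u w v : ℕ) : PlaneGraph :=
  let ren : ℕ × ℕ → ℕ × ℕ := fun d =>
    if d = (u, w) then (u, v) else if d = (w, u) then (w, v) else d
  { verts := insert v G.verts
    darts := (G.darts \ {(u, w), (w, u)}) ∪ {(u, v), (v, w), (w, v), (v, u)}
    next := fun d =>
      if d = (u, v) then (v, w)
      else if d = (v, w) then ren (G.next (u, w))
      else if d = (w, v) then (v, u)
      else if d = (v, u) then ren (G.next (w, u))
      else ren (G.next d)
    face := fun d =>
      if d = (u, v) ∨ d = (v, w) then G.face (u, w)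
      else if d = (w, v) ∨ d = (v, u) then G.face (w, u)
      else G.face d
    valid := G.valid }

/-- Draw a new edge inside the valid face that contains the half-edges `a` and `b`, from the
corner just before `a` (at the node `a.1`) to the corner just before `b` (at the node `b.1`).
The face is split into two valid faces: the half-edges in `X` lie on the face with the new
name `l`, the others on the face that keeps the old name. -/
def addEdge (G : PlaneGraph) (a b : ℕ × ℕ) (l : ℕ) (X : Finset (ℕ × ℕ)) : PlaneGraph where
  verts := G.verts
  darts := insert (a.1, b.1) (insert (b.1, a.1) G.darts)
  next := fun d =>
    if d = (a.1, b.1) then b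
    else if d = (b.1, a.1) then a
    else if G.next d = a then (a.1, b.1)
    else if G.next d = b then (b.1, a.1)
    else G.next d
  face := fun d => if d ∈ X then l else if d = (a.1, b.1) then G.face a else G.face d
  valid := insert l G.valid

/-- Admissible parameters of `addEdge`: `l` is a new name, and `X` consists of one of the two
new half-edges and of half-edges of the face that is split, in such a way that every bounding
walk of the new graph lies on a single face and the two sides of the new edge lie on different
faces. -/
def IsSplitting (G : PlaneGraph) (a b : ℕ × ℕ) (l : ℕ) (X : Finset (ℕ × ℕ)) : Prop :=
  (∀ d ∈ G.darts, G.face d ≠ l) ∧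
  (b.1, a.1) ∈ X ∧ (a.1, b.1) ∉ X ∧
  (∀ d ∈ X, d = (b.1, a.1) ∨ (d ∈ G.darts ∧ G.face d = G.face a)) ∧
  (∀ d ∈ (G.addEdge a b l X).darts, (d ∈ X ↔ (G.addEdge a b l X).next d ∈ X))

/-- The smallest equivalence relation on face names that identifies the two faces on both
sides of each edge incident with some node of `R`: two faces are related if they are merged
when these edges are deleted. -/
def Merged (G : PlaneGraph) (R : Finset ℕ) : ℕ → ℕ → Prop :=
  Relation.EqvGen fun f g =>
    ∃ d ∈ G.darts, (d.1 ∈ R ∨ d.2 ∈ R) ∧ G.face d = f ∧ G.face d.swap = g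

/-- Delete all edges incident with nodes of `R`, and the nodes of `R`.  A merged face is named
by the least name of the faces it consists of, and it is valid if and only if all of these
faces are valid.  The successor of a remaining half-edge is the first remaining one in the
rotation at its head. -/
noncomputable def remove (G : PlaneGraph) (R : Finset ℕ) : PlaneGraph where
  verts := G.verts \ R
  darts := G.darts.filter fun d => d.1 ∉ R ∧ d.2 ∉ R
  next := fun d =>
    (fun x => G.next x.swap)^[sInf {k | ((fun x => G.next x.swap)^[k] (G.next d)).2 ∉ R}]
      (G.next d)
  face := fun d => sInf {g | G.Merged R (G.face d) g}
  valid := {f | ∀ g, G.Merged R f g → g ∈ G.valid}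

end PlaneGraph

/-- A plane graph with a coordinate function (only its values on the nodes are relevant). -/
structure State where
  graph : PlaneGraph
  coord : ℕ → Fin 2 → ℝ

/-- The points `c(v)` of all nodes `v`. -/
def State.points (S : State) : Set (Fin 2 → ℝ) := S.coord '' (S.graph.verts : Set ℕ)

/-- The line segment `c(e)` of an edge `e`, given by one of its two half-edges. -/
def State.seg (S : State) (d : ℕ × ℕ) : Set (Fin 2 → ℝ) :=
  segment ℝ (S.coord d.1) (S.coord d.2)

/-- The H-polyhedron `{x | A x ≤ t 𝟙}`. -/
def hpoly {m : ℕ} (A : Matrix (Fin m) (Fin 2) ℝ) (t : ℝ) : Set (Fin 2 → ℝ) :=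
  {x | ∀ i, A i ⬝ᵥ x ≤ t}

/-- The matrix that consists of the first three rows of `A`. -/
def firstRows {m : ℕ} (hm : 3 ≤ m) (A : Matrix (Fin m) (Fin 2) ℝ) : Matrix (Fin 3) (Fin 2) ℝ :=
  fun i => A (Fin.castLE hm i)

/-- A two-dimensional simplex: the convex hull of three affinely independent points. -/
def IsTriangle (T : Set (Fin 2 → ℝ)) : Prop :=
  ∃ p : Fin 3 → Fin 2 → ℝ, AffineIndependent ℝ p ∧ T = convexHull ℝ (Set.range p)

/-! ### The algorithm -/

/-- Three sets of nodes `V₋`, `V₀`, `V₊`. -/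
structure Tri where
  neg : Finset ℕ
  zero : Finset ℕ
  pos : Finset ℕ

/-- `T` is a partition of the node set as the algorithm may choose it for the inequality
`a x ≤ 1`. -/
def IsPartition (a : Fin 2 → ℝ) (ε : ℝ) (S : State) (T : Tri) : Prop :=
  T.neg ∪ T.zero ∪ T.pos = S.graph.verts ∧
  Disjoint T.neg T.zero ∧ Disjoint T.neg T.pos ∧ Disjoint T.zero T.pos ∧
  T.neg.Nonempty ∧
  (∀ v ∈ T.neg, a ⬝ᵥ S.coord v < 1 + ε / 2) ∧
  (∀ v ∈ T.pos, 1 + ε / 2 < a ⬝ᵥ S.coord v) ∧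
  (∀ v ∈ T.zero, 1 ≤ a ⬝ᵥ S.coord v ∧ a ⬝ᵥ S.coord v ≤ 1 + ε)

/-- The portion of a bounding walk from the start of the half-edge `a` to the start of the
half-edge `b` has all intermediate nodes in `V₊`, or all of them outside `V₋`. -/
def WalkOK (G : PlaneGraph) (T : Tri) (a b : ℕ × ℕ) : Prop :=
  ∃ n : ℕ, G.next^[n] a = b ∧
    ((∀ j, 0 < j → j < n → (G.next^[j] a).1 ∈ T.pos) ∨
     (∀ j, 0 < j → j < n → (G.next^[j] a).1 ∉ T.neg))

/-- An edge between `u` and `w` is to be added, in the valid face of the half-edges `a` and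
`b`: the nodes are distinct and not adjacent, and there is a suitable walk (in one of the two
directions) between them along a bounding walk of this face. -/
def Eligible (G : PlaneGraph) (T : Tri) (u w : ℕ) (a b : ℕ × ℕ) : Prop :=
  u ≠ w ∧ (u, w) ∉ G.darts ∧
  a ∈ G.darts ∧ b ∈ G.darts ∧ a.1 = u ∧ b.1 = w ∧
  G.face a = G.face b ∧ G.face a ∈ G.valid ∧
  (WalkOK G T a b ∨ WalkOK G T b a)

/-- The edges `u₀u₊` with `u₀ ∈ V₀` and `u₊ ∈ V₊`, as half-edges leaving `u₀`. -/
def borderEdges (G : PlaneGraph) (T : Tri) : Finset (ℕ × ℕ) :=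
  G.darts.filter fun d => d.1 ∈ T.zero ∧ d.2 ∈ T.pos

/-- Configurations of the algorithm.  Rows of `A` are numbered from `0`, thus `head k S` means
that the first `k` inequalities have been treated. -/
inductive Config where
  /-- before an outer iteration, or at termination -/
  | head (k : ℕ) (S : State)
  /-- in the first inner loop of the outer iteration that treats row `k` -/
  | first (k : ℕ) (S : State) (T : Tri)
  /-- in the second inner loop; `L` lists the pairs of edges still to be visited -/
  | second (k : ℕ) (S : State) (T : Tri) (L : List ((ℕ × ℕ) × (ℕ × ℕ)))

/-- One (nondeterministic) step of the graph algorithm. -/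
inductive Step {m : ℕ} (A : Matrix (Fin m) (Fin 2) ℝ) (ε : ℝ) : Config → Config → Prop
  /-- start of an outer iteration: partition the node set -/
  | partition (k : ℕ) (hk : k < m) (S : State) (T : Tri) (hT : IsPartition (A ⟨k, hk⟩) ε S T) :
      Step A ε (.head k S) (.first k S T)
  /-- first inner loop: subdivide an edge between `V₋` and `V₊` by a new node `v ∈ V₀`, with
  coordinates on the line segment and between the two parallel lines -/
  | subdivide (k : ℕ) (hk : k < m) (S : State) (T : Tri) (u w v : ℕ) (x : Fin 2 → ℝ)
      (he : (u, w) ∈ S.graph.darts) (hu : u ∈ T.neg) (hw : w ∈ T.pos)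
      (hv : v ∉ S.graph.verts) (hx : x ∈ segment ℝ (S.coord u) (S.coord w))
      (h1 : 1 ≤ A ⟨k, hk⟩ ⬝ᵥ x) (h2 : A ⟨k, hk⟩ ⬝ᵥ x ≤ 1 + ε) :
      Step A ε (.first k S T)
        (.first k ⟨S.graph.subdivide u w v, Function.update S.coord v x⟩
          ⟨T.neg, insert v T.zero, T.pos⟩)
  /-- the first inner loop ends; the second one visits all pairs of edges between `V₀` and `V₊`,
  in some order -/
  | toSecond (k : ℕ) (S : State) (T : Tri) (L : List ((ℕ × ℕ) × (ℕ × ℕ)))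
      (hend : ∀ d ∈ S.graph.darts, ¬ (d.1 ∈ T.neg ∧ d.2 ∈ T.pos))
      (hL : ∀ p, p ∈ L ↔ p.1 ∈ borderEdges S.graph T ∧ p.2 ∈ borderEdges S.graph T) :
      Step A ε (.first k S T) (.second k S T L)
  /-- second inner loop: the visited pair leads to a new edge -/
  | add (k : ℕ) (S : State) (T : Tri) (d e : ℕ × ℕ) (L : List ((ℕ × ℕ) × (ℕ × ℕ)))
      (a b : ℕ × ℕ) (l : ℕ) (X : Finset (ℕ × ℕ))
      (hab : Eligible S.graph T d.1 e.1 a b) (hX : S.graph.IsSplitting a b l X) :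
      Step A ε (.second k S T ((d, e) :: L)) (.second k ⟨S.graph.addEdge a b l X, S.coord⟩ T L)
  /-- second inner loop: the visited pair does not satisfy the conditions -/
  | skip (k : ℕ) (S : State) (T : Tri) (d e : ℕ × ℕ) (L : List ((ℕ × ℕ) × (ℕ × ℕ)))
      (hab : ∀ a b, ¬ Eligible S.graph T d.1 e.1 a b) :
      Step A ε (.second k S T ((d, e) :: L)) (.second k S T L)
  /-- end of an outer iteration: delete `V₊` and all edges incident with it -/
  | remove (k : ℕ) (S : State) (T : Tri) :
      Step A ε (.second k S T []) (.head (k + 1) ⟨S.graph.remove T.pos, S.coord⟩)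

/-- Initial configurations: the graph is `K₃`, and its nodes are placed at the three vertices
of `{x | A x ≤ (1 + ε/2) 𝟙}`, where only the first three rows of `A` are used. -/
def IsInitial {m : ℕ} (hm : 3 ≤ m) (A : Matrix (Fin m) (Fin 2) ℝ) (ε : ℝ) (C : Config) : Prop :=
  ∃ c : ℕ → Fin 2 → ℝ,
    Set.BijOn c (PlaneGraph.K3.verts : Set ℕ)
      (Set.extremePoints ℝ (hpoly (firstRows hm A) (1 + ε / 2))) ∧
    C = .head 3 ⟨PlaneGraph.K3, c⟩

/-- `C` occurs in some run of the algorithm. -/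
def Reachable {m : ℕ} (hm : 3 ≤ m) (A : Matrix (Fin m) (Fin 2) ℝ) (ε : ℝ) (C : Config) : Prop :=
  ∃ C₀, IsInitial hm A ε C₀ ∧ Relation.ReflTransGen (Step A ε) C₀ C

/-! ### The invariants -/

/-- The ray `ℝ₊ r`. -/
def ray (r : Fin 2 → ℝ) : Set (Fin 2 → ℝ) := {x | ∃ t : ℝ, 0 ≤ t ∧ x = t • r}

open Classical in
/-- The number of boundary crossings of the face `f` with the ray `ℝ₊ r`; an edge that occurs
twice in bounding walks of `f` has both of its half-edges on `f` and is counted twice. -/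
noncomputable def crossings (S : State) (f : ℕ) (r : Fin 2 → ℝ) : ℕ :=
  (S.graph.darts.filter fun d => S.graph.face d = f ∧ (S.seg d ∩ ray r).Nonempty).card

open Classical in
/-- The sum of the numbers of boundary crossings over all valid faces. -/
noncomputable def totalCrossings (S : State) (r : Fin 2 → ℝ) : ℕ :=
  ∑ f ∈ (S.graph.darts.image S.graph.face).filter (· ∈ S.graph.valid), crossings S f r

/-- Every edge lies in one of the half-planes `A_κ x ≥ 1`, and for a dense set of directions `r`
(whose lines miss all points `c(v)`) the total number of crossings is odd. -/
def Regular {m : ℕ} (A : Matrix (Fin m) (Fin 2) ℝ) (S : State) : Prop :=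
  (∀ d ∈ S.graph.darts, ∃ κ : Fin m, S.seg d ⊆ {x | 1 ≤ A κ ⬝ᵥ x}) ∧
  Dense {r : Fin 2 → ℝ | r ≠ 0 ∧ (∀ v ∈ S.graph.verts, ∀ t : ℝ, S.coord v ≠ t • r) ∧
    Odd (totalCrossings S r)}

end GraphAlg

namespace GraphAlg

/-! ### Iterates and first returns -/

section Iterate

variable {α : Type*} {f : α → α} {s : Set α}

/-! Planarity enters only through homology modulo two: every cycle bounds a set of faces
(`CyclesBound`), a property preserved by subdividing, drawing and deleting. For a generic direction
`r`, "the edge meets the ray" is a cochain `φ` (`crossing`). A half-plane `a x ≥ 1` misses the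
origin, and on edges inside it `φ` is the coboundary of `side` (`crossing_eq_side`); hence closed
walks in such a half-plane are even.

The parity of the total number of crossings is not inductive by itself: it does not tell which faces
carry the odd crossings, hence not what is lost when a face merges with the invalid one. The
stronger invariant is `IsOddDart`: exactly one bounding walk of the valid faces is odd, and its
component touches an invalid face. Subdivision preserves it because every edge lies in some
half-plane `A κ x ≥ 1`. A drawn edge cuts off a closed walk through nodes outside `V₋`, thus in the
half-plane of the current row; this walk is even, so the oddness stays on the rest. After the second
inner loop, every portion of a valid bounding walk that runs through `V₊` has equal or adjacent end
nodes. Closing these portions up yields even cycles in the same half-plane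
(`Removable.exists_cycle`). Pairing cycles with `φ` shows that some odd half-edge survives the
deletion, that its face does not merge with the invalid one (`IsOddDart.valid_remove`), and that its
component still touches an invalid face (`IsOddDart.joined_remove`).

An odd number is not zero, so rays in a dense set of directions meet edges
(`Sound.exists_crossing`). This makes `V₋` nonempty possible in every iteration. It also gives the
inclusion of `P`: if a line separated `x ∈ P` from the convex hull, a ray close to `x` would meet an
edge at a point with some `A κ z ≥ 1`, which already lies beyond the line. The other inclusion holds
since new nodes lie on old segments and nodes violating a row are deleted. Termination follows from
a lexicographic rank. -/

theorem iterate_mem (h : Set.MapsTo f s s) {x : α} (hx : x ∈ s) (n : ℕ) : f^[n] x ∈ s :=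
  h.iterate n hx

/-- Points of a finite set are periodic under a map that permutes this set. -/
theorem exists_iterate_eq_self (hs : s.Finite) (h : Set.BijOn f s s) {x : α} (hx : x ∈ s) :
    ∃ n, f^[n + 1] x = x := by
  have hmaps : Set.MapsTo (fun n : ℕ => f^[n] x) Set.univ s :=
    fun n _ => iterate_mem h.mapsTo hx n
  obtain ⟨i, -, j, -, hij, he⟩ :=
    Set.infinite_univ.exists_lt_map_eq_of_mapsTo hmaps hs
  refine ⟨j - i - 1, ?_⟩
  have hji : i + (j - i - 1 + 1) = j := by omega
  have he' : f^[i] x = f^[i] (f^[j - i - 1 + 1] x) := by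
    rw [← Function.iterate_add_apply, hji]; exact he
  exact ((h.injOn.iterate h.mapsTo i) hx (iterate_mem h.mapsTo hx _) he').symm

theorem exists_iterate_symm (hs : s.Finite) (h : Set.BijOn f s s) {x y : α} (hx : x ∈ s)
    (hxy : ∃ n, f^[n] x = y) : ∃ n, f^[n] y = x := by
  obtain ⟨n, rfl⟩ := hxy
  obtain ⟨k, hk⟩ := exists_iterate_eq_self hs h hx
  have hk' : ∀ j, f^[(k + 1) * j] x = x := by
    intro j
    rw [Function.iterate_mul]
    exact Function.iterate_fixed hk j
  -- Since `k + 1` is a period of `x`, completing the `n` steps to `(k + 1) * n` leads back to `x`.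
  refine ⟨(k + 1) * n - n, ?_⟩
  rw [← Function.iterate_add_apply]
  have : (k + 1) * n - n + n = (k + 1) * n := by
    have : n ≤ (k + 1) * n := Nat.le_mul_of_pos_left n (Nat.succ_pos k)
    omega
  rw [this, hk']

/-- The first point of the set `t` on the forward orbit of `f x`. -/
noncomputable def firstReturn (f : α → α) (t : Set α) (x : α) : α :=
  f^[sInf {k | f^[k] (f x) ∈ t}] (f x)

variable {t : Set α}

/-- Periodicity makes the set of return times nonempty, so the default value of `sInf` never occurs.
The exponent is `k + 1` because the search starts at `f x`. -/
theorem firstReturn_spec (hs : s.Finite) (h : Set.BijOn f s s) (hts : t ⊆ s) {x : α}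
    (hx : x ∈ t) : ∃ k, firstReturn f t x = f^[k + 1] x ∧ f^[k + 1] x ∈ t ∧
      ∀ j < k, f^[j + 1] x ∉ t := by
  obtain ⟨n, hn⟩ := exists_iterate_eq_self hs h (hts hx)
  have hne : {k | f^[k] (f x) ∈ t}.Nonempty := ⟨n, by
    change f^[n + 1] x ∈ t
    rwa [hn]⟩
  refine ⟨sInf {k | f^[k] (f x) ∈ t}, rfl, Nat.sInf_mem hne, fun j hj hj' => ?_⟩
  exact Nat.notMem_of_lt_sInf hj hj'

/-- If `x` and `y` return to the same point after `i + 1 ≤ j + 1` steps, cancelling `i + 1` steps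
puts `x` on the orbit of `y` strictly before the first return of `y`, unless `i = j`. -/
theorem bijOn_firstReturn (hs : s.Finite) (h : Set.BijOn f s s) (hts : t ⊆ s) :
    Set.BijOn (firstReturn f t) t t := by
  have hmaps : Set.MapsTo (firstReturn f t) t t := by
    intro x hx
    obtain ⟨k, hk, hk', -⟩ := firstReturn_spec hs h hts hx
    rwa [hk]
  have hinj : Set.InjOn (firstReturn f t) t := by
    have key : ∀ x ∈ t, ∀ y ∈ t, ∀ i j, i ≤ j → f^[i + 1] x = f^[j + 1] y →
        (∀ l < j, f^[l + 1] y ∉ t) → x = y := by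
      intro x hx y hy i j hij he hj
      have he' : f^[i + 1] x = f^[i + 1] (f^[j - i] y) := by
        rw [← Function.iterate_add_apply, he, show i + 1 + (j - i) = j + 1 by omega]
      have hxy := (h.injOn.iterate h.mapsTo (i + 1)) (hts hx)
        (iterate_mem h.mapsTo (hts hy) _) he'
      rcases Nat.eq_zero_or_pos (j - i) with h0 | h0
      · rw [h0] at hxy; exact hxy
      · refine absurd hx ?_
        rw [hxy, show j - i = (j - i - 1) + 1 by omega]
        exact hj _ (by omega)
    intro x hx y hy hxy
    obtain ⟨i, hi, -, hi'⟩ := firstReturn_spec hs h hts hx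
    obtain ⟨j, hj, -, hj'⟩ := firstReturn_spec hs h hts hy
    rw [hi, hj] at hxy
    rcases le_total i j with hij | hij
    · exact key x hx y hy i j hij hxy hj'
    · exact (key y hy x hx j i hij hxy.symm hi').symm
  exact ((hs.subset hts).injOn_iff_bijOn_of_mapsTo hmaps).1 hinj

/-- An orbit segment with ends in `t` is a concatenation of excursions. This carries the cyclicity
of rotations over to the graph after a deletion. -/
theorem exists_iterate_firstReturn (hs : s.Finite) (h : Set.BijOn f s s) (hts : t ⊆ s) (n : ℕ) :
    ∀ x ∈ t, f^[n] x ∈ t → ∃ k, (firstReturn f t)^[k] x = f^[n] x := by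
  induction n using Nat.strong_induction_on with
  | _ n ih =>
    intro x hx hn
    rcases Nat.eq_zero_or_pos n with rfl | hpos
    · exact ⟨0, rfl⟩
    obtain ⟨k, hk, hk', hmin⟩ := firstReturn_spec hs h hts hx
    have hkn : k + 1 ≤ n := by
      by_contra hlt
      refine hmin (n - 1) (by omega) ?_
      rwa [Nat.sub_add_cancel hpos]
    have he : f^[n] x = f^[n - (k + 1)] (firstReturn f t x) := by
      rw [hk, ← Function.iterate_add_apply, Nat.sub_add_cancel hkn]
    obtain ⟨j, hj⟩ := ih (n - (k + 1)) (by omega) (firstReturn f t x)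
      (by rwa [hk]) (by rwa [← he])
    exact ⟨j + 1, by rw [Function.iterate_succ_apply, hj, he]⟩

end Iterate

namespace PlaneGraph

variable {G : PlaneGraph}

/-! ### Consistent half-edge structures and chains modulo two -/

theorem Consistent.swap_mem (h : G.Consistent) {d : ℕ × ℕ} (hd : d ∈ G.darts) :
    d.swap ∈ G.darts := (h.1 d hd).1

theorem Consistent.fst_ne_snd (h : G.Consistent) {d : ℕ × ℕ} (hd : d ∈ G.darts) : d.1 ≠ d.2 :=
  (h.1 d hd).2.1

theorem Consistent.fst_mem (h : G.Consistent) {d : ℕ × ℕ} (hd : d ∈ G.darts) : d.1 ∈ G.verts :=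
  (h.1 d hd).2.2

theorem Consistent.snd_mem (h : G.Consistent) {d : ℕ × ℕ} (hd : d ∈ G.darts) : d.2 ∈ G.verts :=
  h.fst_mem (h.swap_mem hd)

theorem Consistent.next_mem (h : G.Consistent) {d : ℕ × ℕ} (hd : d ∈ G.darts) :
    G.next d ∈ G.darts := h.2.1.mapsTo hd

theorem Consistent.next_inj (h : G.Consistent) {d e : ℕ × ℕ} (hd : d ∈ G.darts)
    (he : e ∈ G.darts) (hde : G.next d = G.next e) : d = e := h.2.1.injOn hd he hde

theorem Consistent.exists_next_eq (h : G.Consistent) {d : ℕ × ℕ} (hd : d ∈ G.darts) :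
    ∃ e ∈ G.darts, G.next e = d := h.2.1.surjOn hd

theorem Consistent.next_fst (h : G.Consistent) {d : ℕ × ℕ} (hd : d ∈ G.darts) :
    (G.next d).1 = d.2 := h.2.2.1 d hd

theorem Consistent.face_next (h : G.Consistent) {d : ℕ × ℕ} (hd : d ∈ G.darts) :
    G.face (G.next d) = G.face d := h.2.2.2.2 d hd

theorem Consistent.iterate_next_mem (h : G.Consistent) {d : ℕ × ℕ} (hd : d ∈ G.darts) (n : ℕ) :
    G.next^[n] d ∈ G.darts := iterate_mem h.2.1.mapsTo (s := (G.darts : Set (ℕ × ℕ))) hd n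

theorem Consistent.face_iterate_next (h : G.Consistent) {d : ℕ × ℕ} (hd : d ∈ G.darts) (n : ℕ) :
    G.face (G.next^[n] d) = G.face d := by
  induction n with
  | zero => rfl
  | succ n ih => rw [Function.iterate_succ_apply', h.face_next (h.iterate_next_mem hd n), ih]

theorem Consistent.sum_next (h : G.Consistent) {M : Type*} [AddCommMonoid M] (F : ℕ × ℕ → M) :
    ∑ d ∈ G.darts, F (G.next d) = ∑ d ∈ G.darts, F d :=
  Finset.sum_nbij G.next (fun _ hd => h.next_mem hd) h.2.1.injOn h.2.1.surjOn (fun _ _ => rfl)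

/-- A symmetric function on half-edges counts every edge twice. -/
theorem Consistent.sum_symm (h : G.Consistent) (F : ℕ × ℕ → ZMod 2)
    (hF : ∀ d ∈ G.darts, F d.swap = F d) : ∑ d ∈ G.darts, F d = 0 := by
  refine Finset.sum_involution (fun d _ => d.swap) (fun d hd => ?_) (fun d hd _ he => ?_)
    (fun d hd => h.swap_mem hd) (fun d _ => Prod.swap_swap d)
  · rw [hF d hd]; exact CharTwo.add_self_eq_zero _
  · exact h.fst_ne_snd hd (congrArg Prod.snd he)

/-- A one-dimensional chain modulo two (on half-edges) whose boundary vanishes. -/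
def IsCycle (G : PlaneGraph) (c : ℕ × ℕ → ZMod 2) : Prop :=
  ∀ p : ℕ → ZMod 2, ∑ d ∈ G.darts, c d * (p d.1 + p d.2) = 0

/-- Every cycle modulo two is the boundary of a set of faces (given by its indicator function);
this holds since the graph is plane. -/
def CyclesBound (G : PlaneGraph) : Prop :=
  ∀ c, G.IsCycle c → ∃ s : ℕ → ZMod 2, ∀ d ∈ G.darts,
    c d + c d.swap = s (G.face d) + s (G.face d.swap)

/-- There is at most one invalid face. -/
def UniqueInvalid (G : PlaneGraph) : Prop :=
  ∀ d ∈ G.darts, ∀ e ∈ G.darts, G.face d ∉ G.valid → G.face e ∉ G.valid → G.face d = G.face e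

/-- Two nodes are joined by a path. -/
def Joined (G : PlaneGraph) : ℕ → ℕ → Prop :=
  Relation.ReflTransGen fun u w => (u, w) ∈ G.darts

/-- Among the bounding walks of valid faces exactly one, that of `d₀`, has an odd number of edges
counted by `φ`; and `d₀` is joined to the invalid face. -/
structure IsOddDart (G : PlaneGraph) (φ : ℕ × ℕ → ZMod 2) (d₀ : ℕ × ℕ) : Prop where
  mem : d₀ ∈ G.darts
  valid : G.face d₀ ∈ G.valid
  sum_eq : ∀ y : ℕ × ℕ → ZMod 2, (∀ d ∈ G.darts, y (G.next d) = y d) →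
    (∀ d ∈ G.darts, G.face d ∉ G.valid → y d = 0) → ∑ d ∈ G.darts, y d * φ d = y d₀
  joined : ∃ e ∈ G.darts, G.face e ∉ G.valid ∧ G.Joined d₀.1 e.1

theorem IsOddDart.congr {φ ψ : ℕ × ℕ → ZMod 2} {d₀ : ℕ × ℕ} (h : G.IsOddDart φ d₀)
    (hφ : ∀ d ∈ G.darts, ψ d = φ d) : G.IsOddDart ψ d₀ where
  mem := h.mem
  valid := h.valid
  sum_eq y h1 h2 := by
    rw [← h.sum_eq y h1 h2]
    exact Finset.sum_congr rfl fun d hd => by rw [hφ d hd]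
  joined := h.joined

/-- The half-edge `next d` starts at the head of `d`, so reindexing by `next` matches heads with
tails and the boundary telescopes. -/
theorem Consistent.isCycle_of_next (h : G.Consistent) {y : ℕ × ℕ → ZMod 2}
    (hy : ∀ d ∈ G.darts, y (G.next d) = y d) : G.IsCycle y := by
  intro p
  have h1 : ∑ d ∈ G.darts, y d * p d.2 = ∑ d ∈ G.darts, y d * p d.1 := by
    rw [← h.sum_next fun d => y d * p d.1]
    exact Finset.sum_congr rfl fun d hd => by rw [hy d hd, h.next_fst hd]
  simp only [mul_add, Finset.sum_add_distrib, h1]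
  exact CharTwo.add_self_eq_zero _

/-- A cochain that is a coboundary on the support of a cycle vanishes on this cycle. -/
theorem IsCycle.sum_eq_zero {c φ : ℕ × ℕ → ZMod 2} (hc : G.IsCycle c) (p : ℕ → ZMod 2)
    (hφ : ∀ d ∈ G.darts, c d ≠ 0 → φ d = p d.1 + p d.2) : ∑ d ∈ G.darts, c d * φ d = 0 := by
  rw [← hc p]
  refine Finset.sum_congr rfl fun d hd => ?_
  by_cases h0 : c d = 0
  · simp [h0]
  · rw [hφ d hd h0]

/-- The difference of `c` and `s ∘ face` is symmetric under reversal, so its pairing with the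
symmetric `φ` counts every edge twice. Sums over cycles thereby become sums over faces, to which
`IsOddDart.sum_eq` applies. -/
theorem Consistent.sum_boundary (h : G.Consistent) {c φ : ℕ × ℕ → ZMod 2} {s : ℕ → ZMod 2}
    (hφ : ∀ d ∈ G.darts, φ d.swap = φ d)
    (hc : ∀ d ∈ G.darts, c d + c d.swap = s (G.face d) + s (G.face d.swap)) :
    ∑ d ∈ G.darts, c d * φ d = ∑ d ∈ G.darts, s (G.face d) * φ d := by
  rw [← CharTwo.add_eq_zero, ← Finset.sum_add_distrib]
  refine h.sum_symm (fun d => c d * φ d + s (G.face d) * φ d) fun d hd => ?_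
  rw [hφ d hd, ← add_mul, ← add_mul]
  congr 1
  have := hc d hd
  have h2 : c d.swap + s (G.face d.swap) + (c d + s (G.face d)) = 0 := by
    rw [show c d.swap + s (G.face d.swap) + (c d + s (G.face d))
      = (c d + c d.swap) + (s (G.face d) + s (G.face d.swap)) by ring, this]
    exact CharTwo.add_self_eq_zero _
  exact CharTwo.add_eq_zero.1 h2

/-- The set of faces that a cycle bounds may be chosen without a given face. -/
theorem CyclesBound.exists_boundary (h : G.CyclesBound) {c : ℕ × ℕ → ZMod 2} (hc : G.IsCycle c)
    (g : ℕ) : ∃ s : ℕ → ZMod 2, s g = 0 ∧ ∀ d ∈ G.darts,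
      c d + c d.swap = s (G.face d) + s (G.face d.swap) := by
  obtain ⟨s, hs⟩ := h c hc
  refine ⟨fun f => s f + s g, CharTwo.add_self_eq_zero _, fun d hd => ?_⟩
  rw [hs d hd]
  have : s g + s g = 0 := CharTwo.add_self_eq_zero _
  linear_combination -this

theorem Consistent.joined_symm (h : G.Consistent) {u w : ℕ} (huw : G.Joined u w) :
    G.Joined w u := by
  induction huw with
  | refl => exact .refl
  | tail _ hbc ih => exact .head (h.swap_mem hbc) ih

theorem Consistent.joined_iterate_next (h : G.Consistent) {d : ℕ × ℕ} (hd : d ∈ G.darts)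
    (n : ℕ) : G.Joined d.1 (G.next^[n] d).1 := by
  induction n with
  | zero => exact .refl
  | succ n ih =>
    refine ih.tail ?_
    rw [Function.iterate_succ_apply', h.next_fst (h.iterate_next_mem hd n)]
    exact h.iterate_next_mem hd n

/-- A function on half-edges that is invariant under `next` and under reversal is constant on
the connected components. -/
theorem Consistent.eq_of_joined (h : G.Consistent) {β : Type*} {F : ℕ × ℕ → β}
    (h1 : ∀ d ∈ G.darts, F (G.next d) = F d) (h2 : ∀ d ∈ G.darts, F d.swap = F d)
    {d e : ℕ × ℕ} (hd : d ∈ G.darts) (he : e ∈ G.darts) (hde : G.Joined d.1 e.1) : F d = F e := by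
  have hrot : ∀ d ∈ G.darts, ∀ k, (fun x => G.next x.swap)^[k] d ∈ G.darts ∧
      F ((fun x => G.next x.swap)^[k] d) = F d := by
    intro d hd k
    induction k with
    | zero => exact ⟨hd, rfl⟩
    | succ k ih =>
      rw [Function.iterate_succ_apply']
      exact ⟨h.next_mem (h.swap_mem ih.1), by rw [h1 _ (h.swap_mem ih.1), h2 _ ih.1, ih.2]⟩
  have hnode : ∀ d ∈ G.darts, ∀ e ∈ G.darts, d.1 = e.1 → F d = F e := by
    intro d hd e he hde
    obtain ⟨k, hk⟩ := h.2.2.2.1 d hd e he hde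
    rw [← (hrot d hd k).2, hk]
  have : ∀ w, G.Joined d.1 w → ∀ e ∈ G.darts, e.1 = w → F d = F e := by
    intro w hw
    induction hw with
    | refl => exact fun e he hed => hnode d hd e he hed.symm
    | @tail b c _ hbc ih =>
      intro e he hec
      rw [ih (b, c) hbc rfl, ← h2 _ hbc]
      exact hnode _ (h.swap_mem hbc) _ he hec.symm
  exact this _ hde e he rfl

end PlaneGraph

end GraphAlg

namespace GraphAlg

namespace PlaneGraph

variable {G : PlaneGraph}

/-! ### Subdividing an edge -/

section Subdivide

variable {u w v : ℕ}

/-- The half-edge of the subdivided graph that leaves the tail of an old half-edge. -/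
def subdart (u w v : ℕ) (d : ℕ × ℕ) : ℕ × ℕ :=
  if d = (u, w) then (u, v) else if d = (w, u) then (w, v) else d

theorem subdart_uw : subdart u w v (u, w) = (u, v) := if_pos rfl

theorem subdart_wu (huw : u ≠ w) : subdart u w v (w, u) = (w, v) := by
  simp [subdart, huw.symm]

theorem subdart_of_ne {d : ℕ × ℕ} (h1 : d ≠ (u, w)) (h2 : d ≠ (w, u)) :
    subdart u w v d = d := by
  simp [subdart, h1, h2]

theorem subdart_fst (d : ℕ × ℕ) : (subdart u w v d).1 = d.1 := by
  unfold subdart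
  split_ifs with h1 h2 <;> simp_all

variable (hG : G.Consistent) (huw : (u, w) ∈ G.darts) (hv : v ∉ G.verts)

include hG hv in
theorem Consistent.ne_of_notMem {d : ℕ × ℕ} (hd : d ∈ G.darts) : d.1 ≠ v ∧ d.2 ≠ v :=
  ⟨fun h => hv (h ▸ hG.fst_mem hd), fun h => hv (h ▸ hG.snd_mem hd)⟩

include hG huw in
theorem Consistent.mem_subdivide {d : ℕ × ℕ} : d ∈ (G.subdivide u w v).darts ↔
    (∃ x ∈ G.darts, subdart u w v x = d) ∨ d = (v, w) ∨ d = (v, u) := by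
  have hwu : (w, u) ∈ G.darts := hG.swap_mem huw
  have hne : u ≠ w := hG.fst_ne_snd huw
  constructor
  · intro h
    simp only [subdivide, Finset.mem_union, Finset.mem_sdiff, Finset.mem_insert,
      Finset.mem_singleton, not_or] at h
    rcases h with ⟨hd, h1, h2⟩ | rfl | rfl | rfl | rfl
    · exact .inl ⟨d, hd, subdart_of_ne h1 h2⟩
    · exact .inl ⟨_, huw, subdart_uw⟩
    · exact .inr (.inl rfl)
    · exact .inl ⟨_, hwu, subdart_wu hne⟩
    · exact .inr (.inr rfl)
  · simp only [subdivide, Finset.mem_union, Finset.mem_sdiff, Finset.mem_insert,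
      Finset.mem_singleton, not_or]
    rintro (⟨x, hx, rfl⟩ | rfl | rfl)
    · by_cases h1 : x = (u, w)
      · subst h1; rw [subdart_uw]; simp
      by_cases h2 : x = (w, u)
      · subst h2; rw [subdart_wu hne]; simp
      · rw [subdart_of_ne h1 h2]; exact .inl ⟨hx, h1, h2⟩
    · simp
    · simp

include hG huw hv in
theorem Consistent.injOn_subdart : Set.InjOn (subdart u w v) (G.darts : Set (ℕ × ℕ)) := by
  have hne : u ≠ w := hG.fst_ne_snd huw
  intro x hx y hy hxy
  have hx' := hG.ne_of_notMem hv hx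
  have hy' := hG.ne_of_notMem hv hy
  unfold subdart at hxy
  split_ifs at hxy <;> simp_all
  all_goals
    rw [← hxy] at hy'
    exact absurd rfl hy'.2

include hG huw hv in
theorem Consistent.sum_subdivide {M : Type*} [AddCommMonoid M] (F : ℕ × ℕ → M) :
    ∑ d ∈ (G.subdivide u w v).darts, F d =
      ∑ d ∈ G.darts, F (subdart u w v d) + F (v, w) + F (v, u) := by
  have hne : u ≠ w := hG.fst_ne_snd huw
  have hD : (G.subdivide u w v).darts =
      insert (v, u) (insert (v, w) (G.darts.image (subdart u w v))) := by
    ext d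
    rw [hG.mem_subdivide huw]
    simp only [Finset.mem_insert, Finset.mem_image]
    rw [or_comm, or_assoc, or_left_comm]
  have hnot : ∀ z, (v, z) ∉ G.darts.image (subdart u w v) := by
    intro z hz
    obtain ⟨x, hx, hxz⟩ := Finset.mem_image.1 hz
    refine (hG.ne_of_notMem hv hx).1 ?_
    rw [← subdart_fst (u := u) (w := w) (v := v), hxz]
  rw [hD, Finset.sum_insert, Finset.sum_insert (hnot w),
    Finset.sum_image (hG.injOn_subdart huw hv)]
  · abel
  · rw [Finset.mem_insert, not_or]
    exact ⟨fun h => hne (congrArg Prod.snd h), hnot u⟩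

theorem subdivide_next_uv : (G.subdivide u w v).next (u, v) = (v, w) := by
  simp [subdivide]

include hG huw hv in
theorem Consistent.subdivide_next_wv : (G.subdivide u w v).next (w, v) = (v, u) := by
  have hne : u ≠ w := hG.fst_ne_snd huw
  have hw := (hG.ne_of_notMem hv huw).2
  simp_all [subdivide, eq_comm]

include hG huw hv in
theorem Consistent.subdivide_next_vw :
    (G.subdivide u w v).next (v, w) = subdart u w v (G.next (u, w)) := by
  have hu := (hG.ne_of_notMem hv huw).1
  simp only [subdivide]
  rw [if_neg (by simp_all [eq_comm]), if_pos trivial]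
  rfl

include hG huw hv in
theorem Consistent.subdivide_next_vu :
    (G.subdivide u w v).next (v, u) = subdart u w v (G.next (w, u)) := by
  have hu := (hG.ne_of_notMem hv huw).1
  have hw := (hG.ne_of_notMem hv huw).2
  have hne : u ≠ w := hG.fst_ne_snd huw
  simp only [subdivide]
  rw [if_neg (by simp_all [eq_comm]), if_neg (by simp_all),
    if_neg (by simp_all [eq_comm]), if_pos trivial]
  rfl

include hG hv in
theorem Consistent.subdivide_next_of_ne {d : ℕ × ℕ} (hd : d ∈ G.darts) :
    (G.subdivide u w v).next d = subdart u w v (G.next d) := by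
  have := hG.ne_of_notMem hv hd
  simp only [subdivide]
  rw [if_neg (by rintro rfl; simp_all), if_neg (by rintro rfl; simp_all),
    if_neg (by rintro rfl; simp_all), if_neg (by rintro rfl; simp_all)]
  rfl

include hG huw hv in
theorem Consistent.subdivide_face_subdart {d : ℕ × ℕ} (hd : d ∈ G.darts) :
    (G.subdivide u w v).face (subdart u w v d) = G.face d := by
  have := hG.ne_of_notMem hv hd
  have hne : u ≠ w := hG.fst_ne_snd huw
  by_cases h1 : d = (u, w)
  · subst h1; rw [subdart_uw]; simp [subdivide]
  by_cases h2 : d = (w, u)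
  · subst h2; rw [subdart_wu hne]; simp_all [subdivide, eq_comm]
  rw [subdart_of_ne h1 h2]
  simp only [subdivide]
  rw [if_neg (by rintro (rfl | rfl) <;> simp_all), if_neg (by rintro (rfl | rfl) <;> simp_all)]

theorem subdivide_face_vw : (G.subdivide u w v).face (v, w) = G.face (u, w) := by
  simp [subdivide]

include hG huw hv in
theorem Consistent.subdivide_face_vu :
    (G.subdivide u w v).face (v, u) = G.face (w, u) := by
  have := hG.ne_of_notMem hv huw
  have hne : u ≠ w := hG.fst_ne_snd huw
  simp only [subdivide]
  rw [if_neg (by simp_all [eq_comm]), if_pos (.inr trivial)]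

include hG huw in
theorem Consistent.subdart_swap {d : ℕ × ℕ} (hd : d ∈ G.darts) :
    (subdart u w v d).swap =
      if d = (u, w) then (v, u) else if d = (w, u) then (v, w) else subdart u w v d.swap := by
  have hne : u ≠ w := hG.fst_ne_snd huw
  by_cases h1 : d = (u, w)
  · subst h1; rw [subdart_uw, if_pos rfl]; rfl
  by_cases h2 : d = (w, u)
  · subst h2; rw [subdart_wu hne, if_neg h1, if_pos rfl]; rfl
  rw [subdart_of_ne h1 h2, if_neg h1, if_neg h2, subdart_of_ne]
  · rintro h; exact h2 (by rw [← Prod.swap_swap d, h]; rfl)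
  · rintro h; exact h1 (by rw [← Prod.swap_swap d, h]; rfl)

/-- The rotation commutes with subdividing. -/
theorem Consistent.subdivide_rot (hG : G.Consistent) (huw : (u, w) ∈ G.darts)
    (hv : v ∉ G.verts) {d : ℕ × ℕ} (hd : d ∈ G.darts) :
    (G.subdivide u w v).next (subdart u w v d).swap = subdart u w v (G.next d.swap) := by
  rw [hG.subdart_swap huw hd]
  split_ifs with h1 h2
  · subst h1; exact hG.subdivide_next_vu huw hv
  · subst h2; exact hG.subdivide_next_vw huw hv
  · have hne : u ≠ w := hG.fst_ne_snd huw
    rw [subdart_of_ne, hG.subdivide_next_of_ne hv (hG.swap_mem hd)]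
    · rintro h; exact h2 (by rw [← Prod.swap_swap d, h]; rfl)
    · rintro h; exact h1 (by rw [← Prod.swap_swap d, h]; rfl)

theorem Consistent.subdivide (hG : G.Consistent) (huw : (u, w) ∈ G.darts) (hv : v ∉ G.verts) :
    (G.subdivide u w v).Consistent := by
  have hne : u ≠ w := hG.fst_ne_snd huw
  have hwu : (w, u) ∈ G.darts := hG.swap_mem huw
  have huv := (hG.ne_of_notMem hv huw).1
  have hwv := (hG.ne_of_notMem hv huw).2
  have hmem := fun {d} => hG.mem_subdivide (v := v) huw (d := d)
  have hold : ∀ {d}, d ∈ G.darts → subdart u w v d ∈ (G.subdivide u w v).darts :=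
    fun hd => hmem.2 (.inl ⟨_, hd, rfl⟩)
  have hvw : (v, w) ∈ (G.subdivide u w v).darts := hmem.2 (.inr (.inl rfl))
  have hvu : (v, u) ∈ (G.subdivide u w v).darts := hmem.2 (.inr (.inr rfl))
  have huv' : (u, v) ∈ (G.subdivide u w v).darts := by
    rw [← subdart_uw (w := w)]; exact hold huw
  have hwv' : (w, v) ∈ (G.subdivide u w v).darts := by
    rw [← subdart_wu hne]; exact hold hwu
  have hnext : ∀ {d}, d ∈ G.darts → (d = (u, w) ∨ d = (w, u)) ∨
      subdart u w v d = d ∧ (G.subdivide u w v).next d = subdart u w v (G.next d) := by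
    intro d hd
    by_cases h1 : d = (u, w)
    · exact .inl (.inl h1)
    by_cases h2 : d = (w, u)
    · exact .inl (.inr h2)
    · exact .inr ⟨subdart_of_ne h1 h2, hG.subdivide_next_of_ne hv hd⟩
  have hmaps : Set.MapsTo (G.subdivide u w v).next ((G.subdivide u w v).darts : Set (ℕ × ℕ))
      ((G.subdivide u w v).darts : Set (ℕ × ℕ)) := by
    intro d hd
    rcases hmem.1 hd with ⟨x, hx, rfl⟩ | rfl | rfl
    · rcases hnext hx with (rfl | rfl) | ⟨h1, h2⟩
      · rw [subdart_uw, subdivide_next_uv]; exact hvw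
      · rw [subdart_wu hne, hG.subdivide_next_wv huw hv]; exact hvu
      · rw [h1, h2]; exact hold (hG.next_mem hx)
    · rw [hG.subdivide_next_vw huw hv]; exact hold (hG.next_mem huw)
    · rw [hG.subdivide_next_vu huw hv]; exact hold (hG.next_mem hwu)
  have hsurj : Set.SurjOn (G.subdivide u w v).next ((G.subdivide u w v).darts : Set (ℕ × ℕ))
      ((G.subdivide u w v).darts : Set (ℕ × ℕ)) := by
    intro d hd
    rcases hmem.1 hd with ⟨x, hx, rfl⟩ | rfl | rfl
    · obtain ⟨y, hy, rfl⟩ := hG.exists_next_eq hx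
      rcases hnext hy with (rfl | rfl) | ⟨h1, h2⟩
      · exact ⟨_, hvw, hG.subdivide_next_vw huw hv⟩
      · exact ⟨_, hvu, hG.subdivide_next_vu huw hv⟩
      · exact ⟨y, by rw [← h1]; exact hold hy, h2⟩
    · exact ⟨_, huv', subdivide_next_uv⟩
    · exact ⟨_, hwv', hG.subdivide_next_wv huw hv⟩
  refine ⟨?_, (Set.Finite.surjOn_iff_bijOn_of_mapsTo (Finset.finite_toSet _) hmaps).1 hsurj,
    ?_, ?_, ?_⟩
  · intro d hd
    rcases hmem.1 hd with ⟨x, hx, rfl⟩ | rfl | rfl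
    · refine ⟨?_, ?_, ?_⟩
      · rw [hG.subdart_swap huw hx]
        split_ifs
        exacts [hvu, hvw, hold (hG.swap_mem hx)]
      · rcases hnext hx with (rfl | rfl) | ⟨h1, h2⟩
        · rw [subdart_uw]; exact huv
        · rw [subdart_wu hne]; exact hwv
        · rw [h1]; exact hG.fst_ne_snd hx
      · rw [subdart_fst]; exact Finset.mem_insert_of_mem (hG.fst_mem hx)
    · exact ⟨hwv', hwv.symm, Finset.mem_insert_self _ _⟩
    · exact ⟨huv', huv.symm, Finset.mem_insert_self _ _⟩
  · intro d hd
    rcases hmem.1 hd with ⟨x, hx, rfl⟩ | rfl | rfl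
    · rcases hnext hx with (rfl | rfl) | ⟨h1, h2⟩
      · rw [subdart_uw, subdivide_next_uv]
      · rw [subdart_wu hne, hG.subdivide_next_wv huw hv]
      · rw [h1, h2, subdart_fst, hG.next_fst hx]
    · rw [hG.subdivide_next_vw huw hv, subdart_fst, hG.next_fst huw]
    · rw [hG.subdivide_next_vu huw hv, subdart_fst, hG.next_fst hwu]
  -- At old nodes the rotation is conjugate to the old one by `subdart`; at `v` it exchanges the two
  -- half-edges.
  · have hiter : ∀ d ∈ G.darts, ∀ k,
        (fun x => (G.subdivide u w v).next x.swap)^[k] (subdart u w v d) =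
          subdart u w v ((fun x => G.next x.swap)^[k] d) ∧
        (fun x => G.next x.swap)^[k] d ∈ G.darts := by
      intro d hd k
      induction k with
      | zero => exact ⟨rfl, hd⟩
      | succ k ih =>
        rw [Function.iterate_succ_apply', Function.iterate_succ_apply', ih.1]
        exact ⟨hG.subdivide_rot huw hv ih.2, hG.next_mem (hG.swap_mem ih.2)⟩
    have hvx : ∀ d ∈ G.darts, (subdart u w v d).1 ≠ v := by
      intro d hd
      rw [subdart_fst]
      exact (hG.ne_of_notMem hv hd).1
    intro d hd e he hde
    rcases hmem.1 hd with ⟨x, hx, rfl⟩ | rfl | rfl <;>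
    rcases hmem.1 he with ⟨y, hy, rfl⟩ | rfl | rfl
    · rw [subdart_fst, subdart_fst] at hde
      obtain ⟨k, hk⟩ := hG.2.2.2.1 x hx y hy hde
      exact ⟨k, by rw [(hiter x hx k).1, hk]⟩
    · exact absurd hde (hvx x hx)
    · exact absurd hde (hvx x hx)
    · exact absurd hde.symm (hvx y hy)
    · exact ⟨0, rfl⟩
    · exact ⟨1, hG.subdivide_next_wv huw hv⟩
    · exact absurd hde.symm (hvx y hy)
    · exact ⟨1, subdivide_next_uv⟩
    · exact ⟨0, rfl⟩
  · intro d hd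
    rcases hmem.1 hd with ⟨x, hx, rfl⟩ | rfl | rfl
    · rcases hnext hx with (rfl | rfl) | ⟨h1, h2⟩
      · rw [hG.subdivide_face_subdart huw hv huw, subdart_uw, subdivide_next_uv,
          subdivide_face_vw]
      · rw [hG.subdivide_face_subdart huw hv hwu, subdart_wu hne,
          hG.subdivide_next_wv huw hv, hG.subdivide_face_vu huw hv]
      · rw [hG.subdivide_face_subdart huw hv hx, h1, h2,
          hG.subdivide_face_subdart huw hv (hG.next_mem hx), hG.face_next hx]
    · rw [hG.subdivide_next_vw huw hv, subdivide_face_vw,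
        hG.subdivide_face_subdart huw hv (hG.next_mem huw), hG.face_next huw]
    · rw [hG.subdivide_next_vu huw hv, hG.subdivide_face_vu huw hv,
        hG.subdivide_face_subdart huw hv (hG.next_mem hwu), hG.face_next hwu]

/-- Every face of the subdivided graph is a face of the old graph. -/
theorem Consistent.exists_subdivide_face (hG : G.Consistent) (huw : (u, w) ∈ G.darts)
    (hv : v ∉ G.verts) {d : ℕ × ℕ} (hd : d ∈ (G.subdivide u w v).darts) :
    ∃ x ∈ G.darts, (G.subdivide u w v).face d = G.face x := by
  rcases (hG.mem_subdivide huw).1 hd with ⟨x, hx, rfl⟩ | rfl | rfl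
  · exact ⟨x, hx, hG.subdivide_face_subdart huw hv hx⟩
  · exact ⟨_, huw, subdivide_face_vw⟩
  · exact ⟨_, hG.swap_mem huw, hG.subdivide_face_vu huw hv⟩

theorem UniqueInvalid.subdivide (hU : G.UniqueInvalid) (hG : G.Consistent)
    (huw : (u, w) ∈ G.darts) (hv : v ∉ G.verts) : (G.subdivide u w v).UniqueInvalid := by
  intro d hd e he hd' he'
  obtain ⟨x, hx, hdx⟩ := hG.exists_subdivide_face huw hv hd
  obtain ⟨y, hy, hey⟩ := hG.exists_subdivide_face huw hv he
  rw [hdx] at hd' ⊢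
  rw [hey] at he' ⊢
  exact hU x hx y hy hd' he'

/-- Summation over the half-edges of a graph, one edge being treated separately. -/
theorem Consistent.sum_eq_sum_ne (hG : G.Consistent) (huw : (u, w) ∈ G.darts)
    {M : Type*} [AddCommMonoid M] (F : ℕ × ℕ → M) :
    ∑ d ∈ G.darts, F d = ∑ d ∈ G.darts \ {(u, w), (w, u)}, F d + F (u, w) + F (w, u) := by
  have hne : u ≠ w := hG.fst_ne_snd huw
  have hsub : ({(u, w), (w, u)} : Finset (ℕ × ℕ)) ⊆ G.darts := by
    intro d hd
    rcases Finset.mem_insert.1 hd with rfl | hd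
    · exact huw
    · rw [Finset.mem_singleton.1 hd]; exact hG.swap_mem huw
  rw [← Finset.sum_sdiff hsub, Finset.sum_pair (by simp [hne]), add_assoc]

/-- The node `v` has degree two, so a cycle has the same total weight on both halves of the
subdivided edge. Putting this weight on `uw` gives a cycle of the old graph, and the faces that it
bounds also work for the new one. -/
theorem CyclesBound.subdivide (hP : G.CyclesBound) (hG : G.Consistent)
    (huw : (u, w) ∈ G.darts) (hv : v ∉ G.verts) : (G.subdivide u w v).CyclesBound := by
  have hne : u ≠ w := hG.fst_ne_snd huw
  have hwu : (w, u) ∈ G.darts := hG.swap_mem huw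
  have huv := (hG.ne_of_notMem hv huw).1
  have hwv := (hG.ne_of_notMem hv huw).2
  intro c hc
  have hsplit : ∀ F : ℕ × ℕ → ZMod 2, ∑ d ∈ (G.subdivide u w v).darts, F d =
      ∑ d ∈ G.darts \ {(u, w), (w, u)}, F d + F (u, v) + F (w, v) + F (v, w) + F (v, u) := by
    intro F
    rw [hG.sum_subdivide huw hv, hG.sum_eq_sum_ne huw, subdart_uw, subdart_wu hne]
    congr 4
    refine Finset.sum_congr rfl fun d hd => ?_
    simp only [Finset.mem_sdiff, Finset.mem_insert, Finset.mem_singleton, not_or] at hd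
    rw [subdart_of_ne hd.2.1 hd.2.2]
  -- Test the cycle condition against the indicator function of `v`.
  have hdeg : c (u, v) + c (v, u) = c (v, w) + c (w, v) := by
    have h := hc (fun z => if z = v then 1 else 0)
    rw [hsplit, Finset.sum_eq_zero] at h
    · simp only [huv, hwv, if_true, if_false, zero_add, add_zero, mul_one] at h
      rw [← CharTwo.add_eq_zero, ← h]
      ring
    · intro d hd
      have := hG.ne_of_notMem hv (Finset.mem_sdiff.1 hd).1
      simp [this.1, this.2]
  set c₀ : ℕ × ℕ → ZMod 2 := fun d =>
    if d = (u, w) then c (u, v) + c (v, u) else if d = (w, u) then 0 else c d with hc₀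
  have hc₀_ne : ∀ d, d ≠ (u, w) → d ≠ (w, u) → c₀ d = c d := by
    intro d h1 h2
    simp [hc₀, h1, h2]
  have hc₀_uw : c₀ (u, w) = c (u, v) + c (v, u) := by simp [hc₀]
  have hc₀_wu : c₀ (w, u) = 0 := by simp [hc₀, hne.symm]
  have hcyc : G.IsCycle c₀ := by
    intro p
    -- With the value `p u` at `v`, the half `uv` contributes nothing and the half `vw` contributes
    -- `p u + p w`, as `uw` does in the old graph.
    have h := hc (Function.update p v (p u))
    rw [hsplit] at h
    rw [hG.sum_eq_sum_ne huw, hc₀_uw, hc₀_wu]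
    refine Eq.trans ?_ h
    simp only [Function.update_self, Function.update_of_ne huv, Function.update_of_ne hwv]
    have h1 : ∑ d ∈ G.darts \ {(u, w), (w, u)}, c₀ d * (p d.1 + p d.2) =
        ∑ d ∈ G.darts \ {(u, w), (w, u)},
          c d * (Function.update p v (p u) d.1 + Function.update p v (p u) d.2) := by
      refine Finset.sum_congr rfl fun d hd => ?_
      simp only [Finset.mem_sdiff, Finset.mem_insert, Finset.mem_singleton, not_or] at hd
      have := hG.ne_of_notMem hv hd.1
      rw [hc₀_ne d hd.2.1 hd.2.2, Function.update_of_ne this.1, Function.update_of_ne this.2]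
    rw [h1, hdeg]
    have h2 : p u + p u = 0 := CharTwo.add_self_eq_zero _
    linear_combination (- c (u, v) - c (v, u)) * h2
  obtain ⟨s, hs⟩ := hP c₀ hcyc
  have hs_uw := hs _ huw
  rw [Prod.swap_prod_mk, hc₀_uw, hc₀_wu, add_zero] at hs_uw
  have hf_uv : (G.subdivide u w v).face (u, v) = G.face (u, w) := by
    rw [← subdart_uw (w := w), hG.subdivide_face_subdart huw hv huw]
  have hf_wv : (G.subdivide u w v).face (w, v) = G.face (w, u) := by
    rw [← subdart_wu hne, hG.subdivide_face_subdart huw hv hwu]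
  have hf_vu := hG.subdivide_face_vu huw hv
  have hf_vw : (G.subdivide u w v).face (v, w) = G.face (u, w) := subdivide_face_vw
  refine ⟨s, fun d hd => ?_⟩
  rcases (hG.mem_subdivide huw).1 hd with ⟨x, hx, rfl⟩ | rfl | rfl
  · by_cases h1 : x = (u, w)
    · subst h1
      rw [subdart_uw, Prod.swap_prod_mk, hf_uv, hf_vu, hs_uw]
    by_cases h2 : x = (w, u)
    · subst h2
      rw [subdart_wu hne, Prod.swap_prod_mk, hf_wv, hf_vw, add_comm (s _), ← hs_uw, hdeg, add_comm]
    · have h3 : x.swap ≠ (u, w) := fun h => h2 (by rw [← Prod.swap_swap x, h]; rfl)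
      have h4 : x.swap ≠ (w, u) := fun h => h1 (by rw [← Prod.swap_swap x, h]; rfl)
      have hfx := hG.subdivide_face_subdart huw hv hx
      have hfx' := hG.subdivide_face_subdart huw hv (hG.swap_mem hx)
      rw [subdart_of_ne h1 h2] at hfx ⊢
      rw [subdart_of_ne h3 h4] at hfx'
      rw [hfx, hfx', ← hs x hx, hc₀_ne x h1 h2, hc₀_ne _ h3 h4]
  · rw [Prod.swap_prod_mk, hf_vw, hf_wv, ← hs_uw, hdeg]
  · rw [Prod.swap_prod_mk, hf_vu, hf_uv, add_comm (s _), ← hs_uw, add_comm]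

theorem Consistent.joined_subdivide (hG : G.Consistent) (huw : (u, w) ∈ G.darts) {a b : ℕ} (h : G.Joined a b) : (G.subdivide u w v).Joined a b := by
  have hne : u ≠ w := hG.fst_ne_snd huw
  have hwu : (w, u) ∈ G.darts := hG.swap_mem huw
  have hmem := fun {d} => hG.mem_subdivide (v := v) huw (d := d)
  induction h with
  | refl => exact .refl
  | @tail b c _ hbc ih =>
    by_cases h1 : (b, c) = (u, w)
    · obtain ⟨rfl, rfl⟩ := Prod.mk.inj h1
      exact (ih.tail (hmem.2 (.inl ⟨_, huw, subdart_uw⟩))).tail (hmem.2 (.inr (.inl rfl)))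
    by_cases h2 : (b, c) = (w, u)
    · obtain ⟨rfl, rfl⟩ := Prod.mk.inj h2
      exact (ih.tail (hmem.2 (.inl ⟨_, hwu, subdart_wu hne⟩))).tail (hmem.2 (.inr (.inr rfl)))
    · exact ih.tail (hmem.2 (.inl ⟨_, hbc, subdart_of_ne h1 h2⟩))

/-- A weight that is constant along bounding walks agrees on the two halves of each subdivided
half-edge, so it comes from such a weight on the old graph; additivity of `φ` identifies the two
sums. -/
theorem IsOddDart.subdivide {φ : ℕ × ℕ → ZMod 2} {d₀ : ℕ × ℕ} (h : G.IsOddDart φ d₀)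
    (hG : G.Consistent) (huw : (u, w) ∈ G.darts) (hv : v ∉ G.verts)
    (h1 : φ (u, w) = φ (u, v) + φ (v, w)) (h2 : φ (w, u) = φ (w, v) + φ (v, u)) :
    (G.subdivide u w v).IsOddDart φ (subdart u w v d₀) := by
  have hne : u ≠ w := hG.fst_ne_snd huw
  have hwu : (w, u) ∈ G.darts := hG.swap_mem huw
  have hold : ∀ {d}, d ∈ G.darts → subdart u w v d ∈ (G.subdivide u w v).darts :=
    fun hd => (hG.mem_subdivide huw).2 (.inl ⟨_, hd, rfl⟩)
  have hvw : (v, w) ∈ (G.subdivide u w v).darts := (hG.mem_subdivide huw).2 (.inr (.inl rfl))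
  have hvu : (v, u) ∈ (G.subdivide u w v).darts := (hG.mem_subdivide huw).2 (.inr (.inr rfl))
  refine ⟨hold h.mem, ?_, fun y hy hy0 => ?_, ?_⟩
  · rw [hG.subdivide_face_subdart huw hv h.mem]; exact h.valid
  · have e1 : y (v, w) = y (u, v) := by
      have := hy _ (hold huw)
      rwa [subdart_uw, subdivide_next_uv] at this
    have e2 : y (v, u) = y (w, v) := by
      have := hy _ (hold hwu)
      rwa [subdart_wu hne, hG.subdivide_next_wv huw hv] at this
    rw [← h.sum_eq (fun d => y (subdart u w v d)), hG.sum_subdivide huw hv,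
      hG.sum_eq_sum_ne huw, hG.sum_eq_sum_ne huw, subdart_uw, subdart_wu hne, e1, e2, h1, h2,
      Finset.sum_congr rfl fun d hd => ?_]
    · ring
    · simp only [Finset.mem_sdiff, Finset.mem_insert, Finset.mem_singleton, not_or] at hd
      rw [subdart_of_ne hd.2.1 hd.2.2]
    · intro d hd
      by_cases hd1 : d = (u, w)
      · subst hd1
        rw [subdart_uw, ← e1, ← hG.subdivide_next_vw huw hv, hy _ hvw]
      by_cases hd2 : d = (w, u)
      · subst hd2
        rw [subdart_wu hne, ← e2, ← hG.subdivide_next_vu huw hv, hy _ hvu]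
      have := hy _ (hold hd)
      rw [subdart_of_ne hd1 hd2, hG.subdivide_next_of_ne hv hd] at this
      rw [this, subdart_of_ne hd1 hd2]
    · intro d hd hd'
      refine hy0 _ (hold hd) ?_
      rwa [hG.subdivide_face_subdart huw hv hd]
  · obtain ⟨e, he, he', hj⟩ := h.joined
    refine ⟨_, hold he, ?_, ?_⟩
    · rwa [hG.subdivide_face_subdart huw hv he]
    · rw [subdart_fst, subdart_fst]; exact hG.joined_subdivide huw hj

end Subdivide

end PlaneGraph

end GraphAlg

namespace GraphAlg

namespace PlaneGraph

variable {G H : PlaneGraph} {a b : ℕ × ℕ}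

/-! ### Drawing an edge -/

/-- The half-edges and bounding walks of `H` arise from those of `G` by drawing an edge from the
corner before `a` to the corner before `b`. -/
structure AddsEdge (G H : PlaneGraph) (a b : ℕ × ℕ) : Prop where
  verts_eq : H.verts = G.verts
  fst_mem : a ∈ G.darts
  snd_mem : b ∈ G.darts
  fst_ne : a.1 ≠ b.1
  notMem : (a.1, b.1) ∉ G.darts
  mem_iff : ∀ d, d ∈ H.darts ↔ d = (a.1, b.1) ∨ d = (b.1, a.1) ∨ d ∈ G.darts
  next_fst : H.next (a.1, b.1) = b
  next_snd : H.next (b.1, a.1) = a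
  next_eq_fst : ∀ d ∈ G.darts, G.next d = a → H.next d = (a.1, b.1)
  next_eq_snd : ∀ d ∈ G.darts, G.next d = b → H.next d = (b.1, a.1)
  next_eq : ∀ d ∈ G.darts, G.next d ≠ a → G.next d ≠ b → H.next d = G.next d

theorem Consistent.notMem_swap (hG : G.Consistent) {u w : ℕ} (h : (u, w) ∉ G.darts) :
    (w, u) ∉ G.darts := fun h' => h (hG.swap_mem h')

theorem AddsEdge.symm (h : AddsEdge G H a b) (hG : G.Consistent) : AddsEdge G H b a where
  verts_eq := h.verts_eq
  fst_mem := h.snd_mem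
  snd_mem := h.fst_mem
  fst_ne := h.fst_ne.symm
  notMem := hG.notMem_swap h.notMem
  mem_iff d := by rw [h.mem_iff, or_left_comm]
  next_fst := h.next_snd
  next_snd := h.next_fst
  next_eq_fst := h.next_eq_snd
  next_eq_snd := h.next_eq_fst
  next_eq d hd h1 h2 := h.next_eq d hd h2 h1

theorem addsEdge_addEdge (hG : G.Consistent) (ha : a ∈ G.darts) (hb : b ∈ G.darts)
    (hne : a.1 ≠ b.1) (hab : (a.1, b.1) ∉ G.darts) (l : ℕ) (X : Finset (ℕ × ℕ)) :
    AddsEdge G (G.addEdge a b l X) a b := by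
  have hba := hG.notMem_swap hab
  have hne1 : ∀ d ∈ G.darts, d ≠ (a.1, b.1) := fun d hd h => hab (h ▸ hd)
  have hne2 : ∀ d ∈ G.darts, d ≠ (b.1, a.1) := fun d hd h => hba (h ▸ hd)
  have hab' : b ≠ a := fun h => hne (by rw [h])
  refine ⟨rfl, ha, hb, hne, hab, fun d => ?_, ?_, ?_, fun d hd h => ?_, fun d hd h => ?_,
    fun d hd h1 h2 => ?_⟩
  · simp [addEdge]
  · simp [addEdge]
  · simp [addEdge, hne.symm]
  · simp [addEdge, hne1 d hd, hne2 d hd, h]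
  · simp [addEdge, hne1 d hd, hne2 d hd, h, hab']
  · simp [addEdge, hne1 d hd, hne2 d hd, h1, h2]

theorem AddsEdge.mem (h : AddsEdge G H a b) {d : ℕ × ℕ} (hd : d ∈ G.darts) : d ∈ H.darts :=
  (h.mem_iff d).2 (.inr (.inr hd))

theorem AddsEdge.fst_mem' (h : AddsEdge G H a b) : (a.1, b.1) ∈ H.darts :=
  (h.mem_iff _).2 (.inl rfl)

theorem AddsEdge.snd_mem' (h : AddsEdge G H a b) : (b.1, a.1) ∈ H.darts :=
  (h.mem_iff _).2 (.inr (.inl rfl))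

theorem AddsEdge.sum_eq (h : AddsEdge G H a b) (hG : G.Consistent) {M : Type*} [AddCommMonoid M]
    (F : ℕ × ℕ → M) :
    ∑ d ∈ H.darts, F d = F (a.1, b.1) + (F (b.1, a.1) + ∑ d ∈ G.darts, F d) := by
  have hD : H.darts = insert (a.1, b.1) (insert (b.1, a.1) G.darts) := by
    ext d
    simp [h.mem_iff]
  rw [hD, Finset.sum_insert, Finset.sum_insert (hG.notMem_swap h.notMem)]
  rw [Finset.mem_insert, not_or]
  exact ⟨fun he => h.fst_ne (Prod.mk.inj he).1, h.notMem⟩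

theorem AddsEdge.bijOn (h : AddsEdge G H a b) (hG : G.Consistent) :
    Set.BijOn H.next (H.darts : Set (ℕ × ℕ)) (H.darts : Set (ℕ × ℕ)) := by
  have hmaps : Set.MapsTo H.next (H.darts : Set (ℕ × ℕ)) (H.darts : Set (ℕ × ℕ)) := by
    intro d hd
    rcases (h.mem_iff d).1 hd with rfl | rfl | hd
    · rw [h.next_fst]; exact h.mem h.snd_mem
    · rw [h.next_snd]; exact h.mem h.fst_mem
    · by_cases h1 : G.next d = a
      · rw [h.next_eq_fst d hd h1]; exact h.fst_mem'
      by_cases h2 : G.next d = b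
      · rw [h.next_eq_snd d hd h2]; exact h.snd_mem'
      · rw [h.next_eq d hd h1 h2]; exact h.mem (hG.next_mem hd)
  refine (Set.Finite.surjOn_iff_bijOn_of_mapsTo (Finset.finite_toSet _) hmaps).1 fun d hd => ?_
  rcases (h.mem_iff d).1 hd with rfl | rfl | hd
  · obtain ⟨e, he, hea⟩ := hG.exists_next_eq h.fst_mem
    exact ⟨e, h.mem he, h.next_eq_fst e he hea⟩
  · obtain ⟨e, he, heb⟩ := hG.exists_next_eq h.snd_mem
    exact ⟨e, h.mem he, h.next_eq_snd e he heb⟩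
  · by_cases h1 : d = a
    · exact ⟨_, h.snd_mem', h1 ▸ h.next_snd⟩
    by_cases h2 : d = b
    · exact ⟨_, h.fst_mem', h2 ▸ h.next_fst⟩
    · obtain ⟨e, he, rfl⟩ := hG.exists_next_eq hd
      exact ⟨e, h.mem he, h.next_eq e he h1 h2⟩

/-- In the rotation, the new half-edges are inserted just before `a` and just before `b`. Each old
rotation step is therefore one or two new steps. -/
theorem AddsEdge.consistent (h : AddsEdge G H a b) (hG : G.Consistent)
    (hface : ∀ d ∈ H.darts, H.face (H.next d) = H.face d) : H.Consistent := by
  refine ⟨fun d hd => ?_, h.bijOn hG, fun d hd => ?_, fun d hd e he hde => ?_, hface⟩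
  · rw [h.verts_eq]
    rcases (h.mem_iff d).1 hd with rfl | rfl | hd
    · exact ⟨h.snd_mem', h.fst_ne, hG.fst_mem (d := a) h.fst_mem⟩
    · exact ⟨h.fst_mem', h.fst_ne.symm, hG.fst_mem (d := b) h.snd_mem⟩
    · exact ⟨h.mem (hG.swap_mem hd), hG.fst_ne_snd hd, hG.fst_mem hd⟩
  · rcases (h.mem_iff d).1 hd with rfl | rfl | hd
    · rw [h.next_fst]
    · rw [h.next_snd]
    · rw [← hG.next_fst hd]
      by_cases h1 : G.next d = a
      · rw [h.next_eq_fst d hd h1, h1]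
      by_cases h2 : G.next d = b
      · rw [h.next_eq_snd d hd h2, h2]
      · rw [h.next_eq d hd h1 h2]
  · set f : ℕ × ℕ → ℕ × ℕ := fun x => H.next x.swap with hf
    have htrans : ∀ {x y z}, (∃ k, f^[k] x = y) → (∃ k, f^[k] y = z) → ∃ k, f^[k] x = z := by
      rintro x y z ⟨i, rfl⟩ ⟨j, rfl⟩
      exact ⟨j + i, Function.iterate_add_apply f j i x⟩
    have hea : f (a.1, b.1) = a := h.next_snd
    have heb : f (b.1, a.1) = b := h.next_fst
    have hstep : ∀ x ∈ G.darts, ∃ k, f^[k] x = G.next x.swap := by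
      intro x hx
      have hx' := hG.swap_mem hx
      by_cases h1 : G.next x.swap = a
      · refine ⟨2, ?_⟩
        change f (H.next x.swap) = _
        rw [h.next_eq_fst _ hx' h1, hea, h1]
      by_cases h2 : G.next x.swap = b
      · refine ⟨2, ?_⟩
        change f (H.next x.swap) = _
        rw [h.next_eq_snd _ hx' h2, heb, h2]
      · exact ⟨1, h.next_eq _ hx' h1 h2⟩
    have hold : ∀ x ∈ G.darts, ∀ k, (fun x => G.next x.swap)^[k] x ∈ G.darts ∧
        ∃ j, f^[j] x = (fun x => G.next x.swap)^[k] x := by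
      intro x hx k
      induction k with
      | zero => exact ⟨hx, 0, rfl⟩
      | succ k ih =>
        rw [Function.iterate_succ_apply']
        exact ⟨hG.next_mem (hG.swap_mem ih.1), htrans ih.2 (hstep _ ih.1)⟩
    have hoo : ∀ x ∈ G.darts, ∀ y ∈ G.darts, x.1 = y.1 → ∃ k, f^[k] x = y := by
      intro x hx y hy hxy
      obtain ⟨k, rfl⟩ := hG.2.2.2.1 x hx y hy hxy
      exact (hold x hx k).2
    have hon : ∀ x ∈ G.darts, (x.1 = a.1 → ∃ k, f^[k] x = (a.1, b.1)) ∧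
        (x.1 = b.1 → ∃ k, f^[k] x = (b.1, a.1)) := by
      intro x hx
      constructor
      · intro hxa
        obtain ⟨e, he, hea⟩ := hG.exists_next_eq h.fst_mem
        have h2 : e.swap.1 = a.1 := by rw [← hea, hG.next_fst he]; rfl
        exact htrans (hoo x hx e.swap (hG.swap_mem he) (hxa.trans h2.symm))
          ⟨1, by simpa [hf] using h.next_eq_fst e he hea⟩
      · intro hxa
        obtain ⟨e, he, hea⟩ := hG.exists_next_eq h.snd_mem
        have h2 : e.swap.1 = b.1 := by rw [← hea, hG.next_fst he]; rfl
        exact htrans (hoo x hx e.swap (hG.swap_mem he) (hxa.trans h2.symm))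
          ⟨1, by simpa [hf] using h.next_eq_snd e he hea⟩
    have hfrom : ∀ y ∈ G.darts, ∀ e ∈ H.darts, y.1 = e.1 → ∃ k, f^[k] y = e := by
      intro y hy e he hye
      rcases (h.mem_iff e).1 he with rfl | rfl | he
      · exact (hon y hy).1 hye
      · exact (hon y hy).2 hye
      · exact hoo y hy e he hye
    rcases (h.mem_iff d).1 hd with rfl | rfl | hd
    · exact htrans ⟨1, hea⟩ (hfrom a h.fst_mem e he hde)
    · exact htrans ⟨1, heb⟩ (hfrom b h.snd_mem e he hde)
    · exact hfrom d hd e he hde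

/-- A set of half-edges that is mapped into itself by a permutation is invariant. -/
theorem mem_of_next_mem (hH : Set.BijOn H.next (H.darts : Set (ℕ × ℕ)) (H.darts : Set (ℕ × ℕ)))
    {O : Finset (ℕ × ℕ)} (hO : ∀ d ∈ O, H.next d ∈ O) {d : ℕ × ℕ} (hd : d ∈ H.darts)
    (hd' : H.next d ∈ O) : d ∈ O := by
  obtain ⟨k, hk⟩ := exists_iterate_eq_self (Finset.finite_toSet _) hH hd
  rw [← hk, Function.iterate_succ_apply]
  have : ∀ j, H.next^[j] (H.next d) ∈ O := by
    intro j
    induction j with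
    | zero => exact hd'
    | succ j ih => rw [Function.iterate_succ_apply']; exact hO _ ih
  exact this k

/-- The new bounding walk that consists of the half-edge from `b.1` to `a.1` and of the first `n`
half-edges of the old walk from `a`. -/
def sideWalk (G : PlaneGraph) (a b : ℕ × ℕ) (n : ℕ) : Finset (ℕ × ℕ) :=
  insert (b.1, a.1) ((Finset.range n).image fun j => G.next^[j] a)

theorem mem_sideWalk {n : ℕ} {d : ℕ × ℕ} :
    d ∈ G.sideWalk a b n ↔ d = (b.1, a.1) ∨ ∃ j < n, G.next^[j] a = d := by
  simp [sideWalk]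

/-- Minimality excludes an early visit to `b`, and thereby an early return to `a`. This makes
`sideWalk` invariant under the new `next`. -/
theorem exists_minimal_walk (hab : a.1 ≠ b.1) {n : ℕ} (hn : G.next^[n] a = b) :
    ∃ m ≤ n, 0 < m ∧ G.next^[m] a = b ∧ ∀ j < m, G.next^[j] a ≠ b := by
  classical
  have hex : ∃ m, G.next^[m] a = b := ⟨n, hn⟩
  refine ⟨Nat.find hex, Nat.find_min' hex hn, Nat.pos_of_ne_zero fun h0 => ?_,
    Nat.find_spec hex, fun j hj => Nat.find_min hex hj⟩
  have := Nat.find_spec hex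
  rw [h0] at this
  exact hab (congrArg Prod.fst this)

theorem AddsEdge.sideWalk_next (h : AddsEdge G H a b) (hG : G.Consistent) {n : ℕ} (hn : 0 < n)
    (hab : G.next^[n] a = b) (hmin : ∀ j < n, G.next^[j] a ≠ b) {d : ℕ × ℕ} (hd : d ∈ H.darts) :
    H.next d ∈ G.sideWalk a b n ↔ d ∈ G.sideWalk a b n := by
  have hmaps : ∀ d ∈ G.sideWalk a b n, H.next d ∈ G.sideWalk a b n := by
    intro d hd
    rcases mem_sideWalk.1 hd with rfl | ⟨j, hj, rfl⟩
    · rw [h.next_snd]; exact mem_sideWalk.2 (.inr ⟨0, hn, rfl⟩)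
    · have hmem := hG.iterate_next_mem h.fst_mem j
      by_cases hjn : j + 1 = n
      · rw [h.next_eq_snd _ hmem (by
          rw [← Function.iterate_succ_apply' G.next j a, Nat.succ_eq_add_one, hjn, hab])]
        exact mem_sideWalk.2 (.inl rfl)
      · have e1 : G.next (G.next^[j] a) = G.next^[j + 1] a :=
          (Function.iterate_succ_apply' _ _ _).symm
        rw [h.next_eq _ hmem, e1]
        · exact mem_sideWalk.2 (.inr ⟨j + 1, by omega, rfl⟩)
        -- A return to `a` after `j + 1` steps would allow these steps to be dropped, and `b` would
        -- be reached too early.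
        · intro h0
          rw [e1] at h0
          refine hmin (n - (j + 1)) (by omega) ?_
          rw [← hab, show n = n - (j + 1) + (j + 1) by omega, Function.iterate_add_apply, h0,
            Nat.add_sub_cancel]
        · rw [e1]; exact hmin _ (by omega)
  exact ⟨mem_of_next_mem (h.bijOn hG) hmaps hd, hmaps d⟩

theorem AddsEdge.notMem_sideWalk (h : AddsEdge G H a b) (hG : G.Consistent) {n : ℕ} :
    (a.1, b.1) ∉ G.sideWalk a b n := by
  intro hd
  rcases mem_sideWalk.1 hd with he | ⟨j, -, he⟩
  · exact h.fst_ne (Prod.mk.inj he).1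
  · exact h.notMem (he ▸ hG.iterate_next_mem h.fst_mem j)

/-- An eligible edge can be drawn. -/
theorem Consistent.exists_isSplitting (hG : G.Consistent) (ha : a ∈ G.darts) (hb : b ∈ G.darts)
    (hne : a.1 ≠ b.1) (hab : (a.1, b.1) ∉ G.darts) (hw : ∃ n, G.next^[n] a = b) :
    ∃ l X, G.IsSplitting a b l X := by
  obtain ⟨l, hl⟩ := Infinite.exists_notMem_finset (G.darts.image G.face)
  obtain ⟨n, hn⟩ := hw
  -- Only the side walk receives the new name; any other bounding walks of the face may keep the old
  -- one.
  obtain ⟨m, -, hm0, hm, hmin⟩ := exists_minimal_walk hne hn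
  have hH := addsEdge_addEdge hG ha hb hne hab l (G.sideWalk a b m)
  refine ⟨l, G.sideWalk a b m, fun d hd he => hl (he ▸ Finset.mem_image_of_mem _ hd),
    mem_sideWalk.2 (.inl rfl), hH.notMem_sideWalk hG, fun d hd => ?_,
    fun d hd => (hH.sideWalk_next hG hm0 hm hmin hd).symm⟩
  rcases mem_sideWalk.1 hd with rfl | ⟨j, -, rfl⟩
  · exact .inl rfl
  · exact .inr ⟨hG.iterate_next_mem ha j, hG.face_iterate_next ha j⟩

/-! ### Faces after an edge has been drawn -/

section Splitting

variable {l : ℕ} {X : Finset (ℕ × ℕ)} (hX : G.IsSplitting a b l X)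

include hX

theorem IsSplitting.face_fst : (G.addEdge a b l X).face (a.1, b.1) = G.face a := by
  simp [addEdge, hX.2.2.1]

theorem IsSplitting.face_snd : (G.addEdge a b l X).face (b.1, a.1) = l := by
  simp [addEdge, hX.2.1]

omit hX in
theorem face_addEdge (hab : (a.1, b.1) ∉ G.darts) {d : ℕ × ℕ} (hd : d ∈ G.darts) :
    (G.addEdge a b l X).face d = if d ∈ X then l else G.face d := by
  have : d ≠ (a.1, b.1) := fun h => hab (h ▸ hd)
  simp [addEdge, this]

theorem IsSplitting.face_of_mem (hba : (b.1, a.1) ∉ G.darts) {d : ℕ × ℕ} (hd : d ∈ G.darts)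
    (hdX : d ∈ X) : G.face d = G.face a := by
  rcases hX.2.2.2.1 d hdX with rfl | h
  · exact absurd hd hba
  · exact h.2

theorem IsSplitting.valid_iff (hG : G.Consistent) (hab : (a.1, b.1) ∉ G.darts)
    (hval : G.face a ∈ G.valid) {d : ℕ × ℕ} (hd : d ∈ G.darts) :
    (G.addEdge a b l X).face d ∈ (G.addEdge a b l X).valid ↔ G.face d ∈ G.valid := by
  rw [face_addEdge hab hd]
  by_cases hdX : d ∈ X
  · rw [if_pos hdX, hX.face_of_mem (hG.notMem_swap hab) hd hdX]
    simp [addEdge, hval]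
  · rw [if_neg hdX]
    simp [addEdge, hX.1 d hd]

theorem IsSplitting.consistent (hG : G.Consistent) (ha : a ∈ G.darts) (hb : b ∈ G.darts)
    (hne : a.1 ≠ b.1) (hab : (a.1, b.1) ∉ G.darts) (hf : G.face a = G.face b) :
    (G.addEdge a b l X).Consistent := by
  have hba := hG.notMem_swap hab
  have hH := addsEdge_addEdge hG ha hb hne hab l X
  refine hH.consistent hG fun d hd => ?_
  have hdX := hX.2.2.2.2 d hd
  rcases (hH.mem_iff d).1 hd with rfl | rfl | hd
  · rw [hH.next_fst] at hdX ⊢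
    rw [hX.face_fst, face_addEdge hab hb, if_neg (fun h => hX.2.2.1 (hdX.2 h)), hf]
  · rw [hH.next_snd] at hdX ⊢
    rw [hX.face_snd, face_addEdge hab ha, if_pos (hdX.1 hX.2.1)]
  · rw [face_addEdge hab hd]
    by_cases h1 : G.next d = a
    · rw [hH.next_eq_fst d hd h1] at hdX ⊢
      rw [hX.face_fst, if_neg (fun h => hX.2.2.1 (hdX.1 h)), ← h1, hG.face_next hd]
    by_cases h2 : G.next d = b
    · rw [hH.next_eq_snd d hd h2] at hdX ⊢
      rw [hX.face_snd, if_pos (hdX.2 hX.2.1)]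
    · rw [hH.next_eq d hd h1 h2] at hdX ⊢
      rw [face_addEdge hab (hG.next_mem hd), hG.face_next hd]
      simp only [hdX]

theorem IsSplitting.uniqueInvalid (hU : G.UniqueInvalid) (hG : G.Consistent) (ha : a ∈ G.darts)
    (hb : b ∈ G.darts) (hne : a.1 ≠ b.1) (hab : (a.1, b.1) ∉ G.darts)
    (hval : G.face a ∈ G.valid) : (G.addEdge a b l X).UniqueInvalid := by
  have hH := addsEdge_addEdge hG ha hb hne hab l X
  have key : ∀ d ∈ (G.addEdge a b l X).darts,
      (G.addEdge a b l X).face d ∉ (G.addEdge a b l X).valid →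
      d ∈ G.darts ∧ G.face d ∉ G.valid ∧ (G.addEdge a b l X).face d = G.face d := by
    intro d hd hd'
    rcases (hH.mem_iff d).1 hd with rfl | rfl | hd
    · rw [hX.face_fst] at hd'; exact absurd (Set.mem_insert_of_mem _ hval) hd'
    · rw [hX.face_snd] at hd'; exact absurd (Set.mem_insert _ _) hd'
    · rw [hX.valid_iff hG hab hval hd] at hd'
      refine ⟨hd, hd', ?_⟩
      rw [face_addEdge hab hd, if_neg fun h => hd' ?_]
      rw [hX.face_of_mem (hG.notMem_swap hab) hd h]
      exact hval
  intro d hd e he hd' he'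
  obtain ⟨h1, h2, h3⟩ := key d hd hd'
  obtain ⟨h4, h5, h6⟩ := key e he he'
  rw [h3, h6]
  exact hU d h1 e h4 h2 h5

/-- The indicator of `X` is constant along new walks, hence a cycle, with weight one on the new
edge. Adding it `k` times, where `k` is the weight of `c` on this edge, leaves a cycle of the old
graph. Toggling the new face `l` by `k` undoes the change. -/
theorem IsSplitting.cyclesBound (hP : G.CyclesBound) (hG : G.Consistent) (ha : a ∈ G.darts)
    (hb : b ∈ G.darts) (hne : a.1 ≠ b.1) (hab : (a.1, b.1) ∉ G.darts)
    (hf : G.face a = G.face b) : (G.addEdge a b l X).CyclesBound := by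
  have hba := hG.notMem_swap hab
  have hH := addsEdge_addEdge hG ha hb hne hab l X
  have hHc := hX.consistent hG ha hb hne hab hf
  intro c hc
  set x : ℕ × ℕ → ZMod 2 := fun d => if d ∈ X then 1 else 0 with hx
  have hx_ab : x (a.1, b.1) = 0 := if_neg hX.2.2.1
  have hx_ba : x (b.1, a.1) = 1 := if_pos hX.2.1
  have hxcyc : (G.addEdge a b l X).IsCycle x := hHc.isCycle_of_next fun d hd => by
    simp only [hx, hX.2.2.2.2 d hd]
  set k := c (a.1, b.1) + c (b.1, a.1) with hk
  have hcyc : G.IsCycle fun d => c d + k * x d := by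
    intro p
    have h1 := hc p
    have h2 := hxcyc p
    rw [hH.sum_eq hG] at h1 h2
    simp only [add_mul, Finset.sum_add_distrib, mul_assoc, ← Finset.mul_sum]
    rw [hx_ab, hx_ba] at h2
    have h3 : k + k = 0 := CharTwo.add_self_eq_zero _
    linear_combination h1 + k * h2 - (p a.1 + p b.1) * h3 + (p a.1 + p b.1) * hk
  obtain ⟨s, hs⟩ := hP _ hcyc
  have hfl : G.face a ≠ l := hX.1 a ha
  refine ⟨fun f => if f = l then s (G.face a) + k else s f, fun d hd => ?_⟩
  have hface : ∀ d ∈ G.darts, (if (G.addEdge a b l X).face d = l then s (G.face a) + k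
      else s ((G.addEdge a b l X).face d)) = s (G.face d) + k * x d := by
    intro d hd
    rw [face_addEdge hab hd]
    by_cases hdX : d ∈ X
    · simp [hx, hdX, hX.face_of_mem hba hd hdX]
    · simp [hx, hdX, hX.1 d hd]
  have h0 : s (G.face a) + s (G.face a) = 0 := CharTwo.add_self_eq_zero _
  rcases (hH.mem_iff d).1 hd with rfl | rfl | hd
  · simp only [Prod.swap_prod_mk, hX.face_fst, hX.face_snd, hfl, if_true, if_false]
    linear_combination -h0 - hk
  · simp only [Prod.swap_prod_mk, hX.face_fst, hX.face_snd, hfl, if_true, if_false]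
    linear_combination -h0 - hk
  · simp only [hface d hd, hface _ (hG.swap_mem hd)]
    have h1 := hs d hd
    have h2 : k + k = 0 := CharTwo.add_self_eq_zero _
    linear_combination h1 - (x d + x d.swap) * h2

end Splitting

/-- If the portion of the bounding walk between `a` and `b` lies in a region where `φ` is a
coboundary, then drawing an edge preserves the odd walk. -/
theorem AddsEdge.exists_isOddDart (h : AddsEdge G H a b) (hG : G.Consistent) (hH : H.Consistent)
    {φ : ℕ × ℕ → ZMod 2} (hφ : φ (b.1, a.1) = φ (a.1, b.1)) {d₀ : ℕ × ℕ} (h₀ : G.IsOddDart φ d₀)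
    (hval : ∀ d ∈ G.darts, H.face d ∈ H.valid ↔ G.face d ∈ G.valid)
    (hval_ab : H.face (a.1, b.1) ∈ H.valid) (hval_a : G.face a ∈ G.valid)
    {N : Set ℕ} {p : ℕ → ZMod 2}
    (hN : ∀ d ∈ H.darts, d.1 ∈ N → d.2 ∈ N → φ d = p d.1 + p d.2)
    (ha : a.1 ∈ N) (hb : b.1 ∈ N) {n : ℕ} (hn : G.next^[n] a = b)
    (hwalk : ∀ j, 0 < j → j < n → (G.next^[j] a).1 ∈ N) : ∃ d₁, H.IsOddDart φ d₁ := by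
  classical
  obtain ⟨m, hmn, hm0, hm, hmin⟩ := exists_minimal_walk h.fst_ne hn
  have hwalk' : ∀ j, j ≤ m → (G.next^[j] a).1 ∈ N := by
    intro j hj
    rcases Nat.eq_zero_or_pos j with rfl | hj0
    · exact ha
    rcases hj.eq_or_lt with rfl | hj
    · rw [hm]; exact hb
    · exact hwalk j hj0 (by omega)
  set O := G.sideWalk a b m with hO
  set o : ℕ × ℕ → ZMod 2 := fun d => if d ∈ O then 1 else 0 with ho
  have ho_next : ∀ d ∈ H.darts, o (H.next d) = o d := fun d hd => by
    simp only [ho, h.sideWalk_next hG hm0 hm hmin hd, hO]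
  have ho_ab : o (a.1, b.1) = 0 := if_neg (h.notMem_sideWalk hG)
  have ho_ba : o (b.1, a.1) = 1 := if_pos (mem_sideWalk.2 (.inl rfl))
  -- The side walk stays in `N`, where `φ` is a coboundary, so it is even.
  have ho_sum : ∑ d ∈ H.darts, o d * φ d = 0 := by
    refine (hH.isCycle_of_next ho_next).sum_eq_zero p fun d hd hd0 => ?_
    have hdO : d ∈ O := by
      by_contra hdO
      exact hd0 (if_neg hdO)
    rcases mem_sideWalk.1 hdO with rfl | ⟨j, hj, rfl⟩
    · exact hN _ hd hb ha
    · refine hN _ hd (hwalk' j hj.le) ?_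
      have := hwalk' (j + 1) hj
      rwa [Function.iterate_succ_apply', hG.next_fst (hG.iterate_next_mem h.fst_mem j)] at this
  have ho_mem : ∀ d ∈ G.darts, d ∈ O → ∃ j < m, G.next^[j] a = d := by
    intro d hd hdO
    rcases mem_sideWalk.1 hdO with rfl | hj
    · exact absurd hd (hG.notMem_swap h.notMem)
    · exact hj
  -- Adding `k` on the side walk makes the values of `y` on both sides of the new edge equal, so
  -- that `y + k * o` is constant along the walks of `G`. On the new edge itself the contributions
  -- of `y` and `k * o` cancel.
  have hsum : ∀ y : ℕ × ℕ → ZMod 2, (∀ d ∈ H.darts, y (H.next d) = y d) →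
      (∀ d ∈ H.darts, H.face d ∉ H.valid → y d = 0) →
      ∑ d ∈ H.darts, y d * φ d = y d₀ + (y (a.1, b.1) + y (b.1, a.1)) * o d₀ := by
    intro y hy hy0
    set k := y (a.1, b.1) + y (b.1, a.1) with hk
    have hkk : k + k = 0 := CharTwo.add_self_eq_zero _
    have hy_ab : y b = y (a.1, b.1) := by rw [← hy _ h.fst_mem', h.next_fst]
    have hy_ba : y a = y (b.1, a.1) := by rw [← hy _ h.snd_mem', h.next_snd]
    have ho_b : o b = 0 := by rw [← ho_ab, ← ho_next _ h.fst_mem', h.next_fst]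
    have ho_a : o a = 1 := by rw [← ho_ba, ← ho_next _ h.snd_mem', h.next_snd]
    have hself : ∀ z : ZMod 2, z + z = 0 := fun z => CharTwo.add_self_eq_zero z
    have hold := h₀.sum_eq (fun d => y d + k * o d) (fun d hd => ?_) (fun d hd hd' => ?_)
    · rw [← hold]
      have h1 := h.sum_eq hG fun d => (y d + k * o d) * φ d
      simp only [add_mul, Finset.sum_add_distrib, mul_assoc, ← Finset.mul_sum] at h1 ⊢
      rw [ho_sum, ho_ab, ho_ba, hφ] at h1
      linear_combination h1 + φ (a.1, b.1) * hkk - φ (a.1, b.1) * hk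
    · by_cases h1 : G.next d = a
      · have e1 := hy d (h.mem hd)
        have e2 := ho_next d (h.mem hd)
        rw [h.next_eq_fst d hd h1] at e1 e2
        rw [h1, ← e1, ← e2, hy_ba, ho_a, ho_ab]
        linear_combination hk + hself (y (b.1, a.1))
      by_cases h2 : G.next d = b
      · have e1 := hy d (h.mem hd)
        have e2 := ho_next d (h.mem hd)
        rw [h.next_eq_snd d hd h2] at e1 e2
        rw [h2, ← e1, ← e2, hy_ab, ho_b, ho_ba]
        linear_combination -hk - hself (y (b.1, a.1))
      · have e1 := hy d (h.mem hd)
        have e2 := ho_next d (h.mem hd)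
        rw [h.next_eq d hd h1 h2] at e1 e2
        rw [e1, e2]
    · have h2 : d ∉ O := by
        intro hdO
        obtain ⟨j, -, rfl⟩ := ho_mem d hd hdO
        rw [hG.face_iterate_next h.fst_mem] at hd'
        exact hd' hval_a
      rw [hy0 d (h.mem hd) (by rwa [hval d hd])]
      simp [ho, h2]
  have hjoin : ∀ {u w}, G.Joined u w → H.Joined u w := fun huw =>
    Relation.ReflTransGen.mono (fun _ _ hd => h.mem hd) _ _ huw
  obtain ⟨e, he, he', hje⟩ := h₀.joined
  have he'' : H.face e ∉ H.valid := by rwa [hval e he]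
  -- If `d₀` falls on the even side walk, the walk on the other side of the new edge inherits the
  -- oddness.
  by_cases hd₀ : d₀ ∈ O
  · refine ⟨(a.1, b.1), h.fst_mem', hval_ab, fun y hy hy0 => ?_, e, h.mem he, he'', ?_⟩
    · have : y d₀ = y (b.1, a.1) := by
        obtain ⟨j, hj, rfl⟩ := ho_mem d₀ h₀.mem hd₀
        have : ∀ j < m, y (G.next^[j] a) = y a := by
          intro j
          induction j with
          | zero => exact fun _ => rfl
          | succ j ih =>
            intro hj
            have hmem := hG.iterate_next_mem h.fst_mem j
            rw [← ih (by omega), ← hy _ (h.mem hmem), Function.iterate_succ_apply']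
            have e1 : G.next (G.next^[j] a) = G.next^[j + 1] a :=
              (Function.iterate_succ_apply' _ _ _).symm
            by_cases h1 : G.next (G.next^[j] a) = a
            · exfalso
              refine hmin (m - (j + 1)) (by omega) ?_
              rw [← hm, show m = m - (j + 1) + (j + 1) by omega, Function.iterate_add_apply,
                ← e1, h1, Nat.add_sub_cancel]
            · rw [h.next_eq _ hmem h1 (by rw [e1]; exact hmin _ hj)]
        rw [this j hj, ← hy _ h.snd_mem', h.next_snd]
      rw [hsum y hy hy0, show o d₀ = 1 from if_pos hd₀, this]
      have : y (b.1, a.1) + y (b.1, a.1) = 0 := CharTwo.add_self_eq_zero _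
      linear_combination this
    · obtain ⟨j, -, rfl⟩ := ho_mem d₀ h₀.mem hd₀
      exact (hjoin (hG.joined_iterate_next h.fst_mem j)).trans (hjoin hje)
  · refine ⟨d₀, h.mem h₀.mem, (hval _ h₀.mem).2 h₀.valid, fun y hy hy0 => ?_, e, h.mem he, he'',
      hjoin hje⟩
    rw [hsum y hy hy0, show o d₀ = 0 from if_neg hd₀, mul_zero, add_zero]

end PlaneGraph

end GraphAlg

namespace GraphAlg

namespace PlaneGraph

variable {G : PlaneGraph} {R : Finset ℕ}

/-! ### Deleting nodes -/

theorem mem_remove {d : ℕ × ℕ} :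
    d ∈ (G.remove R).darts ↔ d ∈ G.darts ∧ d.1 ∉ R ∧ d.2 ∉ R := by
  simp [remove]

theorem Consistent.bijOn_rot (hG : G.Consistent) :
    Set.BijOn (fun x : ℕ × ℕ => G.next x.swap) (G.darts : Set (ℕ × ℕ)) (G.darts : Set (ℕ × ℕ)) :=
  hG.2.1.comp ⟨fun _ hd => hG.swap_mem hd, Prod.swap_injective.injOn,
    fun d hd => ⟨d.swap, hG.swap_mem hd, Prod.swap_swap d⟩⟩

theorem Consistent.rot_iterate (hG : G.Consistent) {d : ℕ × ℕ} (hd : d ∈ G.darts) (k : ℕ) :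
    (fun x => G.next x.swap)^[k] d ∈ G.darts ∧ ((fun x => G.next x.swap)^[k] d).1 = d.1 := by
  induction k with
  | zero => exact ⟨hd, rfl⟩
  | succ k ih =>
    rw [Function.iterate_succ_apply']
    exact ⟨hG.next_mem (hG.swap_mem ih.1), by rw [hG.next_fst (hG.swap_mem ih.1), ← ih.2]; rfl⟩

/-- All half-edges of the rotation starting from `d.swap` leave the same surviving node, so they
survive exactly if their heads do. The search in `remove` is thus a first return of the rotation. -/
theorem Consistent.remove_next (hG : G.Consistent) {d : ℕ × ℕ}
    (hd : d ∈ (G.remove R).darts) : (G.remove R).next d =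
      firstReturn (fun x => G.next x.swap) ((G.remove R).darts : Set (ℕ × ℕ)) d.swap := by
  have hd' := mem_remove.1 hd
  have hset : {k | ((fun x => G.next x.swap)^[k] (G.next d)).2 ∉ R} =
      {k | (fun x => G.next x.swap)^[k] (G.next d) ∈ ((G.remove R).darts : Set (ℕ × ℕ))} := by
    ext k
    have h := hG.rot_iterate (hG.next_mem hd'.1) k
    rw [Set.mem_ofPred_eq, Set.mem_ofPred_eq, Finset.mem_coe, mem_remove, h.2,
      hG.next_fst hd'.1]
    exact ⟨fun h2 => ⟨h.1, hd'.2.2, h2⟩, fun h2 => h2.2.2⟩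
  change (fun x => G.next x.swap)^[sInf {k | ((fun x => G.next x.swap)^[k] (G.next d)).2 ∉ R}]
    (G.next d) = _
  rw [hset]
  rfl

theorem remove_subset : ((G.remove R).darts : Set (ℕ × ℕ)) ⊆ (G.darts : Set (ℕ × ℕ)) :=
  fun _ hd => (mem_remove.1 hd).1

theorem Consistent.swap_mem_remove (hG : G.Consistent) {d : ℕ × ℕ}
    (hd : d ∈ (G.remove R).darts) : d.swap ∈ (G.remove R).darts := by
  have hd' := mem_remove.1 hd
  exact mem_remove.2 ⟨hG.swap_mem hd'.1, hd'.2.2, hd'.2.1⟩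

/-! ### Merging of faces -/

theorem merged_swap {d : ℕ × ℕ} (hd : d ∈ G.darts) (hR : d.1 ∈ R ∨ d.2 ∈ R) :
    G.Merged R (G.face d) (G.face d.swap) :=
  .rel _ _ ⟨d, hd, hR, rfl, rfl⟩

/-- Only single deleted edges need to be checked for constancy on merged faces. Both colourings in
`ZMod 2` and predicates (`β = Prop`) are used below. -/
theorem Merged.eq_of_swap {β : Type*} {s : ℕ → β}
    (hs : ∀ d ∈ G.darts, (d.1 ∈ R ∨ d.2 ∈ R) → s (G.face d) = s (G.face d.swap)) {f g : ℕ}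
    (h : G.Merged R f g) : s f = s g := by
  induction h with
  | rel _ _ h =>
    obtain ⟨d, hd, hR, rfl, rfl⟩ := h
    exact hs d hd hR
  | refl => rfl
  | symm _ _ _ ih => exact ih.symm
  | trans _ _ _ _ _ ih1 ih2 => exact ih1.trans ih2

theorem Merged.exists_dart (hG : G.Consistent) {d : ℕ × ℕ} (hd : d ∈ G.darts) {g : ℕ}
    (h : G.Merged R (G.face d) g) : ∃ e ∈ G.darts, G.face e = g := by
  have := h.eq_of_swap (s := fun f => ∃ e ∈ G.darts, G.face e = f) fun d hd _ =>
    propext ⟨fun _ => ⟨_, hG.swap_mem hd, rfl⟩, fun _ => ⟨_, hd, rfl⟩⟩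
  exact this.mp ⟨d, hd, rfl⟩

theorem Merged.setOf_eq {f g : ℕ} (h : G.Merged R f g) :
    {k | G.Merged R f k} = {k | G.Merged R g k} :=
  Set.ext fun _ => ⟨fun hk => .trans _ _ _ (.symm _ _ h) hk, fun hk => .trans _ _ _ h hk⟩

theorem merged_sInf (f : ℕ) : G.Merged R f (sInf {g | G.Merged R f g}) :=
  Nat.sInf_mem (s := {g | G.Merged R f g}) ⟨f, .refl f⟩

theorem merged_remove_face (d : ℕ × ℕ) : G.Merged R (G.face d) ((G.remove R).face d) :=
  merged_sInf _

theorem remove_face_eq {d e : ℕ × ℕ} (h : G.Merged R (G.face d) (G.face e)) :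
    (G.remove R).face d = (G.remove R).face e :=
  congrArg sInf h.setOf_eq

theorem remove_valid_iff {d : ℕ × ℕ} : (G.remove R).face d ∈ (G.remove R).valid ↔
    ∀ g, G.Merged R (G.face d) g → g ∈ G.valid :=
  ⟨fun h g hg => h g (.trans _ _ _ (.symm _ _ (merged_remove_face d)) hg),
    fun h g hg => h g (.trans _ _ _ (merged_remove_face d) hg)⟩

theorem valid_of_remove_valid {d : ℕ × ℕ} (h : (G.remove R).face d ∈ (G.remove R).valid) :
    G.face d ∈ G.valid :=
  remove_valid_iff.1 h _ (.refl _)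

/-- The half-edges skipped by the rotation are incident with `R`, and the two faces at each of them
are merged. -/
theorem Consistent.merged_remove_next (hG : G.Consistent) {d : ℕ × ℕ}
    (hd : d ∈ (G.remove R).darts) : G.Merged R (G.face d) (G.face ((G.remove R).next d)) := by
  obtain ⟨k, hk, -, hmin⟩ := firstReturn_spec (Finset.finite_toSet G.darts) hG.bijOn_rot
    remove_subset (hG.swap_mem_remove hd)
  have hd' := mem_remove.1 (hG.swap_mem_remove hd)
  rw [hG.remove_next hd, hk]
  have : ∀ j ≤ k, G.Merged R (G.face d)
      (G.face ((fun x => G.next x.swap)^[j + 1] d.swap)) := by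
    intro j
    induction j with
    | zero =>
      intro _
      change G.Merged R (G.face d) (G.face (G.next d))
      rw [hG.face_next (mem_remove.1 hd).1]
      exact .refl _
    | succ j ih =>
      intro hj
      have hmem := hG.rot_iterate hd'.1 (j + 1)
      rw [Function.iterate_succ_apply', hG.face_next (hG.swap_mem hmem.1)]
      refine .trans _ _ _ (ih (by omega)) (merged_swap hmem.1 (.inr ?_))
      by_contra hR
      exact hmin j (by omega) (mem_remove.2 ⟨hmem.1, hmem.2 ▸ hd'.2.1, hR⟩)
  exact this k le_rfl

/-- The new `next` is reversal followed by a first return of the old rotation, both of them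
permutations. The new rotation is this first return, so it remains cyclic at each node. -/
theorem Consistent.remove (hG : G.Consistent) (R : Finset ℕ) : (G.remove R).Consistent := by
  have hfin := Finset.finite_toSet G.darts
  have hret := bijOn_firstReturn hfin hG.bijOn_rot (remove_subset (R := R))
  have hbij : Set.BijOn (G.remove R).next ((G.remove R).darts : Set (ℕ × ℕ))
      ((G.remove R).darts : Set (ℕ × ℕ)) := by
    refine (hret.comp (?_ : Set.BijOn Prod.swap _ _)).congr fun d hd => (hG.remove_next hd).symm
    exact ⟨fun _ hd => hG.swap_mem_remove hd, Prod.swap_injective.injOn,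
      fun d hd => ⟨d.swap, hG.swap_mem_remove hd, Prod.swap_swap d⟩⟩
  refine ⟨fun d hd => ?_, hbij, fun d hd => ?_, fun d hd e he hde => ?_, fun d hd => ?_⟩
  · have hd' := mem_remove.1 hd
    exact ⟨hG.swap_mem_remove hd, hG.fst_ne_snd hd'.1,
      Finset.mem_sdiff.2 ⟨hG.fst_mem hd'.1, hd'.2.1⟩⟩
  · have hd' := hG.swap_mem_remove hd
    obtain ⟨k, hk, -, -⟩ := firstReturn_spec hfin hG.bijOn_rot remove_subset hd'
    rw [hG.remove_next hd, hk, (hG.rot_iterate (mem_remove.1 hd').1 _).2]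
    rfl
  · obtain ⟨n, rfl⟩ := hG.2.2.2.1 d (mem_remove.1 hd).1 e (mem_remove.1 he).1 hde
    obtain ⟨k, hk⟩ := exists_iterate_firstReturn hfin hG.bijOn_rot remove_subset n d hd he
    refine ⟨k, hk ▸ ?_⟩
    have : ∀ j, (fun x => (G.remove R).next x.swap)^[j] d =
        (firstReturn (fun x => G.next x.swap) ((G.remove R).darts : Set (ℕ × ℕ)))^[j] d := by
      intro j
      induction j with
      | zero => rfl
      | succ j ih =>
        rw [Function.iterate_succ_apply', Function.iterate_succ_apply', ih,
          hG.remove_next (hG.swap_mem_remove (iterate_mem hret.mapsTo hd j)), Prod.swap_swap]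
    exact this k
  · exact remove_face_eq (.symm _ _ (hG.merged_remove_next hd))

/-- A merged face is invalid only if it contains an invalid old face, and there is only one of these
on the half-edges. -/
theorem UniqueInvalid.exists_merged (hU : G.UniqueInvalid) (hG : G.Consistent) {g : ℕ × ℕ}
    (hg : g ∈ G.darts) (hg' : G.face g ∉ G.valid) {d : ℕ × ℕ} (hd : d ∈ G.darts)
    (hd' : (G.remove R).face d ∉ (G.remove R).valid) : G.Merged R (G.face d) (G.face g) := by
  rw [remove_valid_iff] at hd'
  push Not at hd'
  obtain ⟨f, hf, hfv⟩ := hd'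
  obtain ⟨e, he, rfl⟩ := hf.exists_dart hG hd
  rwa [hU g hg e he hg' hfv]

theorem UniqueInvalid.remove (hU : G.UniqueInvalid) (hG : G.Consistent) (R : Finset ℕ) :
    (G.remove R).UniqueInvalid := by
  intro d hd e he hd' he'
  have hd0 := (mem_remove.1 hd).1
  have he0 := (mem_remove.1 he).1
  have h := hd'
  rw [remove_valid_iff] at h
  push Not at h
  obtain ⟨f, hf, hfv⟩ := h
  obtain ⟨x, hx, rfl⟩ := hf.exists_dart hG hd0
  exact (remove_face_eq (hU.exists_merged hG hx hfv hd0 hd')).trans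
    (remove_face_eq (hU.exists_merged hG hx hfv he0 he')).symm

/-- A chain of the smaller graph, extended by zero. -/
theorem IsCycle.of_remove {c : ℕ × ℕ → ZMod 2} (hc : (G.remove R).IsCycle c) :
    G.IsCycle fun d => if d.1 ∉ R ∧ d.2 ∉ R then c d else 0 := by
  intro p
  refine Eq.trans ?_ (hc p)
  simp only [remove, Finset.sum_filter, ite_mul, zero_mul]

/-- A cycle of the smaller graph bounds a set of faces of the old graph that is compatible with
the merging of faces. -/
theorem CyclesBound.exists_boundary_remove (hP : G.CyclesBound)
    {c : ℕ × ℕ → ZMod 2} (hc : (G.remove R).IsCycle c) (g : ℕ) :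
    ∃ s : ℕ → ZMod 2, s g = 0 ∧ (∀ f f', G.Merged R f f' → s f = s f') ∧
      ∀ d ∈ G.darts, (if d.1 ∉ R ∧ d.2 ∉ R then c d else 0) +
        (if d.2 ∉ R ∧ d.1 ∉ R then c d.swap else 0) = s (G.face d) + s (G.face d.swap) := by
  obtain ⟨s, hsg, hs⟩ := hP.exists_boundary hc.of_remove g
  refine ⟨s, hsg, fun f f' hf => hf.eq_of_swap fun d hd hR => ?_, hs⟩
  have := hs d hd
  rw [if_neg (by tauto), if_neg (by simp only [Prod.fst_swap, Prod.snd_swap]; tauto),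
    add_zero] at this
  exact CharTwo.add_eq_zero.1 this.symm

theorem CyclesBound.remove (hP : G.CyclesBound) (R : Finset ℕ) :
    (G.remove R).CyclesBound := by
  intro c hc
  obtain ⟨s, -, hs, hsd⟩ := hP.exists_boundary_remove hc 0
  refine ⟨s, fun d hd => ?_⟩
  obtain ⟨hd, h1, h2⟩ := mem_remove.1 hd
  rw [← hs _ _ (merged_remove_face d), ← hs _ _ (merged_remove_face d.swap), ← hsd d hd,
    if_pos ⟨h1, h2⟩, if_pos ⟨h2, h1⟩]

open Classical in
/-- The first node outside `R` on the bounding walk that starts with `d`. -/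
noncomputable def landing (G : PlaneGraph) (R : Finset ℕ) (d : ℕ × ℕ) : ℕ :=
  if h : ∃ k, (G.next^[k] d).1 ∉ R then (G.next^[Nat.find h] d).1 else 0

theorem landing_of_notMem {d : ℕ × ℕ} (hd : d.1 ∉ R) : G.landing R d = d.1 := by
  classical
  have h : ∃ k, (G.next^[k] d).1 ∉ R := ⟨0, hd⟩
  have h0 : Nat.find h = 0 := (Nat.find_eq_zero h).2 hd
  rw [landing, dif_pos h, h0]
  rfl

theorem landing_next {d : ℕ × ℕ} (hd : d.1 ∈ R) : G.landing R (G.next d) = G.landing R d := by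
  classical
  unfold landing
  by_cases h : ∃ k, (G.next^[k] (G.next d)).1 ∉ R
  · have h' : ∃ k, (G.next^[k] d).1 ∉ R := h.imp' Nat.succ fun k hk => hk
    rw [dif_pos h, dif_pos h', Nat.find_comp_succ h' h (not_not.2 hd)]
    rfl
  · have h' : ¬ ∃ k, (G.next^[k] d).1 ∉ R := by
      rintro ⟨k, hk⟩
      cases k with
      | zero => exact hk hd
      | succ k => exact h ⟨k, hk⟩
    rw [dif_neg h, dif_neg h']

/-- The walk is periodic and starts outside `R`, so it does come back out of `R`; the default value
in `landing` is not used. -/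
theorem Consistent.exists_landing (hG : G.Consistent) {d : ℕ × ℕ} (hd : d ∈ G.darts)
    (h1 : d.1 ∉ R) : ∃ n, 0 < n ∧ G.landing R (G.next d) = (G.next^[n] d).1 ∧
      (G.next^[n] d).1 ∉ R ∧ ∀ j, 0 < j → j < n → (G.next^[j] d).1 ∈ R := by
  classical
  obtain ⟨k, hk⟩ := exists_iterate_eq_self (Finset.finite_toSet G.darts) hG.2.1 hd
  have h : ∃ k, (G.next^[k] (G.next d)).1 ∉ R := ⟨k, by
    rw [← Function.iterate_succ_apply, Nat.succ_eq_add_one, hk]; exact h1⟩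
  refine ⟨Nat.find h + 1, Nat.succ_pos _, ?_, Nat.find_spec h, fun j hj0 hj => ?_⟩
  · rw [landing, dif_pos h]; rfl
  · have := Nat.find_min h (m := j - 1) (by omega)
    rw [not_not, ← Function.iterate_succ_apply, Nat.succ_eq_add_one, Nat.sub_add_cancel hj0] at this
    exact this

/-- What the second inner loop achieves: the nodes of `R` and their neighbours lie in a region `N`
where `φ` is a coboundary, and each portion of a bounding walk of a valid face that runs through
`R` has end nodes that are equal or adjacent. -/
structure Removable (G : PlaneGraph) (R : Finset ℕ) (φ : ℕ × ℕ → ZMod 2) (N : Set ℕ)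
    (p : ℕ → ZMod 2) : Prop where
  subset : ∀ v ∈ R, v ∈ N
  nbr : ∀ d ∈ G.darts, d.2 ∈ R → d.1 ∈ N
  cobound : ∀ d ∈ G.darts, d.1 ∈ N → d.2 ∈ N → φ d = p d.1 + p d.2
  good : ∀ d ∈ G.darts, G.face d ∈ G.valid → d.1 ∉ R → d.2 ∈ R → ∀ n, 0 < n →
    (∀ j, 0 < j → j < n → (G.next^[j] d).1 ∈ R) → (G.next^[n] d).1 ∉ R →
    d.1 = (G.next^[n] d).1 ∨ (d.1, (G.next^[n] d).1) ∈ G.darts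

variable {φ : ℕ × ℕ → ZMod 2} {N : Set ℕ} {p : ℕ → ZMod 2}

theorem Removable.cobound_of_inc (h : G.Removable R φ N p) (hG : G.Consistent) {d : ℕ × ℕ}
    (hd : d ∈ G.darts) (hR : d.1 ∈ R ∨ d.2 ∈ R) : φ d = p d.1 + p d.2 := by
  rcases hR with hR | hR
  · exact h.cobound d hd (h.subset _ hR) (h.nbr _ (hG.swap_mem hd) hR)
  · exact h.cobound d hd (h.nbr _ hd hR) (h.subset _ hR)

theorem Removable.landing (h : G.Removable R φ N p) (hG : G.Consistent) {d : ℕ × ℕ}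
    (hd : d ∈ G.darts) (hval : G.face d ∈ G.valid) (h1 : d.1 ∉ R) (h2 : d.2 ∈ R) :
    G.landing R (G.next d) ∉ R ∧ G.landing R (G.next d) ∈ N ∧
      (d.1 = G.landing R (G.next d) ∨ (d.1, G.landing R (G.next d)) ∈ G.darts) := by
  obtain ⟨n, hn, hl, hnR, hj⟩ := hG.exists_landing hd h1
  rw [hl]
  refine ⟨hnR, ?_, h.good d hd hval h1 h2 n hn hj hnR⟩
  -- As `d.2 ∈ R`, the landing is not the first node after `d.1`. Its predecessor on the walk is
  -- therefore in `R`, which makes the landing a neighbour of `R`.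
  have hn1 : n ≠ 1 := by
    rintro rfl
    refine hnR ?_
    rw [Function.iterate_one, hG.next_fst hd]
    exact h2
  have hmem := hG.iterate_next_mem hd (n - 1)
  have he : (G.next^[n] d).1 = (G.next^[n - 1] d).2 := by
    rw [← hG.next_fst hmem, ← Function.iterate_succ_apply' G.next, Nat.succ_eq_add_one,
      Nat.sub_add_cancel hn]
  rw [he]
  exact h.nbr _ (hG.swap_mem hmem) (hj _ (by omega) (by omega))

/-- The portions in `R` of bounding walks of valid faces, closed up by edges between their end
nodes, form a cycle in the region `N`. -/
theorem Removable.exists_cycle (h : G.Removable R φ N p) (hG : G.Consistent)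
    {y : ℕ × ℕ → ZMod 2} (hy : ∀ d ∈ G.darts, y (G.next d) = y d)
    (hy0 : ∀ d ∈ G.darts, G.face d ∉ G.valid → y d = 0) :
    ∃ c, G.IsCycle c ∧ ∑ d ∈ G.darts, c d * φ d = 0 ∧
      ∀ d ∈ G.darts, (d.1 ∈ R ∨ d.2 ∈ R) → c d = y d := by
  classical
  set e : ℕ × ℕ → Prop := fun b => b.1 ∉ R ∧ b.2 ∈ R ∧ b.1 ≠ G.landing R (G.next b) with he
  set pr : ℕ × ℕ → ℕ × ℕ := fun b => (b.1, G.landing R (G.next b)) with hpr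
  have hval : ∀ b ∈ G.darts, y b ≠ 0 → G.face b ∈ G.valid := fun b hb hyb => by
    by_contra hv
    exact hyb (hy0 b hb hv)
  -- The closing edges, counted with multiplicity, since several portions may have the same end
  -- nodes.
  set c₂ : ℕ × ℕ → ZMod 2 := fun d =>
    ∑ b ∈ G.darts, if e b ∧ pr b = d then y b else 0 with hc₂
  have hc₂_ne : ∀ d, c₂ d ≠ 0 → ∃ b ∈ G.darts, e b ∧ pr b = d ∧ y b ≠ 0 := by
    intro d hd
    obtain ⟨b, hb, hb0⟩ := Finset.exists_ne_zero_of_sum_ne_zero hd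
    by_cases hb' : e b ∧ pr b = d
    · rw [if_pos hb'] at hb0
      exact ⟨b, hb, hb'.1, hb'.2, hb0⟩
    · exact absurd (if_neg hb') hb0
  have hc₂_sum : ∀ F : ℕ × ℕ → ZMod 2, ∑ d ∈ G.darts, c₂ d * F d =
      ∑ b ∈ G.darts, if e b then y b * F (pr b) else 0 := by
    intro F
    simp only [hc₂, Finset.sum_mul]
    rw [Finset.sum_comm]
    refine Finset.sum_congr rfl fun b hb => ?_
    by_cases hb' : e b
    · by_cases hyb : y b = 0
      · simp [hyb]
      have hmem : pr b ∈ G.darts :=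
        (h.landing hG hb (hval b hb hyb) hb'.1 hb'.2.1).2.2.resolve_left hb'.2.2
      simp [hb', hmem]
    · simp [hb']
  set c₁ : ℕ × ℕ → ZMod 2 := fun d => if d.1 ∈ R ∨ d.2 ∈ R then y d else 0 with hc₁
  have hcyc : G.IsCycle fun d => c₁ d + c₂ d := by
    intro q
    -- Landings telescope along a walk just as tails do in `hB`. Adding the two identities termwise
    -- cancels everything outside `R`, and at each entry into `R` leaves the boundary of the edge
    -- from the entry node together with that of its closing edge.
    have hA : ∑ d ∈ G.darts,
        y d * (q (G.landing R d) + q (G.landing R (G.next d))) = 0 := by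
      have h1 : ∑ d ∈ G.darts, y d * q (G.landing R (G.next d)) =
          ∑ d ∈ G.darts, y d * q (G.landing R d) := by
        rw [← hG.sum_next fun d => y d * q (G.landing R d)]
        exact Finset.sum_congr rfl fun d hd => by rw [hy d hd]
      simp only [mul_add, Finset.sum_add_distrib, h1]
      exact CharTwo.add_self_eq_zero _
    have hB := hG.isCycle_of_next hy q
    have hAB : ∑ d ∈ G.darts, (y d * (q d.1 + q d.2) +
        y d * (q (G.landing R d) + q (G.landing R (G.next d)))) = 0 := by
      rw [Finset.sum_add_distrib, hA, hB, add_zero]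
    simp only [add_mul _ _ (q _ + q _)]
    rw [Finset.sum_add_distrib, hc₂_sum fun d => q d.1 + q d.2, ← Finset.sum_add_distrib]
    refine Eq.trans (Finset.sum_congr rfl fun d hd => ?_) hAB
    have hself : ∀ z : ZMod 2, z + z = 0 := fun z => CharTwo.add_self_eq_zero z
    simp only [hc₁, he, hpr]
    by_cases h1 : d.1 ∈ R
    · rw [if_pos (.inl h1), if_neg (fun h => h.1 h1), landing_next h1]
      linear_combination (-y d) * hself (q (G.landing R d))
    rw [landing_of_notMem h1]
    by_cases h2 : d.2 ∈ R
    · rw [if_pos (.inr h2)]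
      by_cases h3 : d.1 = G.landing R (G.next d)
      · rw [if_neg (fun h => h.2.2 h3), ← h3]
        linear_combination (-y d) * hself (q d.1)
      · rw [if_pos ⟨h1, h2, h3⟩]
    · rw [if_neg (by tauto), if_neg (by tauto), landing_of_notMem (by rwa [hG.next_fst hd]),
        hG.next_fst hd]
      linear_combination (-1 : ZMod 2) * hself (y d * (q d.1 + q d.2))
  refine ⟨_, hcyc, hcyc.sum_eq_zero p fun d hd hd0 => ?_, fun d hd hR => ?_⟩
  · by_cases hR : d.1 ∈ R ∨ d.2 ∈ R
    · exact h.cobound_of_inc hG hd hR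
    · have : c₂ d ≠ 0 := by simpa [hc₁, hR] using hd0
      obtain ⟨b, hb, hb', rfl, hyb⟩ := hc₂_ne d this
      exact h.cobound _ hd (h.nbr b hb hb'.2.1)
        (h.landing hG hb (hval b hb hyb) hb'.1 hb'.2.1).2.1
  · have : c₂ d = 0 := by
      by_contra hd0
      obtain ⟨b, hb, hb', rfl, hyb⟩ := hc₂_ne d hd0
      rcases hR with hR | hR
      · exact hb'.1 hR
      · exact (h.landing hG hb (hval b hb hyb) hb'.1 hb'.2.1).1 hR
    simp only [hc₁, this, if_pos hR, add_zero]

/-! ### The odd walk under deletion of nodes -/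

theorem IsOddDart.iterate {d₀ : ℕ × ℕ} (h₀ : G.IsOddDart φ d₀) (hG : G.Consistent) (k : ℕ) :
    G.IsOddDart φ (G.next^[k] d₀) := by
  refine ⟨hG.iterate_next_mem h₀.mem k, ?_, fun y hy hy0 => ?_, ?_⟩
  · rw [hG.face_iterate_next h₀.mem]; exact h₀.valid
  · rw [h₀.sum_eq y hy hy0]
    induction k with
    | zero => rfl
    | succ k ih => rw [Function.iterate_succ_apply', hy _ (hG.iterate_next_mem h₀.mem k), ih]
  · obtain ⟨e, he, he', hj⟩ := h₀.joined
    exact ⟨e, he, he', (hG.joined_symm (hG.joined_iterate_next h₀.mem k)).trans hj⟩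

/-- Otherwise every half-edge of the odd walk would be incident with `R`. There `φ` is a coboundary,
so the walk would be even. -/
theorem IsOddDart.exists_notMem {d₀ : ℕ × ℕ} (h₀ : G.IsOddDart φ d₀) (hG : G.Consistent)
    (h : G.Removable R φ N p) : ∃ d₁, G.IsOddDart φ d₁ ∧ d₁.1 ∉ R ∧ d₁.2 ∉ R := by
  classical
  by_contra hcon
  push Not at hcon
  set y : ℕ × ℕ → ZMod 2 := fun x => if ∃ k, G.next^[k] d₀ = x then 1 else 0 with hy
  have hy_next : ∀ d ∈ G.darts, y (G.next d) = y d := by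
    intro d hd
    have : (∃ k, G.next^[k] d₀ = G.next d) ↔ ∃ k, G.next^[k] d₀ = d := by
      constructor
      · rintro ⟨k, hk⟩
        cases k with
        | zero =>
          obtain ⟨n, hn⟩ := exists_iterate_eq_self (Finset.finite_toSet G.darts) hG.2.1 hd
          refine ⟨n, ?_⟩
          rw [show d₀ = G.next d from hk, ← Function.iterate_succ_apply]
          exact hn
        | succ k =>
          rw [Function.iterate_succ_apply'] at hk
          exact ⟨k, hG.next_inj (hG.iterate_next_mem h₀.mem k) hd hk⟩
      · rintro ⟨k, hk⟩
        exact ⟨k + 1, by rw [Function.iterate_succ_apply', hk]⟩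
    simp only [hy, this]
  have hy_ne : ∀ d, y d ≠ 0 → ∃ k, G.next^[k] d₀ = d := by
    intro d hd
    by_contra hk
    exact hd (if_neg hk)
  have h1 := h₀.sum_eq y hy_next fun d _ hd' => by
    by_contra hd0
    obtain ⟨k, rfl⟩ := hy_ne d hd0
    rw [hG.face_iterate_next h₀.mem] at hd'
    exact hd' h₀.valid
  have h2 := (hG.isCycle_of_next hy_next).sum_eq_zero p (φ := φ) fun d hd hd0 => by
    obtain ⟨k, rfl⟩ := hy_ne d hd0
    refine h.cobound_of_inc hG hd ?_
    by_contra hR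
    push Not at hR
    exact hR.2 (hcon _ (h₀.iterate hG k) hR.1)
  rw [h1, show y d₀ = 1 from if_pos ⟨0, rfl⟩] at h2
  exact one_ne_zero h2

/-- Let `c` be the even cycle belonging to the portions in `R` of the walks of the face of `d₁`, and
let `s` be a face set that it bounds without the invalid face `g`. Evenness of `c` forces `s (G.face
d₁) = 0`. Across deleted edges, `s` changes exactly as the indicator of the face of `d₁` does, so
their sum is constant on merged faces; but it is one at `d₁` and zero at `g`. -/
theorem IsOddDart.valid_remove {d₁ : ℕ × ℕ} (h₁ : G.IsOddDart φ d₁) (hG : G.Consistent)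
    (hP : G.CyclesBound) (hU : G.UniqueInvalid) (hφ : ∀ d ∈ G.darts, φ d.swap = φ d)
    (h : G.Removable R φ N p) : (G.remove R).face d₁ ∈ (G.remove R).valid := by
  classical
  rw [remove_valid_iff]
  by_contra hcon
  push Not at hcon
  obtain ⟨g, hg, hgv⟩ := hcon
  obtain ⟨e, he, heg⟩ := hg.exists_dart hG h₁.mem
  set y : ℕ × ℕ → ZMod 2 := fun x => if G.face x = G.face d₁ then 1 else 0 with hy
  obtain ⟨c, hc, hcφ, hcy⟩ := h.exists_cycle hG (y := y)
    (fun d hd => by simp only [hy, hG.face_next hd])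
    (fun d hd hd' => if_neg fun h0 : G.face d = G.face d₁ => hd' (h0 ▸ h₁.valid))
  obtain ⟨s, hsg, hs⟩ := hP.exists_boundary hc g
  -- The sum of `s (G.face d) * φ d` equals `s (G.face d₁)` by oddness of `d₁`, and zero because `c`
  -- is even.
  have hs1 : s (G.face d₁) = 0 := by
    rw [← h₁.sum_eq (fun d => s (G.face d)) (fun d hd => by rw [hG.face_next hd]) ?_,
      ← hG.sum_boundary hφ hs, hcφ]
    intro d hd hd'
    rw [hU d hd e he hd' (heg ▸ hgv), heg, hsg]
  have hst := hg.eq_of_swap (s := fun f => s f + if f = G.face d₁ then 1 else 0)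
    fun d hd hR => by
      have h1 := hs d hd
      rw [hcy d hd hR, hcy _ (hG.swap_mem hd) hR.symm] at h1
      have h2 : ∀ a b c d : ZMod 2, a + b = c + d → c + a = d + b := by decide
      exact h2 _ _ _ _ h1
  have hne : g ≠ G.face d₁ := fun h0 => hgv (h0 ▸ h₁.valid)
  simp only [if_true, hs1, hsg, if_neg hne] at hst
  exact absurd hst (by decide)

/-- Suppose the component of `d₁` touches only valid faces after the deletion. The valid walks
landing in this component then use every surviving edge on both sides or on neither, so modulo two
only edges incident with `R` remain. There `φ` is a coboundary, so the total is even, although it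
includes the odd walk. -/
theorem IsOddDart.joined_remove {d₁ : ℕ × ℕ} (h₁ : G.IsOddDart φ d₁) (hG : G.Consistent)
    (hφ : ∀ d ∈ G.darts, φ d.swap = φ d) (h : G.Removable R φ N p) (h1R : d₁.1 ∉ R) :
    ∃ e ∈ (G.remove R).darts, (G.remove R).face e ∉ (G.remove R).valid ∧
      (G.remove R).Joined d₁.1 e.1 := by
  classical
  by_contra hcon
  push Not at hcon
  have hG' := hG.remove R
  set y : ℕ × ℕ → ZMod 2 := fun x =>
    if G.face x ∈ G.valid ∧ (G.remove R).Joined d₁.1 (G.landing R x) then 1 else 0 with hy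
  have hadj : ∀ {u w}, (u, w) ∈ (G.remove R).darts →
      ((G.remove R).Joined d₁.1 w ↔ (G.remove R).Joined d₁.1 u) := fun huw =>
    ⟨fun hj => hj.tail (hG'.swap_mem huw), fun hj => hj.tail huw⟩
  have hy_next : ∀ d ∈ G.darts, y (G.next d) = y d := by
    intro d hd
    have : (G.face (G.next d) ∈ G.valid ∧ (G.remove R).Joined d₁.1 (G.landing R (G.next d))) ↔
        (G.face d ∈ G.valid ∧ (G.remove R).Joined d₁.1 (G.landing R d)) := by
      rw [hG.face_next hd]
      refine and_congr_right fun hval => ?_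
      by_cases h1 : d.1 ∈ R
      · rw [landing_next h1]
      rw [landing_of_notMem h1]
      by_cases h2 : d.2 ∈ R
      · obtain ⟨h3, -, h4⟩ := h.landing hG hd hval h1 h2
        rcases h4 with h4 | h4
        · rw [← h4]
        · exact hadj (mem_remove.2 ⟨h4, h1, h3⟩)
      · rw [landing_of_notMem (by rwa [hG.next_fst hd]), hG.next_fst hd]
        exact hadj (mem_remove.2 ⟨hd, h1, h2⟩)
    simp only [hy, this]
  have hy_swap : ∀ d ∈ G.darts, ¬ (d.1 ∈ R ∨ d.2 ∈ R) → y d.swap = y d := by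
    have key : ∀ d ∈ G.darts, ¬ (d.1 ∈ R ∨ d.2 ∈ R) →
        (G.face d ∈ G.valid ∧ (G.remove R).Joined d₁.1 (G.landing R d)) →
        (G.face d.swap ∈ G.valid ∧ (G.remove R).Joined d₁.1 (G.landing R d.swap)) := by
      intro d hd hR hd'
      push Not at hR
      have hdm : d ∈ (G.remove R).darts := mem_remove.2 ⟨hd, hR⟩
      rw [landing_of_notMem hR.1] at hd'
      rw [landing_of_notMem (show d.swap.1 ∉ R from hR.2)]
      have hj : (G.remove R).Joined d₁.1 d.swap.1 := hd'.2.tail hdm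
      refine ⟨?_, hj⟩
      by_contra hval
      exact hcon _ (hG'.swap_mem hdm) (fun hv => hval (valid_of_remove_valid hv)) hj
    intro d hd hR
    have : (G.face d.swap ∈ G.valid ∧ (G.remove R).Joined d₁.1 (G.landing R d.swap)) ↔
        (G.face d ∈ G.valid ∧ (G.remove R).Joined d₁.1 (G.landing R d)) :=
      ⟨fun h0 => key d.swap (hG.swap_mem hd) (fun h => hR h.symm) h0, key d hd hR⟩
    simp only [hy, this]
  -- On the surviving edges `y` is symmetric, so there its pairing with a symmetric function
  -- vanishes.
  have hsplit : ∀ F : ℕ × ℕ → ZMod 2, (∀ d ∈ G.darts, F d.swap = F d) →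
      ∑ d ∈ G.darts, (if d.1 ∈ R ∨ d.2 ∈ R then y d else 0) * F d =
        ∑ d ∈ G.darts, y d * F d := by
    intro F hF
    rw [← CharTwo.add_eq_zero, ← Finset.sum_add_distrib]
    refine Eq.trans (Finset.sum_congr rfl fun d _ => ?_)
      (hG.sum_symm (fun d => if d.1 ∈ R ∨ d.2 ∈ R then 0 else y d * F d) fun d hd => ?_)
    · split_ifs
      · exact CharTwo.add_self_eq_zero _
      · rw [zero_mul, zero_add]
    · simp only [Prod.fst_swap, Prod.snd_swap, or_comm (a := d.2 ∈ R)]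
      by_cases hR : d.1 ∈ R ∨ d.2 ∈ R
      · rw [if_pos hR, if_pos hR]
      · rw [if_neg hR, if_neg hR, hF d hd, hy_swap d hd hR]
  have hcyc : G.IsCycle fun d => if d.1 ∈ R ∨ d.2 ∈ R then y d else 0 := by
    intro q
    rw [hsplit (fun d => q d.1 + q d.2) fun d _ => add_comm _ _]
    exact hG.isCycle_of_next hy_next q
  have h0 := hcyc.sum_eq_zero p (φ := φ) fun d hd hd0 => by
    refine h.cobound_of_inc hG hd ?_
    by_contra hR
    exact hd0 (if_neg hR)
  rw [hsplit φ hφ, h₁.sum_eq y hy_next fun d _ hd' => if_neg fun h => hd' h.1] at h0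
  have : y d₁ = 1 := if_pos ⟨h₁.valid, by rw [landing_of_notMem h1R]; exact .refl⟩
  rw [this] at h0
  exact one_ne_zero h0

/-- Deleting nodes after the second inner loop preserves the odd walk. -/
theorem IsOddDart.exists_remove {d₀ : ℕ × ℕ} (h₀ : G.IsOddDart φ d₀) (hG : G.Consistent)
    (hP : G.CyclesBound) (hU : G.UniqueInvalid) (hφ : ∀ d ∈ G.darts, φ d.swap = φ d)
    (h : G.Removable R φ N p) : ∃ d₁, (G.remove R).IsOddDart φ d₁ := by
  obtain ⟨d₁, h₁, hR1, hR2⟩ := h₀.exists_notMem hG h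
  have hG' := hG.remove R
  have hd₁ : d₁ ∈ (G.remove R).darts := mem_remove.2 ⟨h₁.mem, hR1, hR2⟩
  obtain ⟨e, he, he', hj⟩ := h₁.joined_remove hG hφ h hR1
  refine ⟨d₁, hd₁, h₁.valid_remove hG hP hU hφ h, fun y hy hy0 => ?_, e, he, he', hj⟩
  obtain ⟨g, hg, hg', -⟩ := h₁.joined
  have hcyc := hG'.isCycle_of_next hy
  obtain ⟨s, hsg, hsm, hs⟩ := hP.exists_boundary_remove hcyc (G.face g)
  -- Extended by zero, `y` bounds a face set `s` of the old graph that avoids the invalid face, so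
  -- oddness in the old graph evaluates the sum.
  have h1 : ∑ d ∈ (G.remove R).darts, y d * φ d = s (G.face d₁) := by
    rw [← h₁.sum_eq (fun d => s (G.face d)) (fun d hd => by rw [hG.face_next hd])
      (fun d hd hd' => by rw [hU d hd g hg hd' hg', hsg]), ← hG.sum_boundary hφ hs]
    simp only [remove, Finset.sum_filter, ite_mul, zero_mul]
  -- The function `s + y` is constant on components of the new graph. At `e`, on an invalid face,
  -- both terms vanish; hence `s (G.face d₁) = y d₁`. This is where the condition `joined` is
  -- needed.
  have hF := hG'.eq_of_joined (F := fun d => s (G.face d) + y d)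
    (fun d hd => by rw [hy d hd, hsm _ _ (hG.merged_remove_next hd)])
    (fun d hd => by
      obtain ⟨hd, h1, h2⟩ := mem_remove.1 hd
      have := hs d hd
      rw [if_pos ⟨h1, h2⟩, if_pos ⟨h2, h1⟩] at this
      have h2 : ∀ a b c d : ZMod 2, a + b = c + d → d + b = c + a := by decide
      exact h2 _ _ _ _ this) hd₁ he hj
  rw [h1]
  simp only [hy0 e he he', hsm _ _ (hU.exists_merged hG hg hg' (mem_remove.1 he).1 he'), hsg,
    add_zero] at hF
  exact CharTwo.add_eq_zero.1 hF

end PlaneGraph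

end GraphAlg

namespace GraphAlg

namespace PlaneGraph

variable {G H : PlaneGraph} {a b : ℕ × ℕ}

/-! ### Visited pairs of nodes -/

/-- The nodes `u` and `w` are equal or adjacent, or no portion of a bounding walk of a valid face
leads from `u` to `w` through nodes of `R`. -/
def Visited (G : PlaneGraph) (R : Finset ℕ) (u w : ℕ) : Prop :=
  u = w ∨ (u, w) ∈ G.darts ∨ ∀ d ∈ G.darts, G.face d ∈ G.valid → d.1 = u →
    ∀ n, (∀ j, 0 < j → j < n → (G.next^[j] d).1 ∈ R) → (G.next^[n] d).1 ≠ w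

/-- The new edge can be entered only at `a.1` or `b.1`, which lie outside `R`; a walk inside `R`
does not notice it. -/
theorem AddsEdge.iterate_next (h : AddsEdge G H a b) (hG : G.Consistent) {R : Finset ℕ}
    (ha : a.1 ∉ R) (hb : b.1 ∉ R) {d : ℕ × ℕ} (hd : d ∈ G.darts) (n : ℕ)
    (hn : ∀ j, 0 < j → j ≤ n → (H.next^[j] d).1 ∈ R) : H.next^[n] d = G.next^[n] d := by
  induction n with
  | zero => rfl
  | succ n ih =>
    have ih := ih fun j h0 hj => hn j h0 (by omega)
    have hmem := hG.iterate_next_mem hd n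
    have h1 := hn (n + 1) (Nat.succ_pos n) le_rfl
    rw [Function.iterate_succ_apply', ih] at h1 ⊢
    rw [Function.iterate_succ_apply']
    refine h.next_eq _ hmem (fun h2 => ?_) (fun h2 => ?_)
    · rw [h.next_eq_fst _ hmem h2] at h1; exact ha h1
    · rw [h.next_eq_snd _ hmem h2] at h1; exact hb h1

/-- A pair once dealt with stays so when later edges are drawn. No portion through `R` arises anew:
a new half-edge ends outside `R`, so a portion starting with it has length one and its end nodes are
adjacent. -/
theorem AddsEdge.visited (h : AddsEdge G H a b) (hG : G.Consistent) (hH : H.Consistent)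
    (hval : ∀ d ∈ G.darts, H.face d ∈ H.valid ↔ G.face d ∈ G.valid) {R : Finset ℕ}
    (ha : a.1 ∉ R) (hb : b.1 ∉ R) {u w : ℕ} (huw : G.Visited R u w) : H.Visited R u w := by
  rcases huw with huw | huw | huw
  · exact .inl huw
  · exact .inr (.inl (h.mem huw))
  by_cases hne : u = w
  · exact .inl hne
  by_cases hadj : (u, w) ∈ H.darts
  · exact .inr (.inl hadj)
  refine .inr (.inr fun d hd hdv hdu n hn hw => ?_)
  cases n with
  | zero => exact hne (hdu.symm.trans hw)
  | succ n =>
    have hwn : (H.next^[n + 1] d).1 = (H.next^[n] d).2 := by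
      rw [Function.iterate_succ_apply', hH.next_fst (hH.iterate_next_mem hd n)]
    have hnew : ∀ {v}, d.2 = v → v ∉ R → False := by
      intro v hv hvR
      cases n with
      | zero => exact hadj (by rw [← hdu, ← hw, hwn]; exact hd)
      | succ n =>
        refine hvR ?_
        have := hn 1 one_pos (by omega)
        rwa [Function.iterate_one, hH.next_fst hd, hv] at this
    rcases (h.mem_iff d).1 hd with rfl | rfl | hd'
    · exact hnew rfl hb
    · exact hnew rfl ha
    -- Agreement is claimed only up to index `n`: at the end node the two walks may continue
    -- differently, but this node is the head of the half-edge with index `n`.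
    · have heq : ∀ j ≤ n, H.next^[j] d = G.next^[j] d := fun j hj =>
        h.iterate_next hG ha hb hd' j fun i h0 hi => hn i h0 (by omega)
      refine huw d hd' ((hval d hd').1 hdv) hdu (n + 1) (fun j h0 hj => ?_) ?_
      · rw [← heq j (by omega)]; exact hn j h0 hj
      · rw [← hw, hwn, heq n le_rfl, Function.iterate_succ_apply',
          hG.next_fst (hG.iterate_next_mem hd' n)]

/-! ### The complete graph on three nodes -/

theorem mem_K3 {d : ℕ × ℕ} : d ∈ K3.darts ↔ d = (0, 1) ∨ d = (1, 2) ∨ d = (2, 0) ∨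
    d = (1, 0) ∨ d = (2, 1) ∨ d = (0, 2) := by
  simp [K3]

theorem sum_K3 {M : Type*} [AddCommMonoid M] (F : ℕ × ℕ → M) : ∑ d ∈ K3.darts, F d =
    F (0, 1) + (F (1, 2) + (F (2, 0) + (F (1, 0) + (F (2, 1) + F (0, 2))))) := by
  simp [K3]

theorem consistent_K3 : K3.Consistent := by
  have hmaps : ∀ d ∈ K3.darts, K3.next d ∈ K3.darts := by decide
  have hinj : ∀ d ∈ K3.darts, ∀ e ∈ K3.darts, K3.next d = K3.next e → d = e := by decide
  have hrot : ∀ d ∈ K3.darts, ∀ e ∈ K3.darts, d.1 = e.1 → d = e ∨ K3.next d.swap = e := by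
    decide
  refine ⟨by decide, (Set.Finite.injOn_iff_bijOn_of_mapsTo (Finset.finite_toSet _) hmaps).1
    fun d hd e he => hinj d hd e he, by decide, fun d hd e he hde => ?_, by decide⟩
  rcases hrot d hd e he hde with h | h
  · exact ⟨0, h⟩
  · exact ⟨1, h⟩

theorem uniqueInvalid_K3 : K3.UniqueInvalid := by
  have h : ∀ d ∈ K3.darts, K3.face d ≠ 0 → K3.face d = 1 := by decide
  intro d hd e he hd' he'
  rw [h d hd hd', h e he he']

/-- The conditions at the nodes `0` and `1` give all three edges the same weight, so the cycle is
this multiple of the boundary of face `0`. -/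
theorem cyclesBound_K3 : K3.CyclesBound := by
  intro c hc
  have h0 := hc fun v => if v = 0 then 1 else 0
  have h1 := hc fun v => if v = 1 then 1 else 0
  rw [sum_K3] at h0 h1
  simp at h0 h1
  refine ⟨fun f => if f = 0 then c (0, 1) + c (1, 0) else 0, fun d hd => ?_⟩
  have e1 : c (1, 2) + c (2, 1) = c (0, 1) + c (1, 0) := by
    have : ∀ x y z w : ZMod 2, x + (y + (z + w)) = 0 → y + w = x + z := by decide
    exact this _ _ _ _ h1
  have e2 : c (2, 0) + c (0, 2) = c (0, 1) + c (1, 0) := by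
    have : ∀ x y z w : ZMod 2, x + (y + (z + w)) = 0 → y + w = x + z := by decide
    exact this _ _ _ _ h0
  rcases mem_K3.1 hd with rfl | rfl | rfl | rfl | rfl | rfl <;> simp [K3]
  · exact e1
  · exact e2
  · exact add_comm _ _
  · rw [add_comm]; exact e1
  · rw [add_comm]; exact e2

theorem isOddDart_K3 {φ : ℕ × ℕ → ZMod 2} (h : φ (0, 1) + φ (1, 2) + φ (2, 0) = 1) :
    K3.IsOddDart φ (0, 1) := by
  refine ⟨by simp [K3], by simp [K3], fun y hy hy0 => ?_, (1, 0), by simp [K3], by simp [K3],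
    .single (by simp [K3])⟩
  have e1 : y (1, 2) = y (0, 1) := hy (0, 1) (by simp [K3])
  have e2 : y (2, 0) = y (1, 2) := hy (1, 2) (by simp [K3])
  rw [sum_K3, hy0 (1, 0) (by simp [K3]) (by simp [K3]), hy0 (2, 1) (by simp [K3]) (by simp [K3]),
    hy0 (0, 2) (by simp [K3]) (by simp [K3]), e2, e1]
  linear_combination y (0, 1) * h

end PlaneGraph

/-! ### Crossings of segments with rays -/

/-- The determinant of two vectors in the plane. -/
def det2 (x y : Fin 2 → ℝ) : ℝ := x 0 * y 1 - x 1 * y 0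

theorem dot_eq (x y : Fin 2 → ℝ) : x ⬝ᵥ y = x 0 * y 0 + x 1 * y 1 := by
  simp [dotProduct, Fin.sum_univ_two]

/-- The end points lie strictly on opposite sides of the line through `r`, so the segment meets this
line in one point `t • r`; the sign of `t` is opposite to that of `det2 u w`. -/
theorem segment_inter_ray_of_pos {r u w : Fin 2 → ℝ} (hu : 0 < det2 r u) (hw : det2 r w < 0) :
    (segment ℝ u w ∩ ray r).Nonempty ↔ det2 u w ≤ 0 := by
  constructor
  · rintro ⟨z, ⟨α, β, hα, hβ, hαβ, rfl⟩, t, ht, hz⟩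
    have h0 := congrFun hz 0
    have h1 := congrFun hz 1
    simp only [Pi.add_apply, Pi.smul_apply, smul_eq_mul] at h0 h1
    have e1 : α * det2 r u + β * det2 r w = 0 := by
      unfold det2; linear_combination r 0 * h1 - r 1 * h0
    have e2 : α * det2 u w = t * det2 r w := by
      unfold det2; linear_combination w 1 * h0 - w 0 * h1
    have hα0 : 0 < α := by
      rcases hα.eq_or_lt with rfl | h
      · have : β = 1 := by linarith
        rw [this] at e1; linarith
      · exact h
    by_contra hpos
    push Not at hpos
    nlinarith [mul_pos hα0 hpos, mul_nonneg ht (neg_pos.2 hw).le]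
  · intro h
    have hd : 0 < det2 r u - det2 r w := by linarith
    -- The weights solve `α * det2 r u + β * det2 r w = 0` with `α + β = 1`.
    refine ⟨(-det2 u w / (det2 r u - det2 r w)) • r, ⟨-det2 r w / (det2 r u - det2 r w),
      det2 r u / (det2 r u - det2 r w), by apply div_nonneg <;> linarith,
      by apply div_nonneg <;> linarith, ?_, ?_⟩, _, by apply div_nonneg <;> linarith, rfl⟩
    · field_simp; ring
    · ext i
      simp only [Pi.add_apply, Pi.smul_apply, smul_eq_mul]
      field_simp
      fin_cases i <;> simp [det2] <;> ring

theorem not_segment_inter_ray {r u w : Fin 2 → ℝ} (h : 0 < det2 r u * det2 r w) :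
    ¬ (segment ℝ u w ∩ ray r).Nonempty := by
  rintro ⟨z, ⟨α, β, hα, hβ, hαβ, rfl⟩, t, ht, hz⟩
  have h0 := congrFun hz 0
  have h1 := congrFun hz 1
  simp only [Pi.add_apply, Pi.smul_apply, smul_eq_mul] at h0 h1
  have e1 : α * det2 r u + β * det2 r w = 0 := by
    unfold det2; linear_combination r 0 * h1 - r 1 * h0
  have hβ' : β = 1 - α := by linarith
  subst hβ'
  have hu : det2 r u ≠ 0 := fun h0 => by simp [h0] at h
  have hw : det2 r w ≠ 0 := fun h0 => by simp [h0] at h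
  have e3 : α * (det2 r u) ^ 2 + (1 - α) * (det2 r u * det2 r w) = 0 := by
    linear_combination det2 r u * e1
  rcases hα.eq_or_lt with rfl | hα
  · nlinarith
  · have := mul_pos hα (by positivity : 0 < (det2 r u) ^ 2)
    nlinarith [mul_nonneg hβ h.le]

open Classical in
/-- The indicator function of the edges that meet a ray. -/
noncomputable def crossing (c : ℕ → Fin 2 → ℝ) (r : Fin 2 → ℝ) (d : ℕ × ℕ) : ZMod 2 :=
  if (segment ℝ (c d.1) (c d.2) ∩ ray r).Nonempty then 1 else 0

theorem crossing_swap (c : ℕ → Fin 2 → ℝ) (r : Fin 2 → ℝ) (d : ℕ × ℕ) :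
    crossing c r d.swap = crossing c r d := by
  unfold crossing
  rw [Prod.fst_swap, Prod.snd_swap, segment_symm]

theorem crossing_of_pos_neg {c : ℕ → Fin 2 → ℝ} {r : Fin 2 → ℝ} {u w : ℕ}
    (hu : 0 < det2 r (c u)) (hw : det2 r (c w) < 0) :
    crossing c r (u, w) = if det2 (c u) (c w) ≤ 0 then 1 else 0 := by
  classical
  unfold crossing
  simp only [segment_inter_ray_of_pos hu hw]

theorem crossing_of_neg_pos {c : ℕ → Fin 2 → ℝ} {r : Fin 2 → ℝ} {u w : ℕ}
    (hu : det2 r (c u) < 0) (hw : 0 < det2 r (c w)) :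
    crossing c r (u, w) = if 0 ≤ det2 (c u) (c w) then 1 else 0 := by
  rw [← crossing_swap, Prod.swap_prod_mk, crossing_of_pos_neg hw hu]
  have : det2 (c w) (c u) = - det2 (c u) (c w) := by unfold det2; ring
  simp only [this, neg_nonpos]

theorem crossing_of_same {c : ℕ → Fin 2 → ℝ} {r : Fin 2 → ℝ} {u w : ℕ}
    (h : 0 < det2 r (c u) * det2 r (c w)) : crossing c r (u, w) = 0 :=
  if_neg (not_segment_inter_ray h)

open Classical in
/-- The side of the ray on which a point lies, if the ray meets the half-plane `{x | 1 ≤ a x}`. -/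
noncomputable def side (a r : Fin 2 → ℝ) (x : Fin 2 → ℝ) : ZMod 2 :=
  if 0 < a ⬝ᵥ r ∧ 0 < det2 r x then 1 else 0

theorem side_of_neg {a r x : Fin 2 → ℝ} (h : det2 r x < 0) : side a r x = 0 :=
  if_neg fun h' => lt_asymm h'.2 h

/-- In a half-plane that does not contain the origin, crossing numbers are a coboundary. -/
theorem crossing_eq_side {c : ℕ → Fin 2 → ℝ} {a r : Fin 2 → ℝ} {u w : ℕ}
    (hu : 1 ≤ a ⬝ᵥ c u) (hw : 1 ≤ a ⬝ᵥ c w) (hu0 : det2 r (c u) ≠ 0) (hw0 : det2 r (c w) ≠ 0) :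
    crossing c r (u, w) = side a r (c u) + side a r (c w) := by
  -- For end points on opposite sides of the ray's line, this identity ties the sign of `det2 (c u)
  -- (c w)`, which decides the crossing, to that of `a ⬝ᵥ r`.
  have key : det2 r (c u) * (a ⬝ᵥ c w) - det2 r (c w) * (a ⬝ᵥ c u) =
      - det2 (c u) (c w) * (a ⬝ᵥ r) := by
    simp only [dot_eq, det2]; ring
  rcases hu0.lt_or_gt with hu1 | hu1 <;> rcases hw0.lt_or_gt with hw1 | hw1
  · rw [crossing_of_same (mul_pos_of_neg_of_neg hu1 hw1), side_of_neg hu1, side_of_neg hw1,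
      add_zero]
  · have hneg : det2 (c u) (c w) * (a ⬝ᵥ r) > 0 := by nlinarith
    rw [crossing_of_neg_pos hu1 hw1, side_of_neg hu1, side, zero_add]
    by_cases hr : 0 < a ⬝ᵥ r
    · rw [if_pos ((pos_iff_pos_of_mul_pos hneg).2 hr).le, if_pos ⟨hr, hw1⟩]
    · have : det2 (c u) (c w) < 0 := by
        by_contra h0
        push Not at h0 hr
        nlinarith
      rw [if_neg (not_le.2 this), if_neg fun h => hr h.1]
  · have hneg : det2 (c u) (c w) * (a ⬝ᵥ r) < 0 := by nlinarith
    rw [crossing_of_pos_neg hu1 hw1, side_of_neg hw1, side, add_zero]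
    by_cases hr : 0 < a ⬝ᵥ r
    · have : det2 (c u) (c w) ≤ 0 := by
        by_contra h0
        push Not at h0
        nlinarith
      rw [if_pos this, if_pos ⟨hr, hu1⟩]
    · have : 0 < det2 (c u) (c w) := by
        by_contra h0
        push Not at h0 hr
        nlinarith
      rw [if_neg (not_le.2 this), if_neg fun h => hr h.1]
  · rw [crossing_of_same (mul_pos hu1 hw1), side, side]
    by_cases hr : 0 < a ⬝ᵥ r
    · rw [if_pos ⟨hr, hu1⟩, if_pos ⟨hr, hw1⟩]; decide
    · rw [if_neg (fun h => hr h.1), if_neg (fun h => hr h.1)]; decide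

/-- A ray from the interior of a triangle crosses its boundary exactly once. -/
theorem crossing_triangle {c : ℕ → Fin 2 → ℝ} {r : Fin 2 → ℝ} {x y z : ℝ} (hx : 0 < x)
    (hy : 0 < y) (hz : 0 < z) (h0 : x • c 0 + y • c 1 + z • c 2 = 0)
    (hdet : det2 (c 0) (c 1) ≠ 0) (hr : ∀ i, i < 3 → det2 r (c i) ≠ 0) :
    crossing c r (0, 1) + crossing c r (1, 2) + crossing c r (2, 0) = 1 := by
  have h1 := congrFun h0 0
  have h2 := congrFun h0 1
  simp only [Pi.add_apply, Pi.smul_apply, smul_eq_mul, Pi.zero_apply] at h1 h2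
  have e0 : x * det2 r (c 0) + y * det2 r (c 1) + z * det2 r (c 2) = 0 := by
    unfold det2; linear_combination r 0 * h2 - r 1 * h1
  have e1 : x * det2 (c 0) (c 1) = z * det2 (c 1) (c 2) := by
    unfold det2; linear_combination c 1 1 * h1 - c 1 0 * h2
  have e2 : y * det2 (c 0) (c 1) = z * det2 (c 2) (c 0) := by
    unfold det2; linear_combination c 0 0 * h2 - c 0 1 * h1
  -- By `e1` and `e2` the three determinants are proportional to the positive weights `z`, `x`, `y`,
  -- so they have a common sign, the orientation of the triangle.
  have hs : (0 < det2 (c 0) (c 1) ∧ 0 < det2 (c 1) (c 2) ∧ 0 < det2 (c 2) (c 0)) ∨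
      (det2 (c 0) (c 1) < 0 ∧ det2 (c 1) (c 2) < 0 ∧ det2 (c 2) (c 0) < 0) := by
    rcases hdet.lt_or_gt with h | h
    · have h3 := mul_neg_of_pos_of_neg hx h
      have h4 := mul_neg_of_pos_of_neg hy h
      rw [e1] at h3
      rw [e2] at h4
      exact .inr ⟨h, neg_of_mul_neg_right h3 hz.le, neg_of_mul_neg_right h4 hz.le⟩
    · have h3 := mul_pos hx h
      have h4 := mul_pos hy h
      rw [e1] at h3
      rw [e2] at h4
      exact .inl ⟨h, pos_of_mul_pos_right h3 hz.le, pos_of_mul_pos_right h4 hz.le⟩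
  -- Of the eight sign patterns, `e0` excludes the two constant ones. In the others two edges cross
  -- the line of `r`, and the orientation decides which one meets the ray.
  rcases (hr 0 (by norm_num)).lt_or_gt with d0 | d0 <;>
  rcases (hr 1 (by norm_num)).lt_or_gt with d1 | d1 <;>
  rcases (hr 2 (by norm_num)).lt_or_gt with d2 | d2
  · nlinarith [mul_neg_of_pos_of_neg hx d0, mul_neg_of_pos_of_neg hy d1,
      mul_neg_of_pos_of_neg hz d2]
  · rw [crossing_of_same (mul_pos_of_neg_of_neg d0 d1), crossing_of_neg_pos d1 d2,
      crossing_of_pos_neg d2 d0]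
    rcases hs with ⟨s0, s1, s2⟩ | ⟨s0, s1, s2⟩
    · rw [if_pos s1.le, if_neg (not_le.2 s2)]; decide
    · rw [if_neg (not_le.2 s1), if_pos s2.le]; decide
  · rw [crossing_of_neg_pos d0 d1, crossing_of_pos_neg d1 d2,
      crossing_of_same (mul_pos_of_neg_of_neg d2 d0)]
    rcases hs with ⟨s0, s1, s2⟩ | ⟨s0, s1, s2⟩
    · rw [if_pos s0.le, if_neg (not_le.2 s1)]; decide
    · rw [if_neg (not_le.2 s0), if_pos s1.le]; decide
  · rw [crossing_of_neg_pos d0 d1, crossing_of_same (mul_pos d1 d2), crossing_of_pos_neg d2 d0]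
    rcases hs with ⟨s0, s1, s2⟩ | ⟨s0, s1, s2⟩
    · rw [if_pos s0.le, if_neg (not_le.2 s2)]; decide
    · rw [if_neg (not_le.2 s0), if_pos s2.le]; decide
  · rw [crossing_of_pos_neg d0 d1, crossing_of_same (mul_pos_of_neg_of_neg d1 d2),
      crossing_of_neg_pos d2 d0]
    rcases hs with ⟨s0, s1, s2⟩ | ⟨s0, s1, s2⟩
    · rw [if_neg (not_le.2 s0), if_pos s2.le]; decide
    · rw [if_pos s0.le, if_neg (not_le.2 s2)]; decide
  · rw [crossing_of_pos_neg d0 d1, crossing_of_neg_pos d1 d2, crossing_of_same (mul_pos d2 d0)]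
    rcases hs with ⟨s0, s1, s2⟩ | ⟨s0, s1, s2⟩
    · rw [if_neg (not_le.2 s0), if_pos s1.le]; decide
    · rw [if_pos s0.le, if_neg (not_le.2 s1)]; decide
  · rw [crossing_of_same (mul_pos d0 d1), crossing_of_pos_neg d1 d2, crossing_of_neg_pos d2 d0]
    rcases hs with ⟨s0, s1, s2⟩ | ⟨s0, s1, s2⟩
    · rw [if_neg (not_le.2 s1), if_pos s2.le]; decide
    · rw [if_pos s1.le, if_neg (not_le.2 s2)]; decide
  · nlinarith [mul_pos hx d0, mul_pos hy d1, mul_pos hz d2]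

/-- The directions that are not parallel to any of finitely many nonzero vectors are dense. -/
theorem dense_generic (F : Finset (Fin 2 → ℝ)) (hF : ∀ p ∈ F, p ≠ 0) :
    Dense {r : Fin 2 → ℝ | ∀ p ∈ F, det2 r p ≠ 0} := by
  have hopen : ∀ p : Fin 2 → ℝ, IsOpen {r : Fin 2 → ℝ | det2 r p ≠ 0} := by
    intro p
    refine isOpen_ne_fun ?_ continuous_const
    unfold det2
    fun_prop
  have hdense : ∀ p : Fin 2 → ℝ, p ≠ 0 → Dense {r : Fin 2 → ℝ | det2 r p ≠ 0} := by
    intro p hp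
    rw [dense_iff_closure_eq, Set.eq_univ_iff_forall]
    intro r
    by_cases hr : det2 r p = 0
    -- The vector `p` turned by a right angle, so that `det2 q p` is its squared length; a small
    -- multiple of `q` moves `r` off the line of `p`.
    · set q : Fin 2 → ℝ := ![p 1, - p 0] with hq
      have hqp : 0 < det2 q p := by
        have h1 : det2 q p = p 0 ^ 2 + p 1 ^ 2 := by simp [det2, hq]; ring
        rw [h1]
        by_contra h0
        refine hp ?_
        have h2 : p 0 = 0 := by nlinarith [sq_nonneg (p 0), sq_nonneg (p 1)]
        have h3 : p 1 = 0 := by nlinarith [sq_nonneg (p 0), sq_nonneg (p 1)]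
        ext i
        fin_cases i
        exacts [h2, h3]
      have hlim : Filter.Tendsto (fun n : ℕ => r + (1 / ((n : ℝ) + 1)) • q) Filter.atTop
          (nhds r) := by
        have := (tendsto_one_div_add_atTop_nhds_zero_nat (𝕜 := ℝ)).smul_const q
        simpa using this.const_add r
      refine mem_closure_of_tendsto hlim (Filter.Eventually.of_forall fun n => ?_)
      have h1 : det2 (r + (1 / ((n : ℝ) + 1)) • q) p = (1 / ((n : ℝ) + 1)) * det2 q p := by
        rw [← zero_add (_ * _), ← hr]
        simp [det2]; ring
      change det2 _ p ≠ 0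
      rw [h1]
      positivity
    · exact subset_closure hr
  induction F using Finset.induction_on with
  | empty => simp
  | insert p F _ ih =>
    have h1 := ih fun q hq => hF q (Finset.mem_insert_of_mem hq)
    have h2 := (hdense p (hF p (Finset.mem_insert_self _ _))).inter_of_isOpen_left h1 (hopen p)
    refine h2.mono fun r hr q hq => ?_
    rcases Finset.mem_insert.1 hq with rfl | hq
    · exact hr.1
    · exact hr.2 q hq

end GraphAlg

namespace GraphAlg

/-! ### Triangles -/

theorem dot_mem_segment {a x u w : Fin 2 → ℝ} (hx : x ∈ segment ℝ u w) :
    ∃ α β : ℝ, 0 ≤ α ∧ 0 ≤ β ∧ α + β = 1 ∧ a ⬝ᵥ x = α * (a ⬝ᵥ u) + β * (a ⬝ᵥ w) := by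
  obtain ⟨α, β, hα, hβ, h, rfl⟩ := hx
  exact ⟨α, β, hα, hβ, h, by simp [dotProduct_add, dotProduct_smul]⟩

theorem le_dot_of_mem_segment {a x u w : Fin 2 → ℝ} {s : ℝ} (hx : x ∈ segment ℝ u w)
    (hu : s ≤ a ⬝ᵥ u) (hw : s ≤ a ⬝ᵥ w) : s ≤ a ⬝ᵥ x := by
  obtain ⟨α, β, hα, hβ, h, he⟩ := dot_mem_segment (a := a) hx
  have : s = α * s + β * s := by rw [← add_mul, h, one_mul]
  rw [he, this]
  gcongr

theorem dot_le_of_mem_segment {a x u w : Fin 2 → ℝ} {s : ℝ} (hx : x ∈ segment ℝ u w)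
    (hu : a ⬝ᵥ u ≤ s) (hw : a ⬝ᵥ w ≤ s) : a ⬝ᵥ x ≤ s := by
  obtain ⟨α, β, hα, hβ, h, he⟩ := dot_mem_segment (a := a) hx
  have : s = α * s + β * s := by rw [← add_mul, h, one_mul]
  rw [he, this]
  gcongr

theorem mem_convexHull_range {ι E : Type*} [Fintype ι] [AddCommGroup E] [Module ℝ E]
    {p : ι → E} {x : E} : x ∈ convexHull ℝ (Set.range p) ↔
      ∃ w : ι → ℝ, (∀ i, 0 ≤ w i) ∧ ∑ i, w i = 1 ∧ ∑ i, w i • p i = x := by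
  classical
  constructor
  · intro hx
    let C : Set E := {x | ∃ w : ι → ℝ, (∀ i, 0 ≤ w i) ∧ ∑ i, w i = 1 ∧ ∑ i, w i • p i = x}
    have hC : Convex ℝ C := by
      rintro x ⟨v, hv, hv1, rfl⟩ y ⟨w, hw, hw1, rfl⟩ a b ha hb hab
      refine ⟨fun i => a * v i + b * w i, fun i =>
        add_nonneg (mul_nonneg ha (hv i)) (mul_nonneg hb (hw i)), ?_, ?_⟩
      · rw [Finset.sum_add_distrib, ← Finset.mul_sum, ← Finset.mul_sum, hv1, hw1, mul_one,
          mul_one, hab]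
      · simp only [add_smul, mul_smul, Finset.sum_add_distrib, Finset.smul_sum]
    refine convexHull_min (t := C) ?_ hC hx
    rintro _ ⟨i, rfl⟩
    refine ⟨fun j => if j = i then 1 else 0, fun j => ?_, by simp, by simp⟩
    dsimp only
    split_ifs <;> norm_num
  · rintro ⟨w, hw, hw1, rfl⟩
    exact (convex_convexHull ℝ _).sum_mem (fun i _ => hw i) hw1
      fun i _ => subset_convexHull ℝ _ ⟨i, rfl⟩

/-- Barycentric coordinates are unique, so if a vertex lies in an open segment, nonnegativity forces
the coordinates of its end points to vanish at all other vertices. -/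
theorem extremePoints_convexHull_range {ι E : Type*} [Fintype ι] [AddCommGroup E] [Module ℝ E]
    {p : ι → E} (hp : AffineIndependent ℝ p) :
    (convexHull ℝ (Set.range p)).extremePoints ℝ = Set.range p := by
  classical
  refine extremePoints_convexHull_subset.antisymm ?_
  rintro _ ⟨i, rfl⟩
  refine mem_extremePoints_iff_left.2 ⟨subset_convexHull ℝ _ ⟨i, rfl⟩, ?_⟩
  rintro x hx y hy ⟨a, b, ha, hb, hab, hxy⟩
  obtain ⟨v, hv, hv1, rfl⟩ := mem_convexHull_range.1 hx
  obtain ⟨w, hw, hw1, rfl⟩ := mem_convexHull_range.1 hy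
  have h := hp.eq_of_sum_eq_sum (s := Finset.univ) (w₁ := fun j => a * v j + b * w j)
    (w₂ := fun j => if j = i then 1 else 0)
    (by simp [Finset.sum_add_distrib, ← Finset.mul_sum, hv1, hw1, hab])
    (by
      simp only [add_smul, mul_smul, Finset.sum_add_distrib, ← Finset.smul_sum]
      rw [hxy]; simp)
  have hv0 : ∀ j, j ≠ i → v j = 0 := by
    intro j hj
    have hj' := h j (Finset.mem_univ j)
    simp only [if_neg hj] at hj'
    have h1 := mul_nonneg ha.le (hv j)
    have h2 := mul_nonneg hb.le (hw j)
    have h3 : a * v j = 0 := by linarith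
    exact (mul_eq_zero.1 h3).resolve_left ha.ne'
  have hvi : v i = 1 := by
    rw [← hv1, Finset.sum_eq_single i (fun j _ hj => hv0 j hj) (by simp)]
  rw [Finset.sum_eq_single i (fun j _ hj => by rw [hv0 j hj, zero_smul]) (by simp), hvi, one_smul]

section Triangle

variable {n : ℕ} {T : Matrix (Fin n) (Fin 2) ℝ} {s : ℝ}

theorem isTriangle_hpoly (h : IsTriangle (hpoly T 1)) (hs : 0 < s) :
    IsTriangle (hpoly T s) := by
  obtain ⟨p, hp, hT⟩ := h
  refine ⟨fun i => s • p i, ?_, Set.ext fun x => ?_⟩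
  · rw [affineIndependent_iff] at hp ⊢
    intro t w hw hw' i hi
    refine hp t w hw ?_ i hi
    simp only [smul_comm _ s, ← Finset.smul_sum] at hw'
    exact (smul_eq_zero.1 hw').resolve_left hs.ne'
  · have h1 : x ∈ hpoly T s ↔ s⁻¹ • x ∈ hpoly T 1 := by
      refine forall_congr' fun i => ?_
      rw [dotProduct_smul, smul_eq_mul, inv_mul_le_iff₀ hs, mul_one]
    rw [h1, hT, mem_convexHull_range, mem_convexHull_range]
    refine exists_congr fun w => and_congr_right fun _ => and_congr_right fun _ => ?_
    simp only [smul_comm _ s, ← Finset.smul_sum]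
    rw [eq_inv_smul_iff₀ hs.ne']

theorem exists_index_three : ∀ i j : Fin 3, i ≠ j →
    ∃ k, k ≠ i ∧ k ≠ j ∧ (Finset.univ : Finset (Fin 3)) = {i, j, k} := by
  decide

theorem exists_sum_three (i j : Fin 3) (hij : i ≠ j) : ∃ k, k ≠ i ∧ k ≠ j ∧
    (∀ F : Fin 3 → ℝ, ∑ l, F l = F i + F j + F k) ∧
    ∀ F : Fin 3 → Fin 2 → ℝ, ∑ l, F l = F i + F j + F k := by
  obtain ⟨k, hki, hkj, hu⟩ := exists_index_three i j hij
  refine ⟨k, hki, hkj, fun F => ?_, fun F => ?_⟩ <;>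
  rw [hu, Finset.sum_insert (by simp [hij, hki.symm]), Finset.sum_insert (by simp [hkj.symm]),
    Finset.sum_singleton, add_assoc]

variable {p : Fin 3 → Fin 2 → ℝ}

/-- Any two vertices of a triangle lie on a common edge line. -/
theorem exists_tight (hp : AffineIndependent ℝ p) (hT : hpoly T s = convexHull ℝ (Set.range p))
    {i j : Fin 3} (hij : i ≠ j) : ∃ κ, T κ ⬝ᵥ p i = s ∧ T κ ⬝ᵥ p j = s := by
  by_contra hcon
  push Not at hcon
  obtain ⟨k, hki, hkj, hsum, hsum'⟩ := exists_sum_three i j hij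
  have hmem : ∀ l κ, T κ ⬝ᵥ p l ≤ s := fun l κ => by
    have : p l ∈ hpoly T s := hT ▸ subset_convexHull ℝ _ ⟨l, rfl⟩
    exact this κ
  -- No row is tight at both vertices, so their midpoint satisfies every row strictly.
  have hlt : ∀ κ, T κ ⬝ᵥ p i + T κ ⬝ᵥ p j < 2 * s := by
    intro κ
    have h1 := hmem i κ
    have h2 := hmem j κ
    by_contra h
    push Not at h
    exact hcon κ (by linarith) (by linarith)
  -- Moving the midpoint slightly away from `p k` therefore stays in the polyhedron, although the
  -- coordinate `-δ` at `p k` is negative.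
  have hev : ∀ᶠ δ : ℝ in nhdsWithin 0 (Set.Ioi 0), ∀ κ,
      (1 + δ) / 2 * (T κ ⬝ᵥ p i + T κ ⬝ᵥ p j) + (-δ) * (T κ ⬝ᵥ p k) < s := by
    rw [Filter.eventually_all]
    intro κ
    refine Filter.Eventually.filter_mono nhdsWithin_le_nhds ?_
    have hcont : Continuous fun δ : ℝ =>
        (1 + δ) / 2 * (T κ ⬝ᵥ p i + T κ ⬝ᵥ p j) + (-δ) * (T κ ⬝ᵥ p k) := by fun_prop
    refine hcont.continuousAt.eventually_lt continuousAt_const ?_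
    have := hlt κ
    simp only [add_zero, neg_zero, zero_mul]
    linarith
  obtain ⟨δ, hδ, hδ0⟩ := (hev.and self_mem_nhdsWithin).exists
  have hδ0 : 0 < δ := hδ0
  set v : Fin 3 → ℝ := fun l => if l = k then -δ else (1 + δ) / 2 with hv
  have hvi : v i = (1 + δ) / 2 := if_neg hki.symm
  have hvj : v j = (1 + δ) / 2 := if_neg hkj.symm
  have hvk : v k = -δ := if_pos rfl
  have hq : ∑ l, v l • p l ∈ hpoly T s := by
    intro κ
    rw [hsum', dotProduct_add, dotProduct_add, dotProduct_smul, dotProduct_smul,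
      dotProduct_smul, hvi, hvj, hvk]
    have := hδ κ
    simp only [smul_eq_mul]
    linarith
  rw [hT] at hq
  obtain ⟨w, hw, hw1, hwq⟩ := mem_convexHull_range.1 hq
  have h := hp.eq_of_sum_eq_sum (s := Finset.univ) (w₁ := w) (w₂ := v)
    (by rw [hw1, hsum, hvi, hvj, hvk]; ring) hwq k (Finset.mem_univ k)
  have := hw k
  rw [h, hvk] at this
  linarith

/-- If one weight vanished, the origin would lie on an edge line `T κ x = s`, contrary to `s > 0`.
-/
theorem exists_pos_combination (hp : AffineIndependent ℝ p)
    (hT : hpoly T s = convexHull ℝ (Set.range p)) (hs : 0 < s) :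
    ∃ w : Fin 3 → ℝ, (∀ i, 0 < w i) ∧ ∑ i, w i • p i = 0 := by
  have h0 : (0 : Fin 2 → ℝ) ∈ hpoly T s := fun κ => by rw [dotProduct_zero]; exact hs.le
  rw [hT] at h0
  obtain ⟨w, hw, hw1, hw0⟩ := mem_convexHull_range.1 h0
  refine ⟨w, fun k => (hw k).lt_of_ne' fun hk => ?_, hw0⟩
  have hij : ∀ k : Fin 3, ∃ i j : Fin 3, i ≠ j ∧ k ≠ i ∧ k ≠ j := by decide
  obtain ⟨i, j, hij, hki, hkj⟩ := hij k
  obtain ⟨k', hki', hkj', hsum, hsum'⟩ := exists_sum_three i j hij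
  have hkk : ∀ i j k k' : Fin 3, i ≠ j → k ≠ i → k ≠ j → k' ≠ i → k' ≠ j → k' = k := by decide
  obtain rfl := hkk i j k k' hij hki hkj hki' hkj'
  obtain ⟨κ, h1, h2⟩ := exists_tight hp hT hij
  rw [hsum, hk, add_zero] at hw1
  rw [hsum', hk, zero_smul, add_zero] at hw0
  have := congrArg (T κ ⬝ᵥ ·) hw0
  simp only [dotProduct_add, dotProduct_smul, h1, h2, smul_eq_mul, dotProduct_zero] at this
  rw [← add_mul, hw1, one_mul] at this
  exact hs.ne' this

/-- A line that avoids the origin contains at most one multiple of a given vector. -/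
theorem det2_ne_zero_of_tight {a u w : Fin 2 → ℝ} (hs : 0 < s) (hu : a ⬝ᵥ u = s)
    (hw : a ⬝ᵥ w = s) (huw : u ≠ w) : det2 u w ≠ 0 := by
  intro h
  rw [dot_eq] at hu hw
  unfold det2 at h
  refine huw (funext fun i => mul_left_cancel₀ hs.ne' ?_)
  fin_cases i
  · change s * u 0 = s * w 0
    linear_combination (-u 0) * hw + w 0 * hu + a 1 * h
  · change s * u 1 = s * w 1
    linear_combination (-u 1) * hw + w 1 * hu - a 0 * h

end Triangle

end GraphAlg

namespace GraphAlg

open PlaneGraph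

/-! ### The invariants of the states -/

/-- The invariants that hold throughout the algorithm. -/
structure Sound {m : ℕ} (A : Matrix (Fin m) (Fin 2) ℝ) (S : State) : Prop where
  consistent : S.graph.Consistent
  cyclesBound : S.graph.CyclesBound
  uniqueInvalid : S.graph.UniqueInvalid
  edge : ∀ d ∈ S.graph.darts, ∃ κ, 1 ≤ A κ ⬝ᵥ S.coord d.1 ∧ 1 ≤ A κ ⬝ᵥ S.coord d.2
  generic : ∃ F : Finset (Fin 2 → ℝ), (∀ p ∈ F, p ≠ 0) ∧
    (∀ v ∈ S.graph.verts, S.coord v ∈ F) ∧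
    ∀ r, (∀ p ∈ F, det2 r p ≠ 0) → ∃ d, S.graph.IsOddDart (crossing S.coord r) d

variable {m : ℕ} {A : Matrix (Fin m) (Fin 2) ℝ} {S : State}

/-- The new point lies in the half-plane of the edge. Crossings are a coboundary there, and the two
occurrences of the side of the new point cancel. The new point joins the finite set of excluded
directions. -/
theorem Sound.subdivide (hS : Sound A S) {u w v : ℕ} {x : Fin 2 → ℝ}
    (huw : (u, w) ∈ S.graph.darts) (hv : v ∉ S.graph.verts)
    (hx : x ∈ segment ℝ (S.coord u) (S.coord w)) :
    Sound A ⟨S.graph.subdivide u w v, Function.update S.coord v x⟩ := by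
  classical
  have hG := hS.consistent
  have hne : u ≠ w := hG.fst_ne_snd huw
  have hcoord : ∀ z, z ≠ v → Function.update S.coord v x z = S.coord z := fun z hz =>
    Function.update_of_ne hz _ _
  have hvc : Function.update S.coord v x v = x := Function.update_self _ _ _
  have huv := (hG.ne_of_notMem hv huw).1
  have hwv := (hG.ne_of_notMem hv huw).2
  obtain ⟨κ, hκu, hκw⟩ := hS.edge _ huw
  have hκx : 1 ≤ A κ ⬝ᵥ x := le_dot_of_mem_segment hx hκu hκw
  refine ⟨hG.subdivide huw hv, hS.cyclesBound.subdivide hG huw hv,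
    hS.uniqueInvalid.subdivide hG huw hv, fun d hd => ?_, ?_⟩
  · rcases (hG.mem_subdivide huw).1 hd with ⟨e, he, rfl⟩ | rfl | rfl
    · by_cases h1 : e = (u, w)
      · subst h1
        rw [subdart_uw]
        exact ⟨κ, by simp only [hcoord u huv]; exact hκu, by simp only [hvc]; exact hκx⟩
      by_cases h2 : e = (w, u)
      · subst h2
        rw [subdart_wu hne]
        exact ⟨κ, by simp only [hcoord w hwv]; exact hκw, by simp only [hvc]; exact hκx⟩
      · rw [subdart_of_ne h1 h2]
        have := hG.ne_of_notMem hv he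
        simp only [hcoord _ this.1, hcoord _ this.2]
        exact hS.edge e he
    · exact ⟨κ, by simp only [hvc]; exact hκx, by simp only [hcoord w hwv]; exact hκw⟩
    · exact ⟨κ, by simp only [hvc]; exact hκx, by simp only [hcoord u huv]; exact hκu⟩
  · obtain ⟨F, hF0, hFv, hF⟩ := hS.generic
    refine ⟨insert x F, fun p hp => ?_, fun z hz => ?_, fun r hr => ?_⟩
    · rcases Finset.mem_insert.1 hp with rfl | hp
      · rintro rfl
        rw [dotProduct_zero] at hκx
        linarith
      · exact hF0 p hp
    · rcases Finset.mem_insert.1 hz with rfl | hz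
      · simp only [hvc]; exact Finset.mem_insert_self _ _
      · have : z ≠ v := fun h => hv (h ▸ hz)
        simp only [hcoord z this]
        exact Finset.mem_insert_of_mem (hFv z hz)
    · obtain ⟨d, hd⟩ := hF r fun p hp => hr p (Finset.mem_insert_of_mem hp)
      have hd' := hd.congr (ψ := crossing (Function.update S.coord v x) r) fun e he => by
        have := hG.ne_of_notMem hv he
        unfold crossing
        rw [hcoord _ this.1, hcoord _ this.2]
      have hcu : Function.update S.coord v x u = S.coord u := hcoord u huv
      have hcw : Function.update S.coord v x w = S.coord w := hcoord w hwv
      have hru := hr _ (Finset.mem_insert_of_mem (hFv u (hG.fst_mem huw)))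
      have hrw := hr _ (Finset.mem_insert_of_mem (hFv w (hG.snd_mem huw)))
      have hrx := hr _ (Finset.mem_insert_self x F)
      have hself : ∀ z : ZMod 2, z + z = 0 := fun z => CharTwo.add_self_eq_zero z
      refine ⟨_, hd'.subdivide hG huw hv ?_ ?_⟩
      · rw [crossing_eq_side (a := A κ), crossing_eq_side (a := A κ), crossing_eq_side (a := A κ)]
        · linear_combination (-1 : ZMod 2) * hself (side (A κ) r (Function.update S.coord v x v))
        all_goals simpa only [hcu, hcw, hvc]
      · rw [crossing_eq_side (a := A κ), crossing_eq_side (a := A κ), crossing_eq_side (a := A κ)]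
        · linear_combination (-1 : ZMod 2) * hself (side (A κ) r (Function.update S.coord v x v))
        all_goals simpa only [hcu, hcw, hvc]

theorem WalkOK.exists_walk {G : PlaneGraph} {T : Tri} {a b : ℕ × ℕ} (h : WalkOK G T a b)
    (hT : Disjoint T.neg T.pos) : ∃ n, G.next^[n] a = b ∧
      ∀ j, 0 < j → j < n → (G.next^[j] a).1 ∉ T.neg := by
  obtain ⟨n, hn, h | h⟩ := h
  · exact ⟨n, hn, fun j h0 hj hneg => Finset.disjoint_left.1 hT hneg (h j h0 hj)⟩
  · exact ⟨n, hn, h⟩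

/-- All nodes outside `V₋` lie in the half-plane of row `κ`. They form the region `N` of
`AddsEdge.exists_isOddDart`, and both kinds of admissible walks stay in it. -/
theorem Sound.addEdge (hS : Sound A S) {T : Tri} {κ : Fin m} {a b : ℕ × ℕ} {l : ℕ}
    {X : Finset (ℕ × ℕ)} (hT : Disjoint T.neg T.pos)
    (hκ : ∀ v ∈ S.graph.verts, v ∉ T.neg → 1 ≤ A κ ⬝ᵥ S.coord v)
    (hab : Eligible S.graph T a.1 b.1 a b) (han : a.1 ∉ T.neg) (hbn : b.1 ∉ T.neg)
    (hX : S.graph.IsSplitting a b l X) : Sound A ⟨S.graph.addEdge a b l X, S.coord⟩ := by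
  obtain ⟨hne, hadj, ha, hb, -, -, hf, hval, hwalk⟩ := hab
  have hG := hS.consistent
  have hH := hX.consistent hG ha hb hne hadj hf
  have hadd := addsEdge_addEdge hG ha hb hne hadj l X
  have hva := hG.fst_mem ha
  have hvb := hG.fst_mem hb
  refine ⟨hH, hX.cyclesBound hS.cyclesBound hG ha hb hne hadj hf,
    hX.uniqueInvalid hS.uniqueInvalid hG ha hb hne hadj hval, fun d hd => ?_, ?_⟩
  · rcases (hadd.mem_iff d).1 hd with rfl | rfl | hd
    · exact ⟨κ, hκ _ hva han, hκ _ hvb hbn⟩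
    · exact ⟨κ, hκ _ hvb hbn, hκ _ hva han⟩
    · exact hS.edge d hd
  · obtain ⟨F, hF0, hFv, hF⟩ := hS.generic
    refine ⟨F, hF0, hFv, fun r hr => ?_⟩
    obtain ⟨d₀, h₀⟩ := hF r hr
    set N : Set ℕ := {v | v ∈ S.graph.verts ∧ v ∉ T.neg} with hN
    have hcob : ∀ d : ℕ × ℕ, d.1 ∈ N → d.2 ∈ N → crossing S.coord r d =
        side (A κ) r (S.coord d.1) + side (A κ) r (S.coord d.2) := fun d h1 h2 =>
      crossing_eq_side (hκ _ h1.1 h1.2) (hκ _ h2.1 h2.2) (hr _ (hFv _ h1.1)) (hr _ (hFv _ h2.1))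
    have hval' : ∀ d ∈ S.graph.darts, (S.graph.addEdge a b l X).face d ∈
        (S.graph.addEdge a b l X).valid ↔ S.graph.face d ∈ S.graph.valid := fun d hd =>
      hX.valid_iff hG hadj hval hd
    have hv1 : (S.graph.addEdge a b l X).face (a.1, b.1) ∈ (S.graph.addEdge a b l X).valid := by
      rw [hX.face_fst]; exact Set.mem_insert_of_mem _ hval
    have hv2 : (S.graph.addEdge a b l X).face (b.1, a.1) ∈ (S.graph.addEdge a b l X).valid := by
      rw [hX.face_snd]; exact Set.mem_insert _ _
    rcases hwalk with hw | hw
    · obtain ⟨n, hn, hj⟩ := hw.exists_walk hT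
      exact hadd.exists_isOddDart hG hH (crossing_swap _ _ (a.1, b.1)) h₀ hval' hv1 hval
        (N := N) (p := fun v => side (A κ) r (S.coord v)) (fun d _ h1 h2 => hcob d h1 h2)
        ⟨hva, han⟩ ⟨hvb, hbn⟩ hn
        fun j h0 hjn => ⟨hG.fst_mem (hG.iterate_next_mem ha j), hj j h0 hjn⟩
    · obtain ⟨n, hn, hj⟩ := hw.exists_walk hT
      exact (hadd.symm hG).exists_isOddDart hG hH (crossing_swap _ _ (b.1, a.1)) h₀ hval' hv2
        (hf ▸ hval) (N := N) (p := fun v => side (A κ) r (S.coord v))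
        (fun d _ h1 h2 => hcob d h1 h2) ⟨hvb, hbn⟩ ⟨hva, han⟩ hn
        fun j h0 hjn => ⟨hG.fst_mem (hG.iterate_next_mem hb j), hj j h0 hjn⟩

/-- A portion of a walk through `V₊` starts with a border edge and ends with a reversed one. This
pair has been visited, so the end nodes are equal or adjacent, as `Removable` requires. -/
theorem Sound.remove (hS : Sound A S) {T : Tri} {κ : Fin m} (hT : Disjoint T.neg T.pos)
    (hverts : T.neg ∪ T.zero ∪ T.pos = S.graph.verts)
    (hκ : ∀ v ∈ S.graph.verts, v ∉ T.neg → 1 ≤ A κ ⬝ᵥ S.coord v)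
    (hend : ∀ d ∈ S.graph.darts, ¬ (d.1 ∈ T.neg ∧ d.2 ∈ T.pos))
    (hvis : ∀ d ∈ borderEdges S.graph T, ∀ e ∈ borderEdges S.graph T,
      S.graph.Visited T.pos d.1 e.1) : Sound A ⟨S.graph.remove T.pos, S.coord⟩ := by
  have hG := hS.consistent
  have hborder : ∀ d ∈ S.graph.darts, d.1 ∉ T.pos → d.2 ∈ T.pos →
      d ∈ borderEdges S.graph T := by
    intro d hd h1 h2
    have hv := hG.fst_mem hd
    rw [← hverts, Finset.mem_union, Finset.mem_union] at hv
    refine Finset.mem_filter.2 ⟨hd, ?_, h2⟩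
    exact (hv.resolve_right h1).resolve_left fun h => hend d hd ⟨h, h2⟩
  refine ⟨hG.remove _, hS.cyclesBound.remove _, hS.uniqueInvalid.remove hG _,
    fun d hd => hS.edge d (mem_remove.1 hd).1, ?_⟩
  obtain ⟨F, hF0, hFv, hF⟩ := hS.generic
  refine ⟨F, hF0, fun v hv => hFv v (Finset.mem_sdiff.1 hv).1, fun r hr => ?_⟩
  obtain ⟨d₀, h₀⟩ := hF r hr
  refine h₀.exists_remove hG hS.cyclesBound hS.uniqueInvalid (fun d _ => crossing_swap _ _ d)
    (N := {v | v ∈ S.graph.verts ∧ v ∉ T.neg}) (p := fun v => side (A κ) r (S.coord v))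
    ⟨fun v hv => ⟨?_, fun h => Finset.disjoint_left.1 hT h hv⟩,
      fun d hd hdR => ⟨hG.fst_mem hd, fun h => hend d hd ⟨h, hdR⟩⟩,
      fun d _ h1 h2 => crossing_eq_side (hκ _ h1.1 h1.2) (hκ _ h2.1 h2.2)
        (hr _ (hFv _ h1.1)) (hr _ (hFv _ h2.1)), ?_⟩
  · rw [← hverts]; exact Finset.mem_union_right _ hv
  · intro d hd hval h1 h2 n hn hj hnR
    have hn1 : n ≠ 1 := by
      rintro rfl
      refine hnR ?_
      rw [Function.iterate_one, hG.next_fst hd]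
      exact h2
    have hmem := hG.iterate_next_mem hd (n - 1)
    have he : (S.graph.next^[n] d).1 = (S.graph.next^[n - 1] d).2 := by
      rw [← hG.next_fst hmem, ← Function.iterate_succ_apply' S.graph.next, Nat.succ_eq_add_one,
        Nat.sub_add_cancel hn]
    have hx := hvis d (hborder d hd h1 h2) _ (hborder _ (hG.swap_mem hmem)
      (by rw [Prod.fst_swap, ← he]; exact hnR) (hj _ (by omega) (by omega)))
    rw [Prod.fst_swap, ← he] at hx
    rcases hx with hx | hx | hx
    · exact .inl hx
    · exact .inr hx
    -- The third alternative of `Visited` denies the very portion under consideration.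
    · exact absurd rfl (hx d hd hval rfl n hj)

/-! ### Consequences of the invariants: odd parity and the inclusions -/

theorem totalCrossings_eq (S : State) (r : Fin 2 → ℝ) [DecidablePred (· ∈ S.graph.valid)] :
    (totalCrossings S r : ZMod 2) = ∑ d ∈ S.graph.darts,
      (if S.graph.face d ∈ S.graph.valid then 1 else 0) * crossing S.coord r d := by
  classical
  have h1 : totalCrossings S r = (S.graph.darts.filter fun d =>
      S.graph.face d ∈ S.graph.valid ∧ (S.seg d ∩ ray r).Nonempty).card := by
    rw [Finset.card_eq_sum_card_fiberwise (f := S.graph.face)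
      (t := (S.graph.darts.image S.graph.face).filter (· ∈ S.graph.valid))]
    · unfold totalCrossings crossings
      refine Finset.sum_congr (by congr) fun f hf => ?_
      have hfv := (Finset.mem_filter.1 hf).2
      rw [Finset.filter_filter]
      congr 1
      ext d
      simp only [Finset.mem_filter]
      constructor
      · rintro ⟨hd, rfl, h⟩; exact ⟨hd, ⟨hfv, h⟩, rfl⟩
      · rintro ⟨hd, ⟨-, h⟩, rfl⟩; exact ⟨hd, rfl, h⟩
    · intro d hd
      have hd := Finset.mem_filter.1 hd
      exact Finset.mem_filter.2 ⟨Finset.mem_image_of_mem _ hd.1, hd.2.1⟩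
  rw [h1, Finset.card_filter, Nat.cast_sum]
  refine Finset.sum_congr rfl fun d _ => ?_
  unfold crossing State.seg
  by_cases h2 : S.graph.face d ∈ S.graph.valid <;>
  by_cases h3 : (segment ℝ (S.coord d.1) (S.coord d.2) ∩ ray r).Nonempty <;> simp [h2, h3]

theorem Sound.regular (hS : Sound A S) : Regular A S := by
  classical
  refine ⟨fun d hd => ?_, ?_⟩
  · obtain ⟨κ, h1, h2⟩ := hS.edge d hd
    exact ⟨κ, fun x hx => le_dot_of_mem_segment hx h1 h2⟩
  · obtain ⟨F, hF0, hFv, hF⟩ := hS.generic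
    refine (dense_generic F hF0).mono fun r hr => ?_
    obtain ⟨d₀, h₀⟩ := hF r hr
    refine ⟨?_, fun v hv t ht => ?_, ?_⟩
    · rintro rfl
      refine hr _ (hFv _ (hS.consistent.fst_mem h₀.mem)) ?_
      simp [det2]
    · refine hr _ (hFv v hv) ?_
      rw [ht]
      simp only [det2, Pi.smul_apply, smul_eq_mul]
      ring
    · rw [← ZMod.natCast_eq_one_iff_odd, totalCrossings_eq,
        h₀.sum_eq (fun d => if S.graph.face d ∈ S.graph.valid then 1 else 0)
        (fun d hd => by simp only [hS.consistent.face_next hd]) (fun d _ hd => if_neg hd)]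
      exact if_pos h₀.valid

theorem continuous_dot (a : Fin 2 → ℝ) : Continuous fun r : Fin 2 → ℝ => a ⬝ᵥ r := by
  simp only [dot_eq]
  fun_prop

/-- Some edge meets a ray whose direction lies in a given open set. -/
theorem Sound.exists_crossing (hS : Sound A S) {U : Set (Fin 2 → ℝ)} (hU : IsOpen U)
    (hne : U.Nonempty) : ∃ r ∈ U, ∃ d ∈ S.graph.darts, ∃ t : ℝ, 0 ≤ t ∧
      t • r ∈ segment ℝ (S.coord d.1) (S.coord d.2) := by
  classical
  obtain ⟨F, hF0, -, hF⟩ := hS.generic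
  obtain ⟨r, hrU, hr⟩ := (dense_generic F hF0).inter_open_nonempty U hU hne
  obtain ⟨d₀, h₀⟩ := hF r hr
  have h := h₀.sum_eq (fun d => if S.graph.face d ∈ S.graph.valid then 1 else 0)
    (fun d hd => by simp only [hS.consistent.face_next hd]) (fun d _ hd => if_neg hd)
  rw [if_pos h₀.valid] at h
  obtain ⟨d, hd, hd0⟩ := Finset.exists_ne_zero_of_sum_ne_zero (h.trans_ne one_ne_zero)
  have hcr := right_ne_zero_of_mul hd0
  unfold crossing at hcr
  obtain ⟨_, hz, t, ht, rfl⟩ : (segment ℝ (S.coord d.1) (S.coord d.2) ∩ ray r).Nonempty := by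
    by_contra hn
    exact hcr (if_neg hn)
  exact ⟨r, hrU, d, hd, t, ht, hz⟩

/-- If all nodes satisfied `a x ≥ 1`, so would all edges, and no ray with `a ⬝ᵥ r ≤ 0` could meet
one. This is what makes a nonempty `V₋` available. -/
theorem Sound.exists_lt (hS : Sound A S) (a : Fin 2 → ℝ) :
    ∃ v ∈ S.graph.verts, a ⬝ᵥ S.coord v < 1 := by
  by_contra hcon
  push Not at hcon
  have hU : ∃ U : Set (Fin 2 → ℝ), IsOpen U ∧ U.Nonempty ∧ ∀ r ∈ U, a ⬝ᵥ r ≤ 0 := by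
    by_cases ha : a = 0
    · exact ⟨Set.univ, isOpen_univ, Set.univ_nonempty, fun r _ => by simp [ha]⟩
    · refine ⟨{r | a ⬝ᵥ r < 0}, isOpen_lt (continuous_dot a) continuous_const,
        ⟨-a, ?_⟩, fun r hr => le_of_lt hr⟩
      have : 0 < a ⬝ᵥ a := by
        by_contra h
        rw [dot_eq] at h
        refine ha (funext fun i => ?_)
        have h1 := mul_self_nonneg (a 0)
        have h2 := mul_self_nonneg (a 1)
        have h3 : a 0 = 0 := mul_self_eq_zero.1 (by linarith)
        have h4 : a 1 = 0 := mul_self_eq_zero.1 (by linarith)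
        fin_cases i
        exacts [h3, h4]
      change a ⬝ᵥ (-a) < 0
      rw [dotProduct_neg]
      linarith
  obtain ⟨U, hU, hne, hUr⟩ := hU
  obtain ⟨r, hr, d, hd, t, ht, hz⟩ := hS.exists_crossing hU hne
  have h1 := le_dot_of_mem_segment hz (hcon _ (hS.consistent.fst_mem hd))
    (hcon _ (hS.consistent.snd_mem hd))
  rw [dotProduct_smul, smul_eq_mul] at h1
  linarith [mul_nonpos_of_nonneg_of_nonpos ht (hUr r hr)]

/-- Separate `x` from the hull by `f < s < f x`. A ray close to `x` meets some edge in `z` with `A κ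
z ≥ 1`, whence `s ≤ s * (A κ z) ≤ f z`, although `z` is in the hull. -/
theorem Sound.hpoly_subset_convexHull (hS : Sound A S) : hpoly A 1 ⊆ convexHull ℝ S.points := by
  intro x hx
  by_contra hcon
  have hfin : S.points.Finite := (Finset.finite_toSet _).image _
  obtain ⟨f, s, hfs, hsx⟩ := geometric_hahn_banach_closed_point (convex_convexHull ℝ S.points)
    (hfin.isClosed_convexHull ℝ) hcon
  have hf : ∀ v ∈ S.graph.verts, f (S.coord v) < s := fun v hv =>
    hfs _ (subset_convexHull ℝ _ ⟨v, hv, rfl⟩)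
  have hseg : ∀ d ∈ S.graph.darts, ∀ z ∈ segment ℝ (S.coord d.1) (S.coord d.2), f z < s := by
    intro d hd z hz
    refine hfs z ((convex_convexHull ℝ S.points).segment_subset ?_ ?_ hz)
    · exact subset_convexHull ℝ _ ⟨_, hS.consistent.fst_mem hd, rfl⟩
    · exact subset_convexHull ℝ _ ⟨_, hS.consistent.snd_mem hd, rfl⟩
  -- Otherwise `f` is negative at the nodes, so directions with `f r > 0` exist; a ray in such a
  -- direction meets an edge where `f ≥ 0 ≥ s`.
  have hs : 0 < s := by
    by_contra hs
    push Not at hs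
    obtain ⟨v, hv, -⟩ := hS.exists_lt 0
    obtain ⟨r, hr, d, hd, t, ht, hz⟩ := hS.exists_crossing
      (U := {r | 0 < f r}) (isOpen_lt continuous_const f.continuous)
      ⟨-S.coord v, by
        change 0 < f (-S.coord v)
        rw [map_neg]
        linarith [hf v hv]⟩
    have h1 := hseg d hd _ hz
    rw [map_smul, smul_eq_mul] at h1
    linarith [mul_nonneg ht (le_of_lt hr)]
  -- This open set contains `x`, because `s * (A κ x) ≤ s < f x` for every row.
  obtain ⟨r, hr, d, hd, t, ht, hz⟩ := hS.exists_crossing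
    (U := {r | ∀ κ, s * (A κ ⬝ᵥ r) < f r}) (by
      simp only [Set.ofPred_forall]
      refine isOpen_iInter_of_finite fun κ => isOpen_lt ?_ f.continuous
      exact continuous_const.mul (continuous_dot _))
    ⟨x, fun κ => by nlinarith [hx κ]⟩
  obtain ⟨κ, h1, h2⟩ := hS.edge d hd
  have h3 := le_dot_of_mem_segment hz h1 h2
  have h4 := hseg d hd _ hz
  rw [map_smul, smul_eq_mul] at h4
  rw [dotProduct_smul, smul_eq_mul] at h3
  have h5 := mul_le_mul_of_nonneg_left (hr κ).le ht
  nlinarith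

theorem convexHull_subset_hpoly {t : ℝ} (h : ∀ v ∈ S.graph.verts, ∀ i, A i ⬝ᵥ S.coord v ≤ t) :
    convexHull ℝ S.points ⊆ hpoly A t := by
  refine convexHull_min ?_ fun x hx y hy a b ha hb hab i => ?_
  · rintro _ ⟨v, hv, rfl⟩
    exact h v hv
  · exact dot_le_of_mem_segment ⟨a, b, ha, hb, hab, rfl⟩ (hx i) (hy i)

end GraphAlg

namespace GraphAlg

open PlaneGraph

/-! ### The invariants of the configurations -/

variable {m : ℕ} {A : Matrix (Fin m) (Fin 2) ℝ} {ε : ℝ}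

/-- The inequalities treated so far are satisfied up to the error `ε`. -/
def Bounded (A : Matrix (Fin m) (Fin 2) ℝ) (ε : ℝ) (k : ℕ) (S : State) : Prop :=
  ∀ v ∈ S.graph.verts, ∀ i : Fin m, (i : ℕ) < k → A i ⬝ᵥ S.coord v ≤ 1 + ε

/-- The invariants that hold in all reachable configurations. -/
def Invariant (A : Matrix (Fin m) (Fin 2) ℝ) (ε : ℝ) : Config → Prop
  | .head k S => k ≤ m ∧ Sound A S ∧ Bounded A ε k S
  | .first k S T => ∃ hk : k < m, Sound A S ∧ Bounded A ε k S ∧ IsPartition (A ⟨k, hk⟩) ε S T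
  | .second k S T L => ∃ hk : k < m, Sound A S ∧ Bounded A ε k S ∧
      IsPartition (A ⟨k, hk⟩) ε S T ∧
      (∀ d ∈ S.graph.darts, ¬ (d.1 ∈ T.neg ∧ d.2 ∈ T.pos)) ∧
      (∀ q ∈ L, q.1.1 ∈ T.zero ∧ q.2.1 ∈ T.zero) ∧
      ∀ d ∈ borderEdges S.graph T, ∀ e ∈ borderEdges S.graph T,
        (d, e) ∈ L ∨ S.graph.Visited T.pos d.1 e.1

section Partition

variable {a : Fin 2 → ℝ} {S : State} {T : Tri}

theorem IsPartition.one_le (h : IsPartition a ε S T) (hε : 0 ≤ ε) {v : ℕ}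
    (hv : v ∈ S.graph.verts) (hn : v ∉ T.neg) : 1 ≤ a ⬝ᵥ S.coord v := by
  obtain ⟨hu, -, -, -, -, -, hpos, hzero⟩ := h
  rw [← hu, Finset.mem_union, Finset.mem_union] at hv
  rcases hv with (hv | hv) | hv
  · exact absurd hv hn
  · exact (hzero v hv).1
  · have := hpos v hv
    linarith

theorem IsPartition.le_of_notMem_pos (h : IsPartition a ε S T) (hε : 0 ≤ ε) {v : ℕ}
    (hv : v ∈ S.graph.verts) (hp : v ∉ T.pos) : a ⬝ᵥ S.coord v ≤ 1 + ε := by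
  obtain ⟨hu, -, -, -, -, hneg, -, hzero⟩ := h
  rw [← hu, Finset.mem_union, Finset.mem_union] at hv
  rcases hv with (hv | hv) | hv
  · have := hneg v hv
    linarith
  · exact (hzero v hv).2
  · exact absurd hv hp

theorem IsPartition.notMem (h : IsPartition a ε S T) {v : ℕ} (hv : v ∉ S.graph.verts) :
    v ∉ T.neg ∧ v ∉ T.zero ∧ v ∉ T.pos := by
  rw [← h.1] at hv
  simp only [Finset.mem_union, not_or] at hv
  exact ⟨hv.1.1, hv.1.2, hv.2⟩

theorem IsPartition.subdivide (h : IsPartition a ε S T) {u w v : ℕ} {x : Fin 2 → ℝ}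
    (hv : v ∉ S.graph.verts) (h1 : 1 ≤ a ⬝ᵥ x) (h2 : a ⬝ᵥ x ≤ 1 + ε) :
    IsPartition a ε ⟨S.graph.subdivide u w v, Function.update S.coord v x⟩
      ⟨T.neg, insert v T.zero, T.pos⟩ := by
  obtain ⟨hvn, -, hvp⟩ := h.notMem hv
  obtain ⟨hu, hd1, hd2, hd3, hne, hneg, hpos, hzero⟩ := h
  have hcoord : ∀ z, z ≠ v → Function.update S.coord v x z = S.coord z := fun z hz =>
    Function.update_of_ne hz _ _
  refine ⟨?_, ?_, hd2, ?_, hne, fun z hz => ?_, fun z hz => ?_, fun z hz => ?_⟩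
  · change T.neg ∪ insert v T.zero ∪ T.pos = insert v S.graph.verts
    rw [← hu, Finset.union_insert, Finset.insert_union]
  · exact Finset.disjoint_insert_right.2 ⟨hvn, hd1⟩
  · exact Finset.disjoint_insert_left.2 ⟨hvp, hd3⟩
  · simp only [hcoord z fun h => hvn (h ▸ hz)]
    exact hneg z hz
  · simp only [hcoord z fun h => hvp (h ▸ hz)]
    exact hpos z hz
  · by_cases hzv : z = v
    · subst hzv
      simp only [Function.update_self]
      exact ⟨h1, h2⟩
    · simp only [hcoord z hzv]
      exact hzero z (Finset.mem_of_mem_insert_of_ne hz hzv)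

/-- A node set can be partitioned as the algorithm demands. -/
theorem Sound.exists_isPartition (hS : Sound A S) (hε : 0 ≤ ε) (a : Fin 2 → ℝ) :
    ∃ T, IsPartition a ε S T := by
  classical
  obtain ⟨v, hv, hlt⟩ := hS.exists_lt a
  refine ⟨⟨S.graph.verts.filter fun v => a ⬝ᵥ S.coord v < 1 + ε / 2,
    S.graph.verts.filter fun v => a ⬝ᵥ S.coord v = 1 + ε / 2,
    S.graph.verts.filter fun v => 1 + ε / 2 < a ⬝ᵥ S.coord v⟩, ?_, ?_, ?_, ?_,
    ⟨v, Finset.mem_filter.2 ⟨hv, by linarith⟩⟩, fun v hv => (Finset.mem_filter.1 hv).2,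
    fun v hv => (Finset.mem_filter.1 hv).2, fun v hv => ?_⟩
  · ext v
    simp only [Finset.mem_union, Finset.mem_filter]
    have := lt_trichotomy (a ⬝ᵥ S.coord v) (1 + ε / 2)
    tauto
  · exact Finset.disjoint_filter.2 fun v _ h1 h2 => h1.ne h2
  · exact Finset.disjoint_filter.2 fun v _ h1 h2 => lt_asymm h1 h2
  · exact Finset.disjoint_filter.2 fun v _ h1 h2 => h2.ne' h1
  · have := (Finset.mem_filter.1 hv).2
    constructor <;> linarith

end Partition

/-- In the second inner loop, a pair leaves the list only when its nodes are adjacent or no portion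
through `V₊` joins them; later edges do not spoil this, and they create no new border edges. -/
theorem Invariant.step (hε : 0 ≤ ε) {C C' : Config} (hC : Invariant A ε C)
    (h : Step A ε C C') : Invariant A ε C' := by
  cases h with
  | partition k hk S T hT => exact ⟨hk, hC.2.1, hC.2.2, hT⟩
  | subdivide k hk S T u w v x he hu hw hv hx h1 h2 =>
    obtain ⟨_, hS, hB, hT⟩ := hC
    refine ⟨hk, hS.subdivide he hv hx, fun z hz i hi => ?_, hT.subdivide hv h1 h2⟩
    by_cases hzv : z = v
    · subst hzv
      simp only [Function.update_self]
      exact dot_le_of_mem_segment hx (hB u (hS.consistent.fst_mem he) i hi)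
        (hB w (hS.consistent.snd_mem he) i hi)
    · simp only [Function.update_of_ne hzv]
      exact hB z (Finset.mem_of_mem_insert_of_ne hz hzv) i hi
  | toSecond k S T L hend hL =>
    obtain ⟨hk, hS, hB, hT⟩ := hC
    refine ⟨hk, hS, hB, hT, hend, fun q hq => ?_, fun d hd e he => .inl ((hL (d, e)).2 ⟨hd, he⟩)⟩
    have hq' := (hL q).1 hq
    exact ⟨(Finset.mem_filter.1 hq'.1).2.1, (Finset.mem_filter.1 hq'.2).2.1⟩
  | add k S T d e L a b l X hab hX =>
    obtain ⟨hk, hS, hB, hT, hend, hL, hvis⟩ := hC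
    have hab' := hab
    obtain ⟨hne, hadj, ha, hb, had, hbe, hf, hval, hwalk⟩ := hab
    obtain ⟨hdz, hez⟩ := hL (d, e) List.mem_cons_self
    simp only at hdz hez
    rw [← had] at hne hadj hdz hab'
    rw [← hbe] at hne hadj hez hab'
    have hG := hS.consistent
    have hH := hX.consistent hG ha hb hne hadj hf
    have hadd := addsEdge_addEdge hG ha hb hne hadj l X
    have hz : ∀ {v}, v ∈ T.zero → v ∉ T.neg ∧ v ∉ T.pos := fun hv =>
      ⟨fun h => Finset.disjoint_left.1 hT.2.1 h hv,
        fun h => Finset.disjoint_left.1 hT.2.2.2.1 hv h⟩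
    have hborder : ∀ x ∈ borderEdges (S.graph.addEdge a b l X) T, x ∈ borderEdges S.graph T := by
      intro x hx
      obtain ⟨hx, h1, h2⟩ := Finset.mem_filter.1 hx
      rcases (hadd.mem_iff x).1 hx with rfl | rfl | hx
      · exact absurd h2 (hz hez).2
      · exact absurd h2 (hz hdz).2
      · exact Finset.mem_filter.2 ⟨hx, h1, h2⟩
    refine ⟨hk, hS.addEdge (κ := ⟨k, hk⟩) hT.2.2.1 (fun v hv hn => hT.one_le hε hv hn) hab'
      (hz hdz).1 (hz hez).1 hX, hB, hT, fun x hx => ?_,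
      fun q hq => hL q (List.mem_cons_of_mem _ hq), fun x hx y hy => ?_⟩
    · rcases (hadd.mem_iff x).1 hx with rfl | rfl | hx
      · exact fun h => (hz hdz).1 h.1
      · exact fun h => (hz hez).1 h.1
      · exact hend x hx
    · rcases hvis x (hborder x hx) y (hborder y hy) with h | h
      · rcases List.mem_cons.1 h with h | h
        · obtain ⟨rfl, rfl⟩ := Prod.mk.inj h
          refine .inr (.inr (.inl ?_))
          rw [← had, ← hbe]
          exact hadd.fst_mem'
        · exact .inl h
      · exact .inr (hadd.visited hG hH (fun d hd => hX.valid_iff hG hadj hval hd) (hz hdz).2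
          (hz hez).2 h)
  | skip k S T d e L hab =>
    obtain ⟨hk, hS, hB, hT, hend, hL, hvis⟩ := hC
    have hG := hS.consistent
    refine ⟨hk, hS, hB, hT, hend, fun q hq => hL q (List.mem_cons_of_mem _ hq),
      fun x hx y hy => ?_⟩
    rcases hvis x hx y hy with h | h
    · rcases List.mem_cons.1 h with h | h
      · obtain ⟨rfl, rfl⟩ := Prod.mk.inj h
        by_cases hne : x.1 = y.1
        · exact .inr (.inl hne)
        by_cases hadj : (x.1, y.1) ∈ S.graph.darts
        · exact .inr (.inr (.inl hadj))
        -- A remaining portion through `V₊` would make the pair eligible.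
        refine .inr (.inr (.inr fun a ha hval hax n hn hay => ?_))
        exact hab a (S.graph.next^[n] a) ⟨hne, hadj, ha, hG.iterate_next_mem ha n, hax, hay,
          (hG.face_iterate_next ha n).symm, hval, .inl ⟨n, rfl, .inl hn⟩⟩
      · exact .inl h
    · exact .inr h
  | remove k S T =>
    obtain ⟨hk, hS, hB, hT, hend, -, hvis⟩ := hC
    refine ⟨hk, hS.remove (κ := ⟨k, hk⟩) hT.2.2.1 hT.1 (fun v hv hn => hT.one_le hε hv hn) hend
      fun d hd e he => (hvis d hd e he).resolve_left List.not_mem_nil, fun v hv i hi => ?_⟩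
    obtain ⟨hv, hvp⟩ := Finset.mem_sdiff.1 hv
    rcases (Nat.lt_succ_iff.1 hi).eq_or_lt with rfl | hi
    · exact hT.le_of_notMem_pos hε hv hvp
    · exact hB v hv i hi

/-- The algorithm never gets stuck before termination. -/
theorem Invariant.progress (hε : 0 ≤ ε) {C : Config} (hC : Invariant A ε C) :
    (∃ S, C = .head m S) ∨ ∃ C', Step A ε C C' := by
  classical
  cases C with
  | head k S =>
    obtain ⟨hk, hS, -⟩ := hC
    rcases hk.eq_or_lt with rfl | hk
    · exact .inl ⟨S, rfl⟩
    · obtain ⟨T, hT⟩ := hS.exists_isPartition hε (A ⟨k, hk⟩)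
      exact .inr ⟨_, .partition k hk S T hT⟩
  | first k S T =>
    obtain ⟨hk, hS, hB, hT⟩ := hC
    right
    by_cases hend : ∀ d ∈ S.graph.darts, ¬ (d.1 ∈ T.neg ∧ d.2 ∈ T.pos)
    · exact ⟨_, .toSecond k S T
        (borderEdges S.graph T ×ˢ borderEdges S.graph T).toList hend (by simp)⟩
    · push Not at hend
      obtain ⟨⟨u, w⟩, he, hu, hw⟩ := hend
      obtain ⟨v, hv⟩ := Infinite.exists_notMem_finset S.graph.verts
      have h1 := hT.2.2.2.2.2.1 u hu
      have h2 := hT.2.2.2.2.2.2.1 w hw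
      have hd : 0 < A ⟨k, hk⟩ ⬝ᵥ S.coord w - A ⟨k, hk⟩ ⬝ᵥ S.coord u := by linarith
      -- Chosen so that the new point lies on the middle line of the admissible strip.
      set t := (1 + ε / 2 - A ⟨k, hk⟩ ⬝ᵥ S.coord u) /
        (A ⟨k, hk⟩ ⬝ᵥ S.coord w - A ⟨k, hk⟩ ⬝ᵥ S.coord u) with ht
      have ht0 : 0 ≤ t := div_nonneg (by linarith) hd.le
      have ht1 : t ≤ 1 := (div_le_one hd).2 (by linarith)
      have hx : A ⟨k, hk⟩ ⬝ᵥ ((1 - t) • S.coord u + t • S.coord w) = 1 + ε / 2 := by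
        rw [dotProduct_add, dotProduct_smul, dotProduct_smul, smul_eq_mul, smul_eq_mul]
        have : t * (A ⟨k, hk⟩ ⬝ᵥ S.coord w - A ⟨k, hk⟩ ⬝ᵥ S.coord u) =
          1 + ε / 2 - A ⟨k, hk⟩ ⬝ᵥ S.coord u := div_mul_cancel₀ _ hd.ne'
        linarith
      exact ⟨_, .subdivide k hk S T u w v _ he hu hw hv
        ⟨1 - t, t, by linarith, ht0, by ring, rfl⟩ (by linarith) (by linarith)⟩
  | second k S T L =>
    obtain ⟨hk, hS, -⟩ := hC
    have hG := hS.consistent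
    right
    cases L with
    | nil => exact ⟨_, .remove k S T⟩
    | cons q L =>
      obtain ⟨d, e⟩ := q
      by_cases hab : ∃ a b, Eligible S.graph T d.1 e.1 a b
      · obtain ⟨a, b, hab⟩ := hab
        have hab' := hab
        obtain ⟨hne, hadj, ha, hb, had, hbe, -, -, hwalk⟩ := hab
        rw [← had, ← hbe] at hne hadj
        -- The eligible walk may lead from `b` to `a`; bounding walks are periodic, so `b` is also
        -- reached from `a`.
        have hw : ∃ n, S.graph.next^[n] a = b := by
          rcases hwalk with ⟨n, hn, -⟩ | ⟨n, hn, -⟩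
          · exact ⟨n, hn⟩
          · exact exists_iterate_symm (Finset.finite_toSet _) hG.2.1 hb ⟨n, hn⟩
        obtain ⟨l, X, hX⟩ := hG.exists_isSplitting ha hb hne hadj hw
        exact ⟨_, .add k S T d e L a b l X hab' hX⟩
      · push Not at hab
        exact ⟨_, .skip k S T d e L hab⟩

/-- A quantity that decreases in every step. -/
def rank (m : ℕ) : Config → ℕ ×ₗ ℕ ×ₗ ℕ
  | .head k _ => toLex (m - k, toLex (2, 0))
  | .first k S T => toLex (m - k,
      toLex (1, (S.graph.darts.filter fun d => d.1 ∈ T.neg ∧ d.2 ∈ T.pos).card))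
  | .second k _ _ L => toLex (m - k, toLex (0, L.length))

/-- Subdividing removes one edge between `V₋` and `V₊` and creates none, as the new node is in `V₀`;
visiting a pair shortens the list, and the other steps lower the phase or the number of remaining
rows. -/
theorem Step.rank_lt {C C' : Config} (hC : Invariant A ε C) (h : Step A ε C C') :
    rank m C' < rank m C := by
  have hsnd : ∀ {i x y : ℕ} {p q : ℕ}, x < y ∨ x = y ∧ p < q →
      (toLex (i, toLex (x, p)) : ℕ ×ₗ ℕ ×ₗ ℕ) < toLex (i, toLex (y, q)) := by
    intro i x y p q hlt
    refine Prod.Lex.toLex_lt_toLex.2 (.inr ⟨rfl, Prod.Lex.toLex_lt_toLex.2 hlt⟩)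
  cases h with
  | partition k hk S T hT => exact hsnd (.inl (by norm_num))
  | subdivide k hk S T u w v x he hu hw hv hx h1 h2 =>
    obtain ⟨_, hS, _, hT⟩ := hC
    obtain ⟨hvn, -, hvp⟩ := hT.notMem hv
    refine hsnd (.inr ⟨rfl, Finset.card_lt_card ?_⟩)
    refine (Finset.ssubset_iff_of_subset fun d hd => ?_).2 ⟨(u, w), ?_, ?_⟩
    · obtain ⟨hd, h3, h4⟩ := Finset.mem_filter.1 hd
      rcases (hS.consistent.mem_subdivide he).1 hd with ⟨y, hy, rfl⟩ | rfl | rfl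
      · by_cases hy1 : y = (u, w)
        · subst hy1; rw [subdart_uw] at h4; exact absurd h4 hvp
        by_cases hy2 : y = (w, u)
        · subst hy2
          rw [subdart_wu (hS.consistent.fst_ne_snd he)] at h4
          exact absurd h4 hvp
        · rw [subdart_of_ne hy1 hy2] at h3 h4 ⊢
          exact Finset.mem_filter.2 ⟨hy, h3, h4⟩
      · exact absurd h3 hvn
      · exact absurd h3 hvn
    · exact Finset.mem_filter.2 ⟨he, hu, hw⟩
    · intro hd
      obtain ⟨hd, -, -⟩ := Finset.mem_filter.1 hd
      have hne := hS.consistent.ne_of_notMem hv he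
      rcases (hS.consistent.mem_subdivide he).1 hd with ⟨y, hy, hyu⟩ | h3 | h3
      · by_cases hy1 : y = (u, w)
        · subst hy1
          rw [subdart_uw] at hyu
          exact hne.2 (Prod.mk.inj hyu).2.symm
        by_cases hy2 : y = (w, u)
        · subst hy2
          rw [subdart_wu (hS.consistent.fst_ne_snd he)] at hyu
          exact hne.2 (Prod.mk.inj hyu).2.symm
        · rw [subdart_of_ne hy1 hy2] at hyu
          exact hy1 hyu
      · exact hne.1 (Prod.mk.inj h3).1
      · exact hne.1 (Prod.mk.inj h3).1
  | toSecond k S T L hend hL => exact hsnd (.inl (by norm_num))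
  | add k S T d e L a b l X hab hX => exact hsnd (.inr ⟨rfl, by simp⟩)
  | skip k S T d e L hab => exact hsnd (.inr ⟨rfl, by simp⟩)
  | remove k S T =>
    obtain ⟨hk, -⟩ := hC
    exact Prod.Lex.toLex_lt_toLex.2 (.inl (by change m - (k + 1) < m - k; omega))

/-! ### The initial configurations -/

section Initial

variable (hm : 3 ≤ m)

theorem exists_isInitial (hS : IsTriangle (hpoly (firstRows hm A) 1)) (hε : 0 ≤ ε) :
    ∃ C, IsInitial hm A ε C := by
  obtain ⟨p, hp, hT⟩ := isTriangle_hpoly hS (show 0 < 1 + ε / 2 by linarith)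
  refine ⟨_, fun v => p (Fin.ofNat 3 v), ?_, rfl⟩
  rw [hT, extremePoints_convexHull_range hp]
  have hverts : ∀ v ∈ (K3.verts : Set ℕ), v < 3 := by
    intro v hv
    have : ∀ v ∈ K3.verts, v < 3 := by decide
    exact this v hv
  refine ⟨fun v _ => ⟨_, rfl⟩, fun v hv w hw hvw => ?_, ?_⟩
  · have h1 := hp.injective hvw
    have h2 := congrArg Fin.val h1
    simp only [Fin.ofNat, Nat.mod_eq_of_lt (hverts v hv), Nat.mod_eq_of_lt (hverts w hw)] at h2
    exact h2
  · rintro _ ⟨i, rfl⟩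
    refine ⟨i, ?_, ?_⟩
    · fin_cases i <;> simp [K3]
    · simp

/-- The initial bijection may list the vertices in any order; the permutation `σ` transports affine
independence and the convex hull. -/
theorem IsInitial.exists_coord {C : Config}
    (hS : IsTriangle (hpoly (firstRows hm A) 1)) (hε : 0 ≤ ε) (hC : IsInitial hm A ε C) :
    ∃ c : ℕ → Fin 2 → ℝ, AffineIndependent ℝ (fun i : Fin 3 => c i) ∧
      hpoly (firstRows hm A) (1 + ε / 2) =
        convexHull ℝ (Set.range fun i : Fin 3 => c i) ∧ C = .head 3 ⟨K3, c⟩ := by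
  obtain ⟨c, hc, rfl⟩ := hC
  obtain ⟨p, hp, hT⟩ := isTriangle_hpoly hS (show 0 < 1 + ε / 2 by linarith)
  rw [hT, extremePoints_convexHull_range hp] at hc
  have hverts : ∀ i : Fin 3, (i : ℕ) ∈ (K3.verts : Set ℕ) := by
    intro i
    fin_cases i <;> simp [K3]
  have hσ : ∀ i : Fin 3, ∃ j, p j = c i := fun i => hc.mapsTo (hverts i)
  choose σ hσ using hσ
  have hinj : Function.Injective σ := by
    intro i j hij
    refine Fin.ext (hc.injOn (hverts i) (hverts j) ?_)
    rw [← hσ i, ← hσ j, hij]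
  have hsurj : Function.Surjective σ := Finite.surjective_of_injective hinj
  have he : (fun i : Fin 3 => c i) = p ∘ σ := funext fun i => (hσ i).symm
  refine ⟨c, ?_, ?_, rfl⟩
  · rw [he]
    exact hp.comp_embedding ⟨σ, hinj⟩
  · rw [he, hsurj.range_comp, hT]

theorem IsInitial.invariant (hS : IsTriangle (hpoly (firstRows hm A) 1)) (hε : 0 ≤ ε)
    {C : Config} (hC : IsInitial hm A ε C) : Invariant A ε C := by
  classical
  have hs : 0 < 1 + ε / 2 := by linarith
  obtain ⟨c, hc, hT, rfl⟩ := hC.exists_coord hm hS hε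
  have hmem : ∀ v ∈ K3.verts, ∃ i : Fin 3, (i : ℕ) = v := by decide
  have htight : ∀ {i j : Fin 3}, i ≠ j → ∃ κ : Fin m,
      A κ ⬝ᵥ c i = 1 + ε / 2 ∧ A κ ⬝ᵥ c j = 1 + ε / 2 := by
    intro i j hij
    obtain ⟨κ, hκ⟩ := exists_tight hc hT hij
    exact ⟨_, hκ⟩
  refine ⟨hm, ⟨consistent_K3, cyclesBound_K3, uniqueInvalid_K3, fun d hd => ?_,
    K3.verts.image c, fun p hp => ?_, fun v hv => Finset.mem_image_of_mem _ hv,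
    fun r hr => ⟨(0, 1), isOddDart_K3 ?_⟩⟩, fun v hv i hi => ?_⟩
  · obtain ⟨i, hi⟩ := hmem d.1 (consistent_K3.fst_mem hd)
    obtain ⟨j, hj⟩ := hmem d.2 (consistent_K3.snd_mem hd)
    have hij : i ≠ j := by
      rintro rfl
      exact consistent_K3.fst_ne_snd hd (hi.symm.trans hj)
    obtain ⟨κ, h1, h2⟩ := htight hij
    rw [hi] at h1
    rw [hj] at h2
    exact ⟨κ, by simp only; linarith, by simp only; linarith⟩
  · obtain ⟨v, hv, rfl⟩ := Finset.mem_image.1 hp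
    obtain ⟨i, rfl⟩ := hmem v hv
    -- Any second vertex provides a row that equals `1 + ε / 2` at `c i`, so `c i` is not the
    -- origin.
    obtain ⟨κ, h1, -⟩ := htight ((by decide : ∀ i : Fin 3, i ≠ i + 1) i)
    intro h0
    rw [h0, dotProduct_zero] at h1
    linarith
  · obtain ⟨w, hw, hw0⟩ := exists_pos_combination hc hT hs
    rw [Fin.sum_univ_three] at hw0
    obtain ⟨κ, h1, h2⟩ := htight (show (0 : Fin 3) ≠ 1 by decide)
    refine crossing_triangle (hw 0) (hw 1) (hw 2) hw0
      (det2_ne_zero_of_tight hs h1 h2 fun h => ?_) fun i hi => hr _ (Finset.mem_image_of_mem _ ?_)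
    · exact absurd (hc.injective (show c (0 : Fin 3) = c (1 : Fin 3) from h)) (by decide)
    · interval_cases i <;> decide
  · obtain ⟨j, rfl⟩ := hmem v hv
    have h1 : c j ∈ hpoly (firstRows hm A) (1 + ε / 2) :=
      hT ▸ subset_convexHull ℝ _ ⟨j, rfl⟩
    have h2 := h1 ⟨i, hi⟩
    change A i ⬝ᵥ c j ≤ _ at h2
    change A i ⬝ᵥ c j ≤ 1 + ε
    linarith

theorem Reachable.invariant (hS : IsTriangle (hpoly (firstRows hm A) 1)) (hε : 0 ≤ ε)
    {C : Config} (hC : Reachable hm A ε C) : Invariant A ε C := by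
  obtain ⟨C₀, h₀, h⟩ := hC
  induction h with
  | refl => exact h₀.invariant hm hS hε
  | tail _ hstep ih => exact ih.step hε hstep

end Initial

end GraphAlg
-- Correctness of the algorithm
theorem mainTheorem2 {m : ℕ} (hm : 3 ≤ m) (A : Matrix (Fin m) (Fin 2) ℝ)
    (hS : GraphAlg.IsTriangle (GraphAlg.hpoly (GraphAlg.firstRows hm A) 1))
    (ε : ℝ) (hε : 0 ≤ ε) :
    -- the algorithm can start, and it never gets stuck before termination
    (∃ C, GraphAlg.IsInitial hm A ε C) ∧
    (∀ C, GraphAlg.Reachable hm A ε C →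
      (∃ S, C = .head m S) ∨ (∃ C', GraphAlg.Step A ε C C')) ∧
    -- every run is finite
    (∀ C : ℕ → GraphAlg.Config, GraphAlg.IsInitial hm A ε (C 0) →
      ¬ ∀ n, GraphAlg.Step A ε (C n) (C (n + 1))) ∧
    -- the invariants hold after the initialization and after every outer iteration
    (∀ k S, GraphAlg.Reachable hm A ε (.head k S) →
      S.graph.Consistent ∧ GraphAlg.Regular A S) ∧
    -- the output is an approximate V-representation
    (∀ S, GraphAlg.Reachable hm A ε (.head m S) →
      GraphAlg.hpoly A 1 ⊆ convexHull ℝ S.points ∧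
      convexHull ℝ S.points ⊆ GraphAlg.hpoly A (1 + ε)) := by
  have hinv := fun {C} hC => GraphAlg.Reachable.invariant (C := C) hm hS hε hC
  refine ⟨GraphAlg.exists_isInitial hm hS hε, fun C hC => (hinv hC).progress hε,
    fun C h₀ hstep => ?_, fun k S hC => ⟨(hinv hC).2.1.consistent, (hinv hC).2.1.regular⟩,
    fun S hC => ⟨(hinv hC).2.1.hpoly_subset_convexHull,
      GraphAlg.convexHull_subset_hpoly fun v hv i => (hinv hC).2.2 v hv i i.2⟩⟩
  have hC : ∀ n, GraphAlg.Invariant A ε (C n) := by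
    intro n
    induction n with
    | zero => exact h₀.invariant hm hS hε
    | succ n ih => exact ih.step hε (hstep n)
  -- An infinite run would have a configuration of least rank, but the next step lowers the rank.
  obtain ⟨_, ⟨n, rfl⟩, hmin⟩ := WellFounded.has_min (wellFounded_lt (α := ℕ ×ₗ ℕ ×ₗ ℕ))
    (Set.range fun n => GraphAlg.rank m (C n)) ⟨_, 0, rfl⟩
  exact hmin _ ⟨n + 1, rfl⟩ ((hstep n).rank_lt (hC n))
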